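/- **Setting.** Let $R$ be an irreducible, finite, crystallographic, not necessarily reduced root system spanning a real inner product space $V$, with simple roots $\alpha_1,\dots,\alpha_n$, positive roots $R^+$, coroots $\alpha^\vee=2\alpha/\langle\alpha,\alpha\rangle$, Weyl group $W_0$ and simple reflections $s_i=s_{\alpha_i}$, where $s_\alpha(\lambda)=\lambda-\langle\lambda,\alpha\rangle\alpha^\vee$. Let $R_1$ be the set of $\alpha\in R$ with $\alpha/2,2\alpha\notin R$, let $R_2=\{\alpha\in R\mid 2\alpha\in R\}$, $R_0=R_1\cup R_2$ and $R_0^+=R_0\cap R^+$. (If $R$ is reduced, $R_0=R$; otherwise $R$ is of type $BC_n$, and its simple roots are numbered so that $\alpha_n$ is the one in $R_2$.) For $w\in W_0$ let $R(w)=\{\alpha\in R_0^+\mid w^{-1}\alpha\in -R_0^+\}$. Let $Q$ be the $\mathbb Z$-span of all coroots, $P=\{\lambda\in V\mid\langle\lambda,\alpha\rangle\in\mathbb Z\ \forall\alpha\in R\}$, and let $L$ be a lattice with $Q\subseteq L\subseteq P$. Let $q_0,q_1,\dots,q_n>1$ be real numbers with $q_i=q_j$ whenever $i,j\ge1$ and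 $s_i,s_j$ are conjugate in $W_0$ ($q_0$ matters only if $R$ is non-reduced). For $\alpha\in R_0$ put $q_\alpha=q_i$ if $\alpha\in W_0\alpha_i$. In the group algebra $\mathbb C[L]$, with basis $x^\lambda$ ($\lambda\in L$), put $d_\alpha=1-x^{-\alpha^\vee}$ for $\alpha\in R_0$, and $$a_\alpha=1-q_\alpha^{-1},\qquad n_\alpha=1-q_\alpha^{-1}x^{-\alpha^\vee}\qquad(\alpha\in R_1),$$ $$a_\alpha=1-q_n^{-1}+\bigl(q_0^{1/2}q_n^{-1/2}-q_0^{-1/2}q_n^{-1/2}\bigr)x^{-\alpha^\vee/2},\qquad n_\alpha=\bigl(1-q_0^{-1/2}q_n^{-1/2}x^{-\alpha^\vee/2}\bigr)\bigl(1+q_0^{1/2}q_n^{-1/2}x^{-\alpha^\vee/2}\bigr)\qquad(\alpha\in R_2),$$ $b_\alpha=a_\alpha/d_\alpha$ and $c_\alpha=n_\alpha/d_\alpha$. Write $a_i,b_i,c_i,d_i$ for $\alpha=\alpha_i$. For a character $t\in\mathrm{Hom}(L,\mathbb C^\times)$ write $t^\lambda=t(\lambda)$, let $f(t)$ be the value of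 $f$ under $x^\lambda\mapsto t^\lambda$, and let $(wt)^\lambda=t^{w^{-1}\lambda}$ for $w\in W_0$. The affine Hecke algebra $\mathscr H_L$ is the unital $\mathbb C$-algebra with generators $T_1,\dots,T_n$ and $x^\lambda$ ($\lambda\in L$), and relations $T_i^2=1+(q_i^{1/2}-q_i^{-1/2})T_i$; $T_iT_jT_i\cdots=T_jT_iT_j\cdots$ ($m_{ij}$ factors on each side, $m_{ij}$ being the order of $s_is_j$, $i\neq j$); $x^0=1$ and $x^\lambda x^\mu=x^{\lambda+\mu}$; and $T_ix^\lambda-x^{s_i\lambda}T_i=q_i^{1/2}a_i\,\dfrac{x^\lambda-x^{s_i\lambda}}{1-x^{-\alpha_i^\vee}}$, where the fraction is an element of $\mathbb C[L]$. For a character $t$ let $$N(t)=\{\alpha\in R_0^+\mid n_\alpha(t)n_{-\alpha}(t)=0\},\qquad D(t)=\{\alpha\in R_0^+\mid d_\alpha(t)=0\},$$ and for $J\subseteq N(t)$ let $$F_J(t)=\{w\in W_0\mid R(w^{-1})\cap N(t)=J,\ R(w^{-1})\cap D(t)=\emptyset\}.$$ For $1\le i,j\le n$ let $R_{ij}=R\cap(\mathbb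 Z\alpha_i+\mathbb Z\alpha_j)$. A character $t$ is *$(i,j)$-regular* if $(wt)^{\alpha_i^\vee}\ne1$ and $(wt)^{\alpha_j^\vee}\neq1$ for all $w\in\langle s_i,s_j\rangle$. It is *$(i,j)$-calibratable* if, possibly after interchanging $i$ and $j$, one of the following holds: 1. $t$ is $(i,j)$-regular. 2. $R_{ij}$ is of type $C_2$ with $\alpha_i$ short and $\alpha_j$ long, and (a) $q_i=q_j$ and $(t^{\alpha_i^\vee},t^{\alpha_j^\vee})\in\{(q_i,q_i^{-1}),(q_i^{-1},q_i)\}$, or (b) $q_i=q_j^2$ and $(t^{\alpha_i^\vee},t^{\alpha_j^\vee})\in\{(q_j^{-2},q_j),(q_j^{2},q_j^{-1})\}$. 3. $R_{ij}$ is of type $G_2$ with $\alpha_i$ short and $\alpha_j$ long, and (a) $q_i=q_j$ and $(t^{\alpha_i^\vee},t^{\alpha_j^\vee})\in\{(q_i^{-1},q_i),(q_i,q_i^{-1}),(q_i^2,q_i^{-1}),(q_i^{-2},q_i)\}$, or (b) $q_i=q_j^3$ and $(t^{\alpha_i^\vee},t^{\alpha_j^\vee})\in\{(q_j^3,q_j^{-1}),(q_j^{-3},q_j),(q_j^{-3},q_j^2),(q_j^3,q_j^{-2})\}$.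 4. $R_{ij}$ is of type $BC_2$ with $\alpha_i$ of middle length and $\alpha_j$ short (so $j=n$), and (a) $q_i=q_0q_j$ and $(t^{\alpha_i^\vee},t^{\alpha_j^\vee/2})\in\{(q_0q_j,q_0^{-1/2}q_j^{-1/2}),(q_0^{-1}q_j^{-1},q_0^{1/2}q_j^{1/2})\}$, or (b) $q_i\in\{q_0q_j^{-1},q_0^{-1}q_j\}$ and $(t^{\alpha_i^\vee},t^{\alpha_j^\vee/2})\in\{(q_0^{-1}q_j,-q_0^{1/2}q_j^{-1/2}),(q_0q_j^{-1},-q_0^{-1/2}q_j^{1/2})\}$, or (c) $q_i=q_0^{1/2}q_j^{1/2}$ and $(t^{\alpha_i^\vee},t^{\alpha_j^\vee/2})\in\{(q_i^{-1},q_i),(q_i,q_i^{-1})\}$, or (d) $q_i\in\{q_0^{-1/2}q_j^{1/2},q_0^{1/2}q_j^{-1/2}\}$ and $(t^{\alpha_i^\vee},t^{\alpha_j^\vee/2})\in\{(q_i^{-1},-q_i),(q_i,-q_i^{-1})\}$. **Theorem.** Let $t\in\mathrm{Hom}(L,\mathbb C^\times)$ and let $J\subseteq N(t)$ with $F_J(t)\ne\emptyset$.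 Suppose that for every $w\in F_J(t)$ the character $wt$ is $(i,j)$-calibratable for all $1\le i,j\le n$ (including $i=j$, which is an additional requirement only if $n=1$). Let $M_J(t)$ be the complex vector space with basis $\{e_w\mid w\in F_J(t)\}$, and put $e_v=0$ for $v\notin F_J(t)$. Then $d_i(wt)\ne0$ for all $w\in F_J(t)$ and all $i$, and there is a representation $\mathscr H_L\to\mathrm{End}(M_J(t))$, $T_i\mapsto\tilde T_i$, $x^\lambda\mapsto\tilde x^\lambda$, given by $$\tilde x^\lambda e_w=(wt)^\lambda e_w\quad(\lambda\in L),\qquad \tilde T_ie_w=q_i^{1/2}b_i(wt)e_w+q_i^{1/2}c_i(wt)e_{s_iw}\quad(1\le i\le n)$$ for $w\in F_J(t)$. Moreover, if $wt\ne w't$ for all $w\neq w'$ in $F_J(t)$, then $M_J(t)$ is irreducible. In particular, $M_J(t)$ is irreducible if $L=P$. -/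

import Mathlib

namespace CalibratedHecke

noncomputable section

open scoped Classical

variable {ι V V' : Type*} [AddCommGroup V] [Module ℝ V] [AddCommGroup V'] [Module ℝ V']

/-! ### Root systems

`P : RootPairing ι ℝ V V'` is a root system which is not assumed to be reduced: `P.root k` is the
root with index `k`, and `P.coroot k` is its coroot, a vector of the dual space `V'`, which an
invariant inner product identifies with `V`. Sets of roots are given as sets of indices. -/

/-- A system of simple roots. (Mathlib's `RootPairing.Base` also wants every coroot to be an
integral combination of simple coroots, which fails for non-reduced systems.) -/
structure SimpleSystem (P : RootPairing ι ℝ V V') (n : ℕ) where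
  simple : Fin n → ι
  linearIndependent : LinearIndependent ℝ fun i => P.root (simple i)
  nonneg_or_nonpos : ∀ k : ι,
    (∃ c : Fin n → ℕ, P.root k = ∑ i, c i • P.root (simple i)) ∨
    (∃ c : Fin n → ℕ, P.root k = -∑ i, c i • P.root (simple i))

/-- The index of the root `-α`. -/
def negIdx (P : RootPairing ι ℝ V V') (k : ι) : ι := P.reflectionPerm k k

theorem root_negIdx (P : RootPairing ι ℝ V V') (k : ι) : P.root (negIdx P k) = -P.root k := by
  simp [negIdx, P.root_reflectionPerm, P.reflection_apply_self]

/-- Roots `α` such that neither `α / 2` nor `2 α` is a root. -/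
def R1 (P : RootPairing ι ℝ V V') : Set ι :=
  {k | (∀ m, P.root k ≠ (2 : ℝ) • P.root m) ∧ ∀ m, P.root m ≠ (2 : ℝ) • P.root k}

/-- Roots `α` such that `2 α` is a root. -/
def R2 (P : RootPairing ι ℝ V V') : Set ι := {k | ∃ m, P.root m = (2 : ℝ) • P.root k}

def R0 (P : RootPairing ι ℝ V V') : Set ι := R1 P ∪ R2 P

/-- The simple reflections, as elements of the Weyl group `W₀`. -/
def SimpleSystem.s {P : RootPairing ι ℝ V V'} {n : ℕ} (B : SimpleSystem P n) (i : Fin n) :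
    P.weylGroup := RootPairing.weylGroup.ofIdx P (B.simple i)

/-- `R₀⁺ = R₀ ∩ R⁺`. -/
def SimpleSystem.R0pos {P : RootPairing ι ℝ V V'} {n : ℕ} (B : SimpleSystem P n) : Set ι :=
  {k | k ∈ R0 P ∧ ∃ c : Fin n → ℕ, P.root k = ∑ i, c i • P.root (B.simple i)}

/-- `R(w) = {α ∈ R₀⁺ | w⁻¹ α ∈ -R₀⁺}`. -/
def SimpleSystem.inversionSet {P : RootPairing ι ℝ V V'} {n : ℕ} (B : SimpleSystem P n)
    (w : P.weylGroup) : Set ι :=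
  {k | k ∈ B.R0pos ∧ negIdx P (w⁻¹ • k) ∈ B.R0pos}

/-! ### Lattices -/

/-- The coroot lattice `Q`. -/
def corootLattice (P : RootPairing ι ℝ V V') : AddSubgroup V' :=
  AddSubgroup.closure (Set.range P.coroot)

/-- The coweight lattice `P`: the vectors on which all roots take integral values. -/
def coweightLattice (P : RootPairing ι ℝ V V') : AddSubgroup V' where
  carrier := {v | ∀ k, ∃ m : ℤ, P.toLinearMap (P.root k) v = m}
  zero_mem' := fun k => ⟨0, by simp⟩
  add_mem' := by
    intro a b ha hb k
    obtain ⟨m, hm⟩ := ha k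
    obtain ⟨l, hl⟩ := hb k
    exact ⟨m + l, by simp [hm, hl]⟩
  neg_mem' := by
    intro a ha k
    obtain ⟨m, hm⟩ := ha k
    exact ⟨-m, by simp [hm]⟩

/-- A lattice `L` with `Q ⊆ L ⊆ P`. -/
structure TranslationLattice (P : RootPairing ι ℝ V V') where
  carrier : AddSubgroup V'
  corootLattice_le : corootLattice P ≤ carrier
  le_coweightLattice : carrier ≤ coweightLattice P

namespace TranslationLattice

variable {P : RootPairing ι ℝ V V'} (L : TranslationLattice P)

/-- `α^∨` as an element of `L`. -/
def coroot (k : ι) : L.carrier :=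
  ⟨P.coroot k, L.corootLattice_le (AddSubgroup.subset_closure (Set.mem_range_self k))⟩

/-- `α^∨ / 2 = (2 α)^∨` as an element of `L`, for a root `α` such that `2 α` is a root. -/
def halfCoroot (k : ι) : L.carrier :=
  if h : ∃ m, P.root m = (2 : ℝ) • P.root k then L.coroot h.choose else 0

theorem coe_halfCoroot [Finite ι] {k : ι} (hk : k ∈ R2 P) :
    (L.halfCoroot k : V') = (2 : ℝ)⁻¹ • P.coroot k := by
  have h : ∃ m, P.root m = (2 : ℝ) • P.root k := hk
  have : IsAddTorsionFree V' := .of_isTorsionFree ℝ V'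
  have h1 := P.smul_coroot_eq_of_root_eq_smul k h.choose 2 h.choose_spec
  rw [halfCoroot, dif_pos h, ← h1, smul_smul]
  simp [coroot]

/-- The integer `⟨λ, α⟩`. -/
def pair (k : ι) (v : L.carrier) : ℤ := (L.le_coweightLattice v.2 k).choose

theorem pair_spec (k : ι) (v : L.carrier) : P.toLinearMap (P.root k) v = (L.pair k v : ℝ) :=
  (L.le_coweightLattice v.2 k).choose_spec

theorem smul_mem (w : P.weylGroup) {v : V'} (hv : v ∈ L.carrier) :
    MulOpposite.op (w : P.Aut) • v ∈ L.carrier := by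
  obtain ⟨g, hg⟩ := w
  change MulOpposite.op g • v ∈ L.carrier
  induction hg using RootPairing.weylGroup.induction generalizing v with
  | mem k =>
    change P.coreflection k v ∈ L.carrier
    rw [P.coreflection_apply]
    have h2 := L.pair_spec k ⟨v, hv⟩
    simp only at h2
    have : P.root' k v • P.coroot k = L.pair k ⟨v, hv⟩ • P.coroot k := by
      rw [← Int.cast_smul_eq_zsmul ℝ, ← h2]
    rw [this]
    exact sub_mem hv (zsmul_mem (L.coroot k).2 _)
  | one => simpa using hv
  | mul x y hx hy hx' hy' =>
    rw [MulOpposite.op_mul, mul_smul]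
    exact hy' (hx' hv)

/-- The action of `W₀` on `L`. Automorphisms of a root pairing act on the coweight space from the
right, so that `w` acts on the left through `w⁻¹`. -/
def act (w : P.weylGroup) : L.carrier →+ L.carrier where
  toFun v := ⟨MulOpposite.op ((w⁻¹ : P.weylGroup) : P.Aut) • (v : V'), L.smul_mem w⁻¹ v.2⟩
  map_zero' := by ext; simp
  map_add' := by intro x y; ext; simp

theorem act_mul (w w' : P.weylGroup) (v : L.carrier) : L.act (w * w') v = L.act w (L.act w' v) := by
  ext
  change MulOpposite.op (((w * w')⁻¹ : P.weylGroup) : P.Aut) • (v : V') =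
    MulOpposite.op ((w⁻¹ : P.weylGroup) : P.Aut) •
      MulOpposite.op ((w'⁻¹ : P.weylGroup) : P.Aut) • (v : V')
  rw [smul_smul, mul_inv_rev, ← MulOpposite.op_mul]
  rfl

/-- `s_α λ = λ - ⟨λ, α⟩ α^∨`. -/
theorem act_reflection (k : ι) (v : L.carrier) :
    L.act (RootPairing.weylGroup.ofIdx P k) v = v - L.pair k v • L.coroot k := by
  ext
  have h : (RootPairing.weylGroup.ofIdx P k)⁻¹ = RootPairing.weylGroup.ofIdx P k := by
    apply Subtype.ext
    exact RootPairing.Equiv.reflection_inv P k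
  change MulOpposite.op (((RootPairing.weylGroup.ofIdx P k)⁻¹ : P.weylGroup) : P.Aut) • (v : V') = _
  rw [h]
  change P.coreflection k v = _
  rw [P.coreflection_apply]
  have : P.root' k (v : V') • P.coroot k = L.pair k v • P.coroot k := by
    rw [← Int.cast_smul_eq_zsmul ℝ, ← L.pair_spec k v]
  rw [this]
  rfl

/-- The group algebra `ℂ[L]`. -/
abbrev GroupAlg : Type _ := AddMonoidAlgebra ℂ L.carrier

/-- The basis element `x^λ` of `ℂ[L]`. -/
def mon (v : L.carrier) : L.GroupAlg := AddMonoidAlgebra.single v 1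

/-- The element `(x^λ - x^{s_α λ}) / (1 - x^{-α^∨})` of `ℂ[L]`, see `mul_divDiff`. -/
def divDiff (k : ι) (v : L.carrier) : L.GroupAlg :=
  (∑ m ∈ Finset.range (L.pair k v).toNat, L.mon (v - m • L.coroot k)) -
    ∑ m ∈ Finset.range (-L.pair k v).toNat, L.mon (v + (m + 1) • L.coroot k)

theorem mon_mul (u v : L.carrier) : L.mon u * L.mon v = L.mon (u + v) := by
  simp [mon, AddMonoidAlgebra.single_mul_single]

theorem mul_divDiff (k : ι) (v : L.carrier) :
    (1 - L.mon (-L.coroot k)) * L.divDiff k v =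
      L.mon v - L.mon (L.act (RootPairing.weylGroup.ofIdx P k) v) := by
  have h1 : ∀ N : ℕ, (1 - L.mon (-L.coroot k)) *
      ∑ m ∈ Finset.range N, L.mon (v - m • L.coroot k) = L.mon v - L.mon (v - N • L.coroot k) := by
    intro N
    induction N with
    | zero => simp
    | succ N ih =>
      rw [Finset.sum_range_succ, mul_add, ih, sub_mul, one_mul, mon_mul,
        show -L.coroot k + (v - N • L.coroot k) = v - (N + 1) • L.coroot k by
          rw [add_smul, one_smul]; abel]
      abel
  have h2 : ∀ N : ℕ, (1 - L.mon (-L.coroot k)) *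
      ∑ m ∈ Finset.range N, L.mon (v + (m + 1) • L.coroot k) =
        L.mon (v + N • L.coroot k) - L.mon v := by
    intro N
    induction N with
    | zero => simp
    | succ N ih =>
      rw [Finset.sum_range_succ, mul_add, ih, sub_mul, one_mul, mon_mul,
        show -L.coroot k + (v + (N + 1) • L.coroot k) = v + N • L.coroot k by
          rw [add_smul, one_smul]; abel]
      abel
  rw [divDiff, mul_sub, h1, h2, act_reflection]
  rcases le_total 0 (L.pair k v) with h | h
  · obtain ⟨N, hN⟩ := Int.eq_ofNat_of_zero_le h
    simp [hN]
  · obtain ⟨N, hN⟩ := Int.eq_ofNat_of_zero_le (neg_nonneg.mpr h)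
    have hN' : L.pair k v = -(N : ℤ) := by omega
    simp [hN']

/-- `f(t)` for `f ∈ ℂ[L]` and a character `t` of `L`; thus `x^λ` has the value `t^λ = t λ`. -/
def eval (t : AddChar L.carrier ℂ) : L.GroupAlg →ₐ[ℂ] ℂ :=
  AddMonoidAlgebra.lift ℂ ℂ L.carrier t.toMonoidHom

theorem eval_mon (t : AddChar L.carrier ℂ) (v : L.carrier) : L.eval t (L.mon v) = t v := by
  simp [eval, mon, AddMonoidAlgebra.lift_single]

/-- The character `w t`, with `(w t)^λ = t^{w⁻¹ λ}`. A character `t ∈ Hom(L, ℂˣ)` is an additive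
character with values in `ℂ` (the values are then units). -/
def tw (w : P.weylGroup) (t : AddChar L.carrier ℂ) : AddChar L.carrier ℂ :=
  t.compAddMonoidHom (L.act w⁻¹)

end TranslationLattice

/-! ### Parameters and rational functions -/

/-- Parameters `q₀, q₁, …, qₙ > 1` (with `q₁, …, qₙ` indexed by `Fin n`), where `q_i = q_j` if `s_i`
and `s_j` are conjugate. The parameter `q₀` is used for non-reduced systems only, and there `s₀` is
not conjugate to any other generator; two simple reflections are conjugate in `W₀` if and only if
they are so in the affine Weyl group. -/
structure ParameterSystem {P : RootPairing ι ℝ V V'} {n : ℕ} (B : SimpleSystem P n) where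
  q0 : ℝ
  q : Fin n → ℝ
  one_lt_q0 : 1 < q0
  one_lt_q : ∀ i, 1 < q i
  q_eq_of_isConj : ∀ i j, IsConj (B.s i) (B.s j) → q i = q j

section Hecke

variable {P : RootPairing ι ℝ V V'} {n : ℕ} {B : SimpleSystem P n}

/-- `q_α = q_i` if `α ∈ W₀ α_i`; every root in `R₀` is of this form. -/
def ParameterSystem.qRoot (q : ParameterSystem B) (k : ι) : ℝ :=
  if h : ∃ i, ∃ w : P.weylGroup, w • B.simple i = k then q.q h.choose else 1

theorem conj_ofIdx (w : P.weylGroup) (k : ι) :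
    w * RootPairing.weylGroup.ofIdx P k * w⁻¹ = RootPairing.weylGroup.ofIdx P (w • k) := by
  apply Subtype.ext
  obtain ⟨g, hg⟩ := w
  change g * RootPairing.Equiv.reflection P k * g⁻¹ = RootPairing.Equiv.reflection P (g • k)
  induction hg using RootPairing.weylGroup.induction generalizing k with
  | mem m =>
    rw [RootPairing.Equiv.reflection_inv]
    apply RootPairing.Equiv.weightHom_injective P
    ext v
    have h : P.reflection (P.reflectionPerm m k) =
        P.reflection m * P.reflection k * P.reflection m := P.reflection_reflectionPerm
    rw [map_mul, map_mul]
    change P.reflection m (P.reflection k (P.reflection m v)) =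
      P.reflection (P.reflectionPerm m k) v
    rw [h]
    rfl
  | one => simp
  | mul x y hx hy hx' hy' =>
    rw [mul_smul, ← hx', ← hy']
    group

theorem ParameterSystem.qRoot_smul (q : ParameterSystem B) (w : P.weylGroup) (i : Fin n) :
    q.qRoot (w • B.simple i) = q.q i := by
  have h : ∃ j, ∃ w' : P.weylGroup, w' • B.simple j = w • B.simple i := ⟨i, w, rfl⟩
  rw [qRoot, dif_pos h]
  obtain ⟨w', hw'⟩ := h.choose_spec
  apply q.q_eq_of_isConj
  rw [isConj_iff]
  refine ⟨w⁻¹ * w', ?_⟩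
  have h1 := conj_ofIdx w' (B.simple h.choose)
  rw [hw', ← conj_ofIdx w (B.simple i)] at h1
  change w' * B.s h.choose * w'⁻¹ = w * B.s i * w⁻¹ at h1
  calc w⁻¹ * w' * B.s h.choose * (w⁻¹ * w')⁻¹
      = w⁻¹ * (w' * B.s h.choose * w'⁻¹) * w := by group
    _ = B.s i := by rw [h1]; group

variable (q : ParameterSystem B) (L : TranslationLattice P)

/-- `d_α = 1 - x^{-α^∨}`. -/
def dElt (k : ι) : L.GroupAlg := 1 - L.mon (-L.coroot k)

/-- `a_α`, for `α ∈ R₀`. The roots of `R₂` are conjugate to the simple root `α_n` of `R₂`, so that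
`q_n = q_α` for them. -/
def aElt (k : ι) : L.GroupAlg :=
  if k ∈ R2 P then
    algebraMap ℂ L.GroupAlg (1 - (q.qRoot k : ℂ)⁻¹) +
      ((√q.q0 * (√(q.qRoot k))⁻¹ - (√q.q0)⁻¹ * (√(q.qRoot k))⁻¹ : ℝ) : ℂ) •
        L.mon (-L.halfCoroot k)
  else algebraMap ℂ L.GroupAlg (1 - (q.qRoot k : ℂ)⁻¹)

/-- `n_α`, for `α ∈ R₀`. -/
def nElt (k : ι) : L.GroupAlg :=
  if k ∈ R2 P then
    (1 - (((√q.q0)⁻¹ * (√(q.qRoot k))⁻¹ : ℝ) : ℂ) • L.mon (-L.halfCoroot k)) *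
      (1 + ((√q.q0 * (√(q.qRoot k))⁻¹ : ℝ) : ℂ) • L.mon (-L.halfCoroot k))
  else 1 - (q.qRoot k : ℂ)⁻¹ • L.mon (-L.coroot k)

/-- `b_α(t) = a_α(t) / d_α(t)`. -/
def bVal (k : ι) (t : AddChar L.carrier ℂ) : ℂ := L.eval t (aElt q L k) / L.eval t (dElt L k)

/-- `c_α(t) = n_α(t) / d_α(t)`. -/
def cVal (k : ι) (t : AddChar L.carrier ℂ) : ℂ := L.eval t (nElt q L k) / L.eval t (dElt L k)

/-! ### The affine Hecke algebra -/

/-- The alternating product `a b a ⋯` with `m` factors. -/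
def altProd {A : Type*} [Monoid A] (a b : A) : ℕ → A
  | 0 => 1
  | m + 1 => a * altProd b a m

/-- The free algebra on symbols `T_i` (`i = 1, …, n`) and `x^λ` (`λ ∈ L`). -/
abbrev FreeAlg (n : ℕ) (L : TranslationLattice P) : Type _ := FreeAlgebra ℂ (Fin n ⊕ L.carrier)

def freeT (i : Fin n) : FreeAlg n L := FreeAlgebra.ι ℂ (Sum.inl i)

def freeX (v : L.carrier) : FreeAlg n L := FreeAlgebra.ι ℂ (Sum.inr v)

/-- The linear map from `ℂ[L]` to the free algebra that replaces `x^λ` by the symbol `x^λ`. -/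
def freeOfGroupAlg (f : L.GroupAlg) : FreeAlg n L := Finsupp.linearCombination ℂ (freeX L) f.coeff

/-- The defining relations of the affine Hecke algebra in the Bernstein presentation. -/
inductive HeckeRel : FreeAlg n L → FreeAlg n L → Prop
  | quadratic (i : Fin n) : HeckeRel (freeT L i * freeT L i)
      (1 + ((√(q.q i) - (√(q.q i))⁻¹ : ℝ) : ℂ) • freeT L i)
  | braid (i j : Fin n) (hij : i ≠ j) : HeckeRel
      (altProd (freeT L i) (freeT L j) (orderOf (B.s i * B.s j)))
      (altProd (freeT L j) (freeT L i) (orderOf (B.s i * B.s j)))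
  | x_zero : HeckeRel (freeX L 0) 1
  | x_add (u v : L.carrier) : HeckeRel (freeX L u * freeX L v) (freeX L (u + v))
  | bernstein (i : Fin n) (v : L.carrier) : HeckeRel
      (freeT L i * freeX L v - freeX L (L.act (B.s i) v) * freeT L i)
      (((√(q.q i) : ℝ) : ℂ) • freeOfGroupAlg L (aElt q L (B.simple i) * L.divDiff (B.simple i) v))

/-- The affine Hecke algebra `ℋ_L`. -/
abbrev Hecke : Type _ := RingQuot (HeckeRel q L)

def Hecke.T (i : Fin n) : Hecke q L := RingQuot.mkAlgHom ℂ (HeckeRel q L) (freeT L i)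

def Hecke.X (v : L.carrier) : Hecke q L := RingQuot.mkAlgHom ℂ (HeckeRel q L) (freeX L v)

/-! ### Calibratable weights -/

variable (B) in
/-- `N(t) = {α ∈ R₀⁺ | n_α(t) n_{-α}(t) = 0}`. -/
def setN (t : AddChar L.carrier ℂ) : Set ι :=
  {k | k ∈ B.R0pos ∧ L.eval t (nElt q L k) * L.eval t (nElt q L (negIdx P k)) = 0}

variable (B) in
/-- `D(t) = {α ∈ R₀⁺ | d_α(t) = 0}`. -/
def setD (t : AddChar L.carrier ℂ) : Set ι := {k | k ∈ B.R0pos ∧ L.eval t (dElt L k) = 0}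

/-- `F_J(t) = {w ∈ W₀ | R(w⁻¹) ∩ N(t) = J and R(w⁻¹) ∩ D(t) = ∅}`. -/
def setF (J : Set ι) (t : AddChar L.carrier ℂ) : Set P.weylGroup :=
  {w | B.inversionSet w⁻¹ ∩ setN B q L t = J ∧ B.inversionSet w⁻¹ ∩ setD B L t = ∅}

variable (B) in
/-- The subsystem `R_{ij} = R ∩ (ℤ α_i + ℤ α_j)`. -/
def subsystem (i j : Fin n) : Set ι :=
  {k | ∃ a b : ℤ, P.root k = a • P.root (B.simple i) + b • P.root (B.simple j)}

/-- `R_{ij}` is of type `C₂`, with `α_i` short and `α_j` long: it is reduced, and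
`⟨α_j, α_i^∨⟩ = -2`, `⟨α_i, α_j^∨⟩ = -1`. -/
def IsC2 (B : SimpleSystem P n) (i j : Fin n) : Prop :=
  subsystem B i j ⊆ R1 P ∧ P.pairing (B.simple j) (B.simple i) = -2 ∧
    P.pairing (B.simple i) (B.simple j) = -1

/-- `R_{ij}` is of type `G₂`, with `α_i` short and `α_j` long. -/
def IsG2 (B : SimpleSystem P n) (i j : Fin n) : Prop :=
  subsystem B i j ⊆ R1 P ∧ P.pairing (B.simple j) (B.simple i) = -3 ∧
    P.pairing (B.simple i) (B.simple j) = -1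

/-- `R_{ij}` is of type `BC₂`, with `α_i` middle-length and `α_j` short: here `2 α_j` is a root,
`⟨α_i, α_j^∨⟩ = -2` and `⟨α_j, α_i^∨⟩ = -1`. -/
def IsBC2 (B : SimpleSystem P n) (i j : Fin n) : Prop :=
  B.simple j ∈ R2 P ∧ P.pairing (B.simple i) (B.simple j) = -2 ∧
    P.pairing (B.simple j) (B.simple i) = -1

/-- `t` is `(i, j)`-regular. -/
def IsRegularAt (B : SimpleSystem P n) (L : TranslationLattice P) (i j : Fin n)
    (t : AddChar L.carrier ℂ) : Prop :=
  ∀ w ∈ Subgroup.closure {B.s i, B.s j},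
    L.tw w t (L.coroot (B.simple i)) ≠ 1 ∧ L.tw w t (L.coroot (B.simple j)) ≠ 1

/-- The exceptional weights for an ordered pair of simple roots `(α_i, α_j)`, where the pair
`(z, y)` is `(t^{α_i^∨}, t^{α_j^∨})`, or `(t^{α_i^∨}, t^{α_j^∨ / 2})` for type `BC₂`. -/
def IsExceptionalAt (i j : Fin n) (t : AddChar L.carrier ℂ) : Prop :=
  let q0 : ℝ := q.q0
  let qi : ℝ := q.q i
  let qj : ℝ := q.q j
  let z : ℂ := t (L.coroot (B.simple i))
  let y : ℂ := t (L.coroot (B.simple j))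
  let h : ℂ := t (L.halfCoroot (B.simple j))
  (IsC2 B i j ∧
    ((qi = qj ∧ ((z = qi ∧ y = (qi⁻¹ : ℝ)) ∨ (z = (qi⁻¹ : ℝ) ∧ y = qi))) ∨
     (qi = qj ^ 2 ∧ ((z = ((qj ^ 2)⁻¹ : ℝ) ∧ y = qj) ∨ (z = (qj ^ 2 : ℝ) ∧ y = (qj⁻¹ : ℝ))))))
  ∨ (IsG2 B i j ∧
    ((qi = qj ∧
        ((z = (qi⁻¹ : ℝ) ∧ y = qi) ∨ (z = qi ∧ y = (qi⁻¹ : ℝ)) ∨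
         (z = (qi ^ 2 : ℝ) ∧ y = (qi⁻¹ : ℝ)) ∨ (z = ((qi ^ 2)⁻¹ : ℝ) ∧ y = qi))) ∨
     (qi = qj ^ 3 ∧
        ((z = (qj ^ 3 : ℝ) ∧ y = (qj⁻¹ : ℝ)) ∨ (z = ((qj ^ 3)⁻¹ : ℝ) ∧ y = qj) ∨
         (z = ((qj ^ 3)⁻¹ : ℝ) ∧ y = (qj ^ 2 : ℝ)) ∨
         (z = (qj ^ 3 : ℝ) ∧ y = ((qj ^ 2)⁻¹ : ℝ))))))
  ∨ (IsBC2 B i j ∧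
    ((qi = q0 * qj ∧
        ((z = (q0 * qj : ℝ) ∧ h = ((√q0)⁻¹ * (√qj)⁻¹ : ℝ)) ∨
         (z = (q0⁻¹ * qj⁻¹ : ℝ) ∧ h = (√q0 * √qj : ℝ)))) ∨
     ((qi = q0 * qj⁻¹ ∨ qi = q0⁻¹ * qj) ∧
        ((z = (q0⁻¹ * qj : ℝ) ∧ h = (-(√q0 * (√qj)⁻¹) : ℝ)) ∨
         (z = (q0 * qj⁻¹ : ℝ) ∧ h = (-((√q0)⁻¹ * √qj) : ℝ)))) ∨
     (qi = √q0 * √qj ∧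
        ((z = (qi⁻¹ : ℝ) ∧ h = qi) ∨ (z = qi ∧ h = (qi⁻¹ : ℝ)))) ∨
     ((qi = (√q0)⁻¹ * √qj ∨ qi = √q0 * (√qj)⁻¹) ∧
        ((z = (qi⁻¹ : ℝ) ∧ h = (-qi : ℝ)) ∨ (z = qi ∧ h = (-qi⁻¹ : ℝ))))))

/-- `t` is `(i, j)`-calibratable. This is symmetric in `i` and `j`, since the cases that single out
a short or a long root are imposed for either numbering. -/
def IsCalibratable (i j : Fin n) (t : AddChar L.carrier ℂ) : Prop :=
  IsRegularAt B L i j t ∨ IsExceptionalAt q L i j t ∨ IsExceptionalAt q L j i t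

/-! ### The module `M_J(t)` -/

/-- The vector space with basis `{e_w | w ∈ F_J(t)}`. -/
abbrev ModuleSpace (J : Set ι) (t : AddChar L.carrier ℂ) : Type _ := setF q L J t →₀ ℂ

/-- The vector `e_w`, which is `0` if `w ∉ F_J(t)`. -/
def e (J : Set ι) (t : AddChar L.carrier ℂ) (w : P.weylGroup) : ModuleSpace q L J t :=
  if h : w ∈ setF q L J t then Finsupp.single ⟨w, h⟩ 1 else 0

/-- `x^λ e_w = (w t)^λ e_w`. -/
def opX (J : Set ι) (t : AddChar L.carrier ℂ) (v : L.carrier) :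
    Module.End ℂ (ModuleSpace q L J t) :=
  Finsupp.linearCombination ℂ fun w : setF q L J t => L.tw w t v • e q L J t w

/-- `T_i e_w = q_i^{1/2} b_i(w t) e_w + q_i^{1/2} c_i(w t) e_{s_i w}`. -/
def opT (J : Set ι) (t : AddChar L.carrier ℂ) (i : Fin n) :
    Module.End ℂ (ModuleSpace q L J t) :=
  Finsupp.linearCombination ℂ fun w : setF q L J t =>
    (((√(q.q i) : ℝ) : ℂ) * bVal q L (B.simple i) (L.tw w t)) • e q L J t w +
      (((√(q.q i) : ℝ) : ℂ) * cVal q L (B.simple i) (L.tw w t)) • e q L J t (B.s i * w)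

end Hecke

/-- A representation of an algebra is irreducible if the corresponding module is simple. -/
def IsIrreducibleRep {A M : Type*} [Ring A] [Algebra ℂ A] [AddCommGroup M] [Module ℂ M]
    (ρ : A →ₐ[ℂ] Module.End ℂ M) : Prop :=
  letI : Module A M := Module.compHom M ρ.toRingHom
  IsSimpleModule A M

end

end CalibratedHecke

namespace CalibratedHecke
open RootPairing MulOpposite

variable {ι V V' : Type*} [AddCommGroup V] [Module ℝ V] [AddCommGroup V'] [Module ℝ V']
  {P : RootPairing ι ℝ V V'} {n : ℕ}

/-! ### The Weyl group and its actions -/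

/-! Combinatorics of $F_J(t)$. The sets $R((s_iw)^{-1})$ and $R(w^{-1})$ differ in exactly one root,
the positive one of $\pm w^{-1}\alpha_i$. If this root lies in $N(t)$, then $F_J(t)$ prescribes the
side of its wall and the step to $s_iw$ is blocked (`s_mul_notMem_setF`); if it lies neither in
$N(t)$ nor in $D(t)$, the step is free (`s_mul_mem_setF`). Calibratability for $i=j$ keeps $D(t)$
out of the way. So $e_{s_iw}=0$ exactly when $n_{\alpha_i}n_{-\alpha_i}$ vanishes at $wt$. On the
span of $e_w$ and $e_{s_iw}$ the operator $\tilde T_i$ then has trace $q_i^{1/2}-q_i^{-1/2}$ and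
determinant $-1$, or it has $e_w$ as an eigenvector with the right eigenvalue; this is the quadratic
relation. The Bernstein relation compares the weights $wt$ and $s_iwt$.

Braid relations at a regular weight $\chi=wt$. The differences $T_i-q_i^{1/2}b_\alpha(\chi)$, taken
along a reduced word of the longest element of $\langle s_i,s_j\rangle$, carry $e_w$ through basis
vectors. Both words end at the same vector, and their coefficients are products over the same
positive roots of $R_{ij}$ in opposite orders (`opChain_apply`). On the other hand, the two products
minus their leading words are equal as a consequence of the quadratic relations and scalar
identities between the $b_\alpha(\chi)$ (`yangBaxter_three`, `yangBaxter_four`, `yangBaxter_six`).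
Hence the leading words, which are the two sides of the braid relation, agree on $e_w$.

Braid relations at an exceptional weight. Usually both simple roots are blocked, so $e_w$ is a
common eigenvector of $\tilde T_i$ and $\tilde T_j$. The remaining weights are of type $G_2$: there
a two-dimensional space is stable, and the product of the two operators has trace $-1$ and
determinant $1$ on it, so that its cube is the identity.

Irreducibility. Distinct weights let any nonzero submodule contain some $e_w$. The set $F_J(t)$ is
connected by free steps, whose coefficients $c_i$ do not vanish, so every other basis vector
follows.

The case $L=P$. If $wt=w't$, then $g=w^{-1}w'$ fixes $t$ and permutes $D(t)$, because $w$ and $w'$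
both keep $D(t)$ positive. A logarithm of $t$ is moved by $g$ only by an element of the root
lattice. It can be perturbed by $g$-fixed vectors until no coroot is integral on it, that is, until
it lies inside an alcove. Freeness of the affine Weyl group on alcoves gives $g=1$
(`eq_one_of_smul_sub_mem_rootLattice`, `eq_of_tw_eq`). -/

theorem root_smul (w : P.weylGroup) (k : ι) : P.root (w • k) = w • P.root k :=
  Equiv.root_indexEquiv_eq_smul (P := P) k (w : P.Aut)

theorem ofIdx_smul_vec (k : ι) (v : V) :
    weylGroup.ofIdx P k • v = v - P.toLinearMap v (P.coroot k) • P.root k :=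
  P.reflection_apply k v

theorem root_ofIdx_smul (k m : ι) :
    P.root (weylGroup.ofIdx P k • m) = P.root m - P.pairing m k • P.root k := by
  rw [root_smul, ofIdx_smul_vec, P.root_coroot_eq_pairing]

theorem ofIdx_mul_self (k : ι) : weylGroup.ofIdx P k * weylGroup.ofIdx P k = 1 := by
  apply Subtype.ext
  change Equiv.reflection P k * Equiv.reflection P k = 1
  rw [mul_eq_one_iff_eq_inv, Equiv.reflection_inv]

theorem ofIdx_inv (k : ι) : (weylGroup.ofIdx P k)⁻¹ = weylGroup.ofIdx P k :=
  inv_eq_of_mul_eq_one_left (ofIdx_mul_self k)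

theorem ofIdx_smul_smul {α : Type*} [MulAction P.weylGroup α] (k : ι) (a : α) :
    weylGroup.ofIdx P k • weylGroup.ofIdx P k • a = a := by
  rw [smul_smul, ofIdx_mul_self, one_smul]

theorem weylGroup_smul_eq_self_of_forall {w : P.weylGroup} (h : ∀ v : V, w • v = v) : w = 1 := by
  apply Subtype.ext
  apply Equiv.weightHom_injective P
  ext v
  exact h v

theorem toLinearMap_smul (w : P.weylGroup) (v : V) (μ : V') :
    P.toLinearMap (w • v) μ = P.toLinearMap v (op (w : P.Aut) • μ) :=
  LinearMap.congr_fun (Hom.weight_coweight_transpose_apply P P μ (w : P.Aut).toHom) v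

theorem coroot_smul (w : P.weylGroup) (k : ι) :
    P.coroot (w • k) = op ((w⁻¹ : P.weylGroup) : P.Aut) • P.coroot k := by
  exact (congrFun (((w⁻¹ : P.weylGroup) : P.Aut).toHom.coroot_coweightMap) k).symm

theorem toLinearMap_smul_coroot_smul (w : P.weylGroup) (v : V) (k : ι) :
    P.toLinearMap (w • v) (P.coroot (w • k)) = P.toLinearMap v (P.coroot k) := by
  rw [coroot_smul, toLinearMap_smul, smul_smul, ← op_mul]
  simp

theorem toLinearMap_smul_coroot (w : P.weylGroup) (v : V) (k : ι) :
    P.toLinearMap (w • v) (P.coroot k) = P.toLinearMap v (P.coroot (w⁻¹ • k)) := by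
  rw [← toLinearMap_smul_coroot_smul w v (w⁻¹ • k), smul_inv_smul]

theorem smul_negIdx (w : P.weylGroup) (k : ι) : w • negIdx P k = negIdx P (w • k) := by
  apply P.root.injective
  rw [root_smul, root_negIdx, root_negIdx, smul_neg, root_smul]

theorem coroot_negIdx (k : ι) : P.coroot (negIdx P k) = -P.coroot k := by
  simp [negIdx, P.coroot_reflectionPerm, P.coreflection_apply_self]

theorem negIdx_negIdx (k : ι) : negIdx P (negIdx P k) = k := by
  apply P.root.injective
  rw [root_negIdx, root_negIdx, neg_neg]

theorem ofIdx_smul_self (k : ι) : weylGroup.ofIdx P k • k = negIdx P k := rfl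

theorem negIdx_mem_R2 {k : ι} (h : k ∈ R2 P) : negIdx P k ∈ R2 P := by
  obtain ⟨m, hm⟩ := h
  exact ⟨negIdx P m, by rw [root_negIdx, root_negIdx, hm, smul_neg]⟩

theorem smul_mem_R2 (w : P.weylGroup) {k : ι} (h : k ∈ R2 P) : w • k ∈ R2 P := by
  obtain ⟨m, hm⟩ := h
  exact ⟨w • m, by rw [root_smul, root_smul, hm, smul_comm w (2 : ℝ)]⟩

theorem smul_mem_R2_iff (w : P.weylGroup) {k : ι} : w • k ∈ R2 P ↔ k ∈ R2 P :=
  ⟨fun h => by simpa using smul_mem_R2 w⁻¹ h, smul_mem_R2 w⟩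

theorem smul_mem_R1 (w : P.weylGroup) {k : ι} (h : k ∈ R1 P) : w • k ∈ R1 P := by
  refine ⟨fun m hm => h.1 (w⁻¹ • m) ?_, fun m hm => h.2 (w⁻¹ • m) ?_⟩
  · rw [root_smul, ← smul_comm w⁻¹ (2 : ℝ), ← hm, root_smul, inv_smul_smul]
  · rw [root_smul, hm, smul_comm w⁻¹ (2 : ℝ), root_smul, inv_smul_smul]

theorem smul_mem_R0 (w : P.weylGroup) {k : ι} (h : k ∈ R0 P) : w • k ∈ R0 P :=
  h.imp (smul_mem_R1 w) (smul_mem_R2 w)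

theorem smul_mem_R0_iff (w : P.weylGroup) {k : ι} : w • k ∈ R0 P ↔ k ∈ R0 P :=
  ⟨fun h => by simpa using smul_mem_R0 w⁻¹ h, smul_mem_R0 w⟩

theorem negIdx_mem_R0 {k : ι} (h : k ∈ R0 P) : negIdx P k ∈ R0 P :=
  smul_mem_R0 (weylGroup.ofIdx P k) h

theorem negIdx_mem_R0_iff {k : ι} : negIdx P k ∈ R0 P ↔ k ∈ R0 P :=
  ⟨fun h => by simpa [negIdx_negIdx] using negIdx_mem_R0 h, negIdx_mem_R0⟩

theorem exists_int_pairing [P.IsCrystallographic] (k m : ι) : ∃ z : ℤ, P.pairing k m = z :=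
  ⟨P.pairingIn ℤ k m, (P.algebraMap_pairingIn ℤ k m).symm⟩

/-! ### Heights and positivity -/

namespace SimpleSystem

variable (B : SimpleSystem P n)

theorem s_mul_self (i : Fin n) : B.s i * B.s i = 1 := ofIdx_mul_self _

theorem s_inv (i : Fin n) : (B.s i)⁻¹ = B.s i := ofIdx_inv _

theorem s_smul_s_smul {α : Type*} [MulAction P.weylGroup α] (i : Fin n) (a : α) :
    B.s i • B.s i • a = a := ofIdx_smul_smul _ a

theorem span_eq_top [P.IsRootSystem] :
    ⊤ ≤ Submodule.span ℝ (Set.range fun i => P.root (B.simple i)) := by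
  rw [← IsRootSystem.span_root_eq_top (P := P), Submodule.span_le]
  rintro _ ⟨k, rfl⟩
  have key : ∀ c : Fin n → ℕ, ∑ i, c i • P.root (B.simple i) ∈
      Submodule.span ℝ (Set.range fun i => P.root (B.simple i)) := fun c =>
    sum_mem fun i _ => nsmul_mem (Submodule.subset_span (Set.mem_range_self i)) _
  rcases B.nonneg_or_nonpos k with ⟨c, hc⟩ | ⟨c, hc⟩
  · rw [hc, SetLike.mem_coe]; exact key c
  · rw [hc, SetLike.mem_coe]; exact neg_mem (key c)

variable [P.IsRootSystem]

/-- The basis of simple roots. -/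
noncomputable def basis : Module.Basis (Fin n) ℝ V :=
  .mk B.linearIndependent B.span_eq_top

@[simp] theorem basis_apply (i : Fin n) : B.basis i = P.root (B.simple i) := by
  simp [basis]

/-- The height: the linear functional that takes the value `1` on all simple roots. -/
noncomputable def ht : V →ₗ[ℝ] ℝ := B.basis.constr ℝ fun _ => (1 : ℝ)

@[simp] theorem ht_simple (i : Fin n) : B.ht (P.root (B.simple i)) = 1 := by
  rw [← basis_apply, ht, Module.Basis.constr_basis]

theorem coord_sum (c : Fin n → ℕ) (j : Fin n) :
    B.basis.coord j (∑ i, c i • P.root (B.simple i)) = c j := by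
  simp_rw [← basis_apply, map_sum, map_nsmul, Module.Basis.coord_apply, Module.Basis.repr_self]
  simp [Finsupp.single_apply]

theorem ht_sum (c : Fin n → ℕ) :
    B.ht (∑ i, c i • P.root (B.simple i)) = ∑ i, (c i : ℝ) := by
  simp

theorem root_eq_sum_coord (v : V) : v = ∑ i, B.basis.coord i v • P.root (B.simple i) := by
  conv_lhs => rw [← B.basis.sum_repr v]
  simp

/-- A nonzero sum of simple roots with coefficients in $\mathbb N$ has positive height, so the sign
of one linear functional decides positivity. All later positivity arguments use `ht` in this way. -/
theorem isPos_iff (k : ι) :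
    (∃ c : Fin n → ℕ, P.root k = ∑ i, c i • P.root (B.simple i)) ↔ 0 < B.ht (P.root k) := by
  have key : ∀ c : Fin n → ℕ, ∑ i, c i • P.root (B.simple i) ≠ 0 →
      0 < B.ht (∑ i, c i • P.root (B.simple i)) := by
    intro c hc
    rw [ht_sum]
    have h0 : (0 : ℝ) ≤ ∑ i, (c i : ℝ) := Finset.sum_nonneg fun i _ => Nat.cast_nonneg _
    refine lt_of_le_of_ne h0 fun h => hc ?_
    have := (Finset.sum_eq_zero_iff_of_nonneg fun i _ => Nat.cast_nonneg (c i)).1 h.symm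
    refine Finset.sum_eq_zero fun i hi => ?_
    have h1 : c i = 0 := by exact_mod_cast this i hi
    rw [h1, zero_smul]
  constructor
  · rintro ⟨c, hc⟩
    rw [hc]
    exact key c (hc ▸ P.ne_zero k)
  · intro h
    rcases B.nonneg_or_nonpos k with hc | ⟨c, hc⟩
    · exact hc
    · exfalso
      have h1 := key c (fun h0 => P.ne_zero k (by rw [hc, h0, neg_zero]))
      rw [hc, map_neg] at h
      linarith

theorem ht_root_ne_zero (k : ι) : B.ht (P.root k) ≠ 0 := by
  rcases B.nonneg_or_nonpos k with hc | ⟨c, hc⟩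
  · exact ((B.isPos_iff k).1 hc).ne'
  · have : 0 < B.ht (P.root (negIdx P k)) := (B.isPos_iff _).1 ⟨c, by rw [root_negIdx, hc, neg_neg]⟩
    rw [root_negIdx, map_neg] at this
    linarith

theorem mem_R0pos {k : ι} : k ∈ B.R0pos ↔ k ∈ R0 P ∧ 0 < B.ht (P.root k) := by
  rw [R0pos, Set.mem_ofPred_eq, isPos_iff]

theorem mem_inversionSet {w : P.weylGroup} {k : ι} :
    k ∈ B.inversionSet w⁻¹ ↔ k ∈ R0 P ∧ 0 < B.ht (P.root k) ∧ B.ht (P.root (w • k)) < 0 := by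
  rw [inversionSet, Set.mem_ofPred_eq, mem_R0pos, mem_R0pos, inv_inv, negIdx_mem_R0_iff,
    smul_mem_R0_iff, root_negIdx, map_neg, neg_pos]
  tauto

theorem exists_coord {k : ι} (h : 0 < B.ht (P.root k)) (i : Fin n) :
    ∃ m : ℕ, B.basis.coord i (P.root k) = m := by
  obtain ⟨c, hc⟩ := (B.isPos_iff k).2 h
  exact ⟨c i, by rw [hc, coord_sum]⟩

theorem coord_nonneg {k : ι} (h : 0 < B.ht (P.root k)) (i : Fin n) :
    0 ≤ B.basis.coord i (P.root k) := by
  obtain ⟨m, hm⟩ := B.exists_coord h i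
  rw [hm]
  exact Nat.cast_nonneg _

/-- The coordinates of a root all have the same sign, so one positive coordinate decides. -/
theorem ht_pos_of_coord_pos {k : ι} {i : Fin n} (h : 0 < B.basis.coord i (P.root k)) :
    0 < B.ht (P.root k) := by
  by_contra hn
  have : 0 < B.ht (P.root (negIdx P k)) := by
    rw [root_negIdx, map_neg]
    have := B.ht_root_ne_zero k
    grind
  have := B.coord_nonneg this i
  rw [root_negIdx, map_neg] at this
  linarith

theorem exists_int_coord (k : ι) (i : Fin n) : ∃ m : ℤ, B.basis.coord i (P.root k) = m := by
  rcases lt_or_gt_of_ne (B.ht_root_ne_zero k) with h | h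
  · have h1 : 0 < B.ht (P.root (negIdx P k)) := by
      rw [root_negIdx, map_neg]; linarith
    obtain ⟨m, hm⟩ := B.exists_coord h1 i
    rw [root_negIdx, map_neg] at hm
    exact ⟨-m, by push_cast; linarith⟩
  · obtain ⟨m, hm⟩ := B.exists_coord h i
    exact ⟨m, by exact_mod_cast hm⟩

theorem coord_simple (i j : Fin n) :
    B.basis.coord i (P.root (B.simple j)) = if i = j then 1 else 0 := by
  rw [← basis_apply, Module.Basis.coord_apply, Module.Basis.repr_self, Finsupp.single_apply]
  simp [eq_comm]

theorem coord_s_smul {i j : Fin n} (hij : j ≠ i) (k : ι) :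
    B.basis.coord j (P.root (B.s i • k)) = B.basis.coord j (P.root k) := by
  rw [s, root_ofIdx_smul, map_sub, map_smul, coord_simple, if_neg hij]
  simp

/-- Reflecting a positive root which is not a multiple of `α_i` in `α_i` gives a positive root. -/
theorem ht_s_smul_pos {i : Fin n} {k : ι} (h : 0 < B.ht (P.root k))
    (hk : ∀ c : ℝ, P.root k ≠ c • P.root (B.simple i)) : 0 < B.ht (P.root (B.s i • k)) := by
  obtain ⟨j, hji, hj⟩ : ∃ j, j ≠ i ∧ B.basis.coord j (P.root k) ≠ 0 := by
    by_contra! hc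
    refine hk (B.basis.coord i (P.root k)) ?_
    conv_lhs => rw [B.root_eq_sum_coord (P.root k)]
    refine Finset.sum_eq_single i (fun j _ hj => ?_) (by simp)
    rw [hc j hj, zero_smul]
  apply B.ht_pos_of_coord_pos (i := j)
  rw [B.coord_s_smul hji]
  exact lt_of_le_of_ne (B.coord_nonneg h j) hj.symm

end SimpleSystem

/-- A reflection depends only on the line of its root. This absorbs the pairs $\alpha,2\alpha$ of a
non-reduced system. -/
theorem ofIdx_eq_of_root_eq_smul [Finite ι] {k m : ι} {c : ℝ}
    (h : P.root k = c • P.root m) : weylGroup.ofIdx P k = weylGroup.ofIdx P m := by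
  have : IsAddTorsionFree V' := .of_isTorsionFree ℝ V'
  have h1 := P.smul_coroot_eq_of_root_eq_smul m k c h
  have h2 : ∀ v : V, weylGroup.ofIdx P k • v = weylGroup.ofIdx P m • v := by
    intro v
    rw [ofIdx_smul_vec, ofIdx_smul_vec, h, ← h1, map_smul, smul_smul, mul_comm, smul_eq_mul]
  rw [← inv_mul_eq_one]
  apply weylGroup_smul_eq_self_of_forall
  intro v
  rw [mul_smul, ← h2, inv_smul_smul]

namespace SimpleSystem

variable (B : SimpleSystem P n) [P.IsRootSystem]

/-- Half of a simple root would have the non-integral coordinate $1/2$. -/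
theorem simple_mem_R0 (i : Fin n) : B.simple i ∈ R0 P := by
  by_cases h : B.simple i ∈ R2 P
  · exact Or.inr h
  · refine Or.inl ⟨fun m hm => ?_, fun m hm => h ⟨m, hm⟩⟩
    obtain ⟨c, hc⟩ := B.exists_int_coord m i
    have := congrArg (B.basis.coord i) hm
    rw [coord_simple, if_pos rfl, map_smul, hc, smul_eq_mul] at this
    have h2 : (1 : ℤ) = 2 * c := by exact_mod_cast this
    omega

/-- The scalar $c$ is a coordinate, hence an integer, and
$c\,\langle\alpha_i,\alpha_k^\vee\rangle=2$ makes it a divisor of $2$. -/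
theorem coeff_of_root_eq_smul [P.IsCrystallographic] {i : Fin n} {k : ι} {c : ℝ}
    (h : P.root k = c • P.root (B.simple i)) : c = 1 ∨ c = -1 ∨ c = 2 ∨ c = -2 := by
  obtain ⟨m, hm⟩ := B.exists_int_coord k i
  rw [h, map_smul, coord_simple, if_pos rfl, smul_eq_mul, mul_one] at hm
  have hp : c * P.pairing (B.simple i) k = 2 := by
    rw [← P.pairing_same k, ← P.root_coroot_eq_pairing k k, h, map_smul]
    simp
  obtain ⟨z, hz⟩ := exists_int_pairing (P := P) (B.simple i) k
  rw [hm, hz] at hp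
  have hp' : m * z = 2 := by exact_mod_cast hp
  have hd : m ∣ 2 := ⟨z, hp'.symm⟩
  have h1 : m ≤ 2 := Int.le_of_dvd (by norm_num) hd
  have h2 : -m ≤ 2 := Int.le_of_dvd (by norm_num) (by simpa using hd)
  rw [hm]
  have : m = 1 ∨ m = -1 ∨ m = 2 ∨ m = -2 := by
    have : m ≠ 0 := by rintro rfl; simp at hp'
    omega
  rcases this with rfl | rfl | rfl | rfl <;> simp

/-- The only multiples of `α_i` in `R₀` are `±α_i`. -/
theorem eq_simple_or_of_root_eq_smul [P.IsCrystallographic] {i : Fin n} {k : ι} {c : ℝ}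
    (hk : k ∈ R0 P) (h : P.root k = c • P.root (B.simple i)) :
    k = B.simple i ∨ k = negIdx P (B.simple i) := by
  -- A root of $R_0$ that is twice another root must lie in $R_2$, which produces four times that
  -- root; a coefficient of absolute value $4$ is then excluded.
  have hbad : ∀ m : ι, k ∈ R0 P → P.root k = (2 : ℝ) • P.root m →
      ∃ m', P.root m' = (4 : ℝ) • P.root m := by
    rintro m (hk | ⟨m', hm'⟩) hm
    · exact absurd hm (hk.1 m)
    · exact ⟨m', by rw [hm', hm, smul_smul]; norm_num⟩
  rcases B.coeff_of_root_eq_smul h with rfl | rfl | rfl | rfl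
  · left; apply P.root.injective; simpa using h
  · right; apply P.root.injective; rw [root_negIdx]; simpa using h
  · obtain ⟨m', hm'⟩ := hbad _ hk h
    exfalso
    have := B.coeff_of_root_eq_smul hm'
    norm_num at this
  · obtain ⟨m', hm'⟩ := hbad (negIdx P (B.simple i)) hk (by rw [h, root_negIdx]; simp)
    rw [root_negIdx, smul_neg, ← neg_smul] at hm'
    exfalso
    have := B.coeff_of_root_eq_smul hm'
    norm_num at this

theorem ht_s_smul_pos_of_mem_R0 [P.IsCrystallographic] {i : Fin n} {k : ι} (hk : k ∈ R0 P)
    (h : 0 < B.ht (P.root k)) (hne : k ≠ B.simple i) : 0 < B.ht (P.root (B.s i • k)) := by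
  refine B.ht_s_smul_pos h fun c hc => ?_
  rcases B.eq_simple_or_of_root_eq_smul hk hc with h1 | h1
  · exact hne h1
  · rw [h1, root_negIdx, map_neg, ht_simple] at h
    linarith

/-! ### Simple reflections generate the Weyl group and act simply transitively -/

/-- The product of the simple reflections in a word. -/
noncomputable def wordProd (l : List (Fin n)) : P.weylGroup := (l.map B.s).prod

/-- Expanding $2=\langle\alpha,\alpha^\vee\rangle$ in the nonnegative coordinates of $\alpha$ leaves
some positive term. -/
theorem exists_pairing_pos [Finite ι] {k : ι} (h : 0 < B.ht (P.root k)) :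
    ∃ i, 0 < P.pairing (B.simple i) k := by
  by_contra! hc
  have h1 : P.pairing k k = ∑ i, B.basis.coord i (P.root k) * P.pairing (B.simple i) k := by
    rw [← P.root_coroot_eq_pairing k k]
    conv_lhs => rw [B.root_eq_sum_coord (P.root k)]
    simp
  rw [P.pairing_same] at h1
  have : ∑ i, B.basis.coord i (P.root k) * P.pairing (B.simple i) k ≤ 0 :=
    Finset.sum_nonpos fun i _ => mul_nonpos_of_nonneg_of_nonpos (B.coord_nonneg h i) (hc i)
  linarith

/-- Induction on the height: a simple reflection $s_i$ with $\langle\alpha,\alpha_i^\vee\rangle>0$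
lowers the height of $\alpha$ by at least $1$ and conjugates $s_\alpha$ into the reflection in a
lower positive root. Multiples of simple roots are the end of the descent. -/
theorem ofIdx_mem_closure [Finite ι] [P.IsCrystallographic] (k : ι) :
    weylGroup.ofIdx P k ∈ Subgroup.closure (Set.range B.s) := by
  have key : ∀ N : ℕ, ∀ k, 0 < B.ht (P.root k) → B.ht (P.root k) < N →
      weylGroup.ofIdx P k ∈ Subgroup.closure (Set.range B.s) := by
    intro N
    induction N with
    | zero => intro k h h'; simp at h'; linarith
    | succ N ih =>
      intro k h h'
      obtain ⟨i, hi⟩ := B.exists_pairing_pos h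
      have hi' : 0 < P.pairing k (B.simple i) := by
        obtain ⟨a, ha⟩ := exists_int_pairing (P := P) (B.simple i) k
        obtain ⟨b, hb⟩ := exists_int_pairing (P := P) k (B.simple i)
        have := P.zero_lt_pairingIn_iff' ℤ (i := B.simple i) (j := k)
        rw [← P.algebraMap_pairingIn ℤ] at hi ⊢
        simp only [algebraMap_int_eq, eq_intCast, Int.cast_pos] at hi ⊢
        exact this.1 hi
      by_cases hm : ∃ c : ℝ, P.root k = c • P.root (B.simple i)
      · obtain ⟨c, hc⟩ := hm
        rw [ofIdx_eq_of_root_eq_smul hc]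
        exact Subgroup.subset_closure ⟨i, rfl⟩
      · push Not at hm
        have h1 := B.ht_s_smul_pos h hm
        have h2 : B.ht (P.root (B.s i • k)) = B.ht (P.root k) - P.pairing k (B.simple i) := by
          rw [s, root_ofIdx_smul, map_sub, map_smul, ht_simple, smul_eq_mul, mul_one]
        obtain ⟨b, hb⟩ := exists_int_pairing (P := P) k (B.simple i)
        have hb1 : (1 : ℝ) ≤ b := by
          rw [hb] at hi'
          exact_mod_cast hi'
        have h3 := ih (B.s i • k) h1 (by rw [h2, hb]; push_cast at h'; linarith)
        rw [← conj_ofIdx] at h3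
        have hs : B.s i ∈ Subgroup.closure (Set.range B.s) := Subgroup.subset_closure ⟨i, rfl⟩
        have := mul_mem (mul_mem (inv_mem hs) h3) hs
        convert this using 1
        group
  obtain ⟨N, hN⟩ := exists_nat_gt |B.ht (P.root k)|
  rcases lt_or_gt_of_ne (B.ht_root_ne_zero k) with h | h
  · have : weylGroup.ofIdx P k = weylGroup.ofIdx P (negIdx P k) :=
      ofIdx_eq_of_root_eq_smul (c := -1) (by rw [root_negIdx]; simp)
    rw [this]
    refine key N _ ?_ ?_ <;> rw [root_negIdx, map_neg]
    · linarith
    · rwa [abs_of_neg h] at hN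
  · exact key N k h (by rwa [abs_of_pos h] at hN)

theorem exists_wordProd [Finite ι] [P.IsCrystallographic] (w : P.weylGroup) :
    ∃ l, B.wordProd l = w := by
  have hgen : ∀ w ∈ Subgroup.closure (Set.range B.s), ∃ l, B.wordProd l = w := by
    intro w hw
    induction hw using Subgroup.closure_induction with
    | mem x hx => obtain ⟨i, rfl⟩ := hx; exact ⟨[i], by simp [wordProd]⟩
    | one => exact ⟨[], rfl⟩
    | mul x y _ _ hx hy =>
      obtain ⟨l, rfl⟩ := hx
      obtain ⟨l', rfl⟩ := hy
      exact ⟨l ++ l', by simp [wordProd]⟩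
    | inv x _ hx =>
      obtain ⟨l, rfl⟩ := hx
      refine ⟨l.reverse, ?_⟩
      rw [wordProd, wordProd, List.prod_inv_reverse, List.map_map, List.map_reverse]
      congr 3
      funext i
      exact (B.s_inv i).symm
  apply hgen
  obtain ⟨g, hg⟩ := w
  induction hg using weylGroup.induction with
  | mem k => exact B.ofIdx_mem_closure k
  | one => exact one_mem _
  | mul x y hx hy hx' hy' => exact mul_mem hx' hy'

/-- The exchange condition. -/
theorem exists_wordProd_mul_s [Finite ι] [P.IsCrystallographic] (l : List (Fin n)) (j : Fin n)
    (h : B.ht (P.root (B.wordProd l • B.simple j)) < 0) :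
    ∃ l', l'.length + 1 = l.length ∧ B.wordProd l * B.s j = B.wordProd l' := by
  induction l with
  | nil =>
    simp only [wordProd, List.map_nil, List.prod_nil, one_smul, ht_simple] at h
    linarith
  | cons i l ih =>
    have hcons : ∀ l, B.wordProd (i :: l) = B.s i * B.wordProd l := fun l => by simp [wordProd]
    rcases lt_or_gt_of_ne (B.ht_root_ne_zero (B.wordProd l • B.simple j)) with h1 | h1
    · obtain ⟨l', hl', he⟩ := ih h1
      exact ⟨i :: l', by simp [hl'], by rw [hcons, hcons, mul_assoc, he]⟩
    · refine ⟨l, rfl, ?_⟩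
      -- The letter $s_i$ is the one that turns the root negative, so the root is a multiple of
      -- $\alpha_i$. Hence $s_i$ is the conjugate of $s_j$ by the rest of the word, and the two
      -- letters cancel.
      obtain ⟨c, hc⟩ : ∃ c : ℝ, P.root (B.wordProd l • B.simple j) = c • P.root (B.simple i) := by
        by_contra! hn
        have := B.ht_s_smul_pos h1 hn
        rw [hcons, mul_smul] at h
        linarith
      have h2 := ofIdx_eq_of_root_eq_smul hc
      rw [← conj_ofIdx] at h2
      have h3 : B.s i = B.wordProd l * B.s j * (B.wordProd l)⁻¹ := h2.symm
      rw [hcons, h3]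
      have := B.s_mul_self j
      calc B.wordProd l * B.s j * (B.wordProd l)⁻¹ * B.wordProd l * B.s j
          = B.wordProd l * (B.s j * B.s j) := by group
        _ = B.wordProd l := by rw [this, mul_one]

/-- An element of the Weyl group that makes no simple root negative is trivial. -/
theorem eq_one_of_forall_ht_pos [Finite ι] [P.IsCrystallographic] {w : P.weylGroup}
    (h : ∀ i, 0 < B.ht (P.root (w • B.simple i))) : w = 1 := by
  have key : ∀ N : ℕ, ∀ l : List (Fin n), l.length ≤ N →
      (∀ i, 0 < B.ht (P.root (B.wordProd l • B.simple i))) → B.wordProd l = 1 := by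
    intro N
    induction N with
    | zero =>
      intro l hl _
      rw [List.length_eq_zero_iff.1 (Nat.le_zero.1 hl)]
      rfl
    | succ N ih =>
      intro l hl hpos
      rcases List.eq_nil_or_concat l with rfl | ⟨l₁, j, rfl⟩
      · rfl
      · have h1 : B.wordProd (l₁.concat j) = B.wordProd l₁ * B.s j := by simp [wordProd]
        -- The last letter sends $\alpha_j$ to $-\alpha_j$, so the shorter word makes $\alpha_j$
        -- negative; the exchange condition then replaces the word by one that is two letters
        -- shorter.
        have h2 : B.ht (P.root (B.wordProd l₁ • B.simple j)) < 0 := by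
          have := hpos j
          rw [h1, mul_smul, s, ofIdx_smul_self, smul_negIdx, root_negIdx, map_neg] at this
          linarith
        obtain ⟨l₂, hl₂, he⟩ := B.exists_wordProd_mul_s l₁ j h2
        rw [h1, he]
        apply ih l₂ _ (by rw [← he, ← h1]; exact hpos)
        simp at hl
        omega
  obtain ⟨l, rfl⟩ := B.exists_wordProd w
  exact key _ l le_rfl h

end SimpleSystem
end CalibratedHecke

namespace CalibratedHecke
open RootPairing MulOpposite

variable {ι V V' : Type*} [AddCommGroup V] [Module ℝ V] [AddCommGroup V'] [Module ℝ V']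
  {P : RootPairing ι ℝ V V'} {n : ℕ}

/-! ### The action on the lattice and on characters -/

namespace TranslationLattice

variable (L : TranslationLattice P)

theorem act_one (v : L.carrier) : L.act 1 v = v := by
  ext
  change op (((1 : P.weylGroup)⁻¹ : P.weylGroup) : P.Aut) • (v : V') = v
  simp

theorem act_inv_act (w : P.weylGroup) (v : L.carrier) : L.act w⁻¹ (L.act w v) = v := by
  rw [← act_mul, inv_mul_cancel, act_one]

theorem act_coroot (w : P.weylGroup) (k : ι) : L.act w (L.coroot k) = L.coroot (w • k) :=
  Subtype.ext (coroot_smul w k).symm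

theorem act_halfCoroot [Finite ι] (w : P.weylGroup) {k : ι} (hk : k ∈ R2 P) :
    L.act w (L.halfCoroot k) = L.halfCoroot (w • k) := by
  apply Subtype.ext
  rw [L.coe_halfCoroot (smul_mem_R2 w hk), coroot_smul]
  change op ((w⁻¹ : P.weylGroup) : P.Aut) • (L.halfCoroot k : V') = _
  rw [L.coe_halfCoroot hk, smul_comm]

theorem coroot_negIdx (k : ι) : L.coroot (negIdx P k) = -L.coroot k :=
  Subtype.ext (CalibratedHecke.coroot_negIdx k)

theorem halfCoroot_add_self [Finite ι] {k : ι} (hk : k ∈ R2 P) :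
    L.halfCoroot k + L.halfCoroot k = L.coroot k := by
  apply Subtype.ext
  rw [AddSubgroup.coe_add, L.coe_halfCoroot hk, ← add_smul]
  norm_num [coroot]

theorem halfCoroot_negIdx [Finite ι] {k : ι} (hk : k ∈ R2 P) :
    L.halfCoroot (negIdx P k) = -L.halfCoroot k := by
  apply Subtype.ext
  rw [AddSubgroup.coe_neg, L.coe_halfCoroot hk, L.coe_halfCoroot (negIdx_mem_R2 hk),
    CalibratedHecke.coroot_negIdx, smul_neg]

theorem tw_apply (w : P.weylGroup) (t : AddChar L.carrier ℂ) (v : L.carrier) :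
    L.tw w t v = t (L.act w⁻¹ v) := rfl

theorem tw_mul (w w' : P.weylGroup) (t : AddChar L.carrier ℂ) :
    L.tw (w * w') t = L.tw w (L.tw w' t) := by
  ext v
  rw [tw_apply, tw_apply, tw_apply, mul_inv_rev, act_mul]

theorem tw_one (t : AddChar L.carrier ℂ) : L.tw 1 t = t := by
  ext v
  rw [tw_apply, inv_one, act_one]

theorem tw_coroot (w : P.weylGroup) (t : AddChar L.carrier ℂ) (k : ι) :
    L.tw w t (L.coroot k) = t (L.coroot (w⁻¹ • k)) := by
  rw [tw_apply, act_coroot]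

theorem tw_halfCoroot [Finite ι] (w : P.weylGroup) (t : AddChar L.carrier ℂ) {k : ι}
    (hk : k ∈ R2 P) : L.tw w t (L.halfCoroot k) = t (L.halfCoroot (w⁻¹ • k)) := by
  rw [tw_apply, act_halfCoroot _ _ hk]

end TranslationLattice

/-! ### Values of $d_\alpha$, $n_\alpha$ and $a_\alpha$ at characters. -/

variable {B : SimpleSystem P n} (q : ParameterSystem B) (L : TranslationLattice P)

theorem eval_dElt (t : AddChar L.carrier ℂ) (k : ι) :
    L.eval t (dElt L k) = 1 - (t (L.coroot k))⁻¹ := by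
  rw [dElt, map_sub, map_one, L.eval_mon, AddChar.map_neg_eq_inv]

theorem eval_dElt_eq_zero_iff (t : AddChar L.carrier ℂ) (k : ι) :
    L.eval t (dElt L k) = 0 ↔ t (L.coroot k) = 1 := by
  rw [eval_dElt, sub_eq_zero, eq_comm, inv_eq_one]

theorem eval_dElt_tw (w : P.weylGroup) (t : AddChar L.carrier ℂ) (k : ι) :
    L.eval (L.tw w t) (dElt L k) = L.eval t (dElt L (w⁻¹ • k)) := by
  rw [eval_dElt, eval_dElt, L.tw_coroot]

theorem eval_nElt_of_mem_R2 (t : AddChar L.carrier ℂ) {k : ι} (hk : k ∈ R2 P) :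
    L.eval t (nElt q L k) =
      (1 - (√q.q0 : ℂ)⁻¹ * (√(q.qRoot k) : ℂ)⁻¹ * (t (L.halfCoroot k))⁻¹) *
        (1 + (√q.q0 : ℂ) * (√(q.qRoot k) : ℂ)⁻¹ * (t (L.halfCoroot k))⁻¹) := by
  rw [nElt, if_pos hk]
  simp only [map_mul, map_sub, map_add, map_one, map_smul, L.eval_mon, AddChar.map_neg_eq_inv,
    smul_eq_mul]
  push_cast
  ring

theorem eval_nElt_of_notMem_R2 (t : AddChar L.carrier ℂ) {k : ι} (hk : k ∉ R2 P) :
    L.eval t (nElt q L k) = 1 - (q.qRoot k : ℂ)⁻¹ * (t (L.coroot k))⁻¹ := by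
  rw [nElt, if_neg hk]
  simp only [map_sub, map_one, map_smul, L.eval_mon, AddChar.map_neg_eq_inv, smul_eq_mul]

theorem eval_aElt_of_mem_R2 (t : AddChar L.carrier ℂ) {k : ι} (hk : k ∈ R2 P) :
    L.eval t (aElt q L k) = 1 - (q.qRoot k : ℂ)⁻¹ +
      ((√q.q0 : ℂ) * (√(q.qRoot k) : ℂ)⁻¹ - (√q.q0 : ℂ)⁻¹ * (√(q.qRoot k) : ℂ)⁻¹) *
        (t (L.halfCoroot k))⁻¹ := by
  rw [aElt, if_pos hk]
  simp only [map_add, map_smul, L.eval_mon, AddChar.map_neg_eq_inv, smul_eq_mul, AlgHom.commutes]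
  push_cast
  rfl

theorem eval_aElt_of_notMem_R2 (t : AddChar L.carrier ℂ) {k : ι} (hk : k ∉ R2 P) :
    L.eval t (aElt q L k) = 1 - (q.qRoot k : ℂ)⁻¹ := by
  rw [aElt, if_neg hk, AlgHom.commutes]
  rfl

theorem qRoot_simple (i : Fin n) : q.qRoot (B.simple i) = q.q i := by
  have := q.qRoot_smul 1 i
  rwa [one_smul] at this

theorem eval_nElt_tw [Finite ι] (w w' : P.weylGroup) (t : AddChar L.carrier ℂ) (i : Fin n) :
    L.eval (L.tw w t) (nElt q L (w' • B.simple i)) =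
      L.eval t (nElt q L (w⁻¹ • w' • B.simple i)) := by
  have h : q.qRoot (w⁻¹ • w' • B.simple i) = q.qRoot (w' • B.simple i) := by
    rw [smul_smul, q.qRoot_smul, q.qRoot_smul]
  by_cases hk : w' • B.simple i ∈ R2 P
  · rw [eval_nElt_of_mem_R2 q L _ hk, eval_nElt_of_mem_R2 q L _ (smul_mem_R2 _ hk), h,
      L.tw_halfCoroot _ _ hk]
  · rw [eval_nElt_of_notMem_R2 q L _ hk,
      eval_nElt_of_notMem_R2 q L _ (mt (smul_mem_R2_iff _).1 hk), h, L.tw_coroot]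

/-- The product `n_α(t) n_{-α}(t)`. -/
noncomputable def nn (k : ι) (t : AddChar L.carrier ℂ) : ℂ :=
  L.eval t (nElt q L k) * L.eval t (nElt q L (negIdx P k))

theorem nn_negIdx (k : ι) (t : AddChar L.carrier ℂ) : nn q L (negIdx P k) t = nn q L k t := by
  rw [nn, nn, negIdx_negIdx, mul_comm]

theorem nn_simple_tw [Finite ι] (w : P.weylGroup) (t : AddChar L.carrier ℂ) (i : Fin n) :
    nn q L (B.simple i) (L.tw w t) = nn q L (w⁻¹ • B.simple i) t := by
  have h1 := eval_nElt_tw q L w 1 t i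
  have h2 := eval_nElt_tw q L w (B.s i) t i
  rw [one_smul] at h1
  rw [SimpleSystem.s, ofIdx_smul_self, smul_negIdx] at h2
  rw [nn, nn, h1, h2]

/-! ### The set `F_J(t)` -/

section

variable [Finite ι] [P.IsRootSystem] [P.IsCrystallographic]

/-- The reflection $s_i$ permutes the roots of $R_0^+$ other than $\alpha_i$, so only $\pm
w^{-1}\alpha_i$ can change sides. -/
theorem mem_inversionSet_s_mul {w : P.weylGroup} {i : Fin n} {k : ι}
    (h1 : k ≠ w⁻¹ • B.simple i) (h2 : k ≠ negIdx P (w⁻¹ • B.simple i)) :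
    k ∈ B.inversionSet (B.s i * w)⁻¹ ↔ k ∈ B.inversionSet w⁻¹ := by
  rw [B.mem_inversionSet, B.mem_inversionSet]
  refine and_congr_right fun hk => and_congr_right fun _ => ?_
  have hk' : w • k ∈ R0 P := smul_mem_R0 w hk
  have h1' : w • k ≠ B.simple i := fun h => h1 (by rw [← h, inv_smul_smul])
  have h2' : w • k ≠ negIdx P (B.simple i) := fun h =>
    h2 (by rw [← smul_negIdx, ← h, inv_smul_smul])
  rw [mul_smul]
  have key : ∀ m ∈ R0 P, m ≠ negIdx P (B.simple i) → B.ht (P.root m) < 0 →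
      B.ht (P.root (B.s i • m)) < 0 := by
    intro m hm hne h
    have := B.ht_s_smul_pos_of_mem_R0 (i := i) (negIdx_mem_R0 hm)
      (by rw [root_negIdx, map_neg]; linarith) (fun h => hne (by rw [← h, negIdx_negIdx]))
    rw [smul_negIdx, root_negIdx, map_neg] at this
    linarith
  refine ⟨fun h => ?_, key _ hk' h2'⟩
  have h3 := B.ht_root_ne_zero (w • k)
  by_contra hn
  have := B.ht_s_smul_pos_of_mem_R0 hk' (lt_of_le_of_ne (not_lt.1 hn) h3.symm) h1'
  linarith

theorem mem_inversionSet_s_mul_of_eq {w : P.weylGroup} {i : Fin n} {k : ι} (hk : k ∈ B.R0pos)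
    (h : k = w⁻¹ • B.simple i ∨ k = negIdx P (w⁻¹ • B.simple i)) :
    k ∈ B.inversionSet (B.s i * w)⁻¹ ↔ k ∉ B.inversionSet w⁻¹ := by
  obtain ⟨h0, hp⟩ := B.mem_R0pos.1 hk
  rw [B.mem_inversionSet, B.mem_inversionSet]
  have h1 : P.root ((B.s i * w) • k) = -P.root (w • k) := by
    rw [mul_smul]
    rcases h with rfl | rfl
    · rw [smul_inv_smul, SimpleSystem.s, ofIdx_smul_self, root_negIdx]
    · rw [← smul_negIdx, smul_inv_smul, SimpleSystem.s, smul_negIdx, ofIdx_smul_self, root_negIdx,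
        root_negIdx]
  rw [h1, map_neg]
  have := B.ht_root_ne_zero (w • k)
  grind

theorem exists_mem_R0pos_eq (w : P.weylGroup) (i : Fin n) : ∃ k ∈ B.R0pos,
    k = w⁻¹ • B.simple i ∨ k = negIdx P (w⁻¹ • B.simple i) := by
  have h0 : w⁻¹ • B.simple i ∈ R0 P := smul_mem_R0 _ (B.simple_mem_R0 i)
  rcases lt_or_gt_of_ne (B.ht_root_ne_zero (w⁻¹ • B.simple i)) with h | h
  · refine ⟨_, B.mem_R0pos.2 ⟨negIdx_mem_R0 h0, ?_⟩, Or.inr rfl⟩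
    rw [root_negIdx, map_neg]; linarith
  · exact ⟨_, B.mem_R0pos.2 ⟨h0, h⟩, Or.inl rfl⟩

variable {q L} {J : Set ι} {t : AddChar L.carrier ℂ}

theorem nn_eq_of_eq {w : P.weylGroup} {i : Fin n} {k : ι}
    (h : k = w⁻¹ • B.simple i ∨ k = negIdx P (w⁻¹ • B.simple i)) :
    nn q L k t = nn q L (B.simple i) (L.tw w t) := by
  rw [nn_simple_tw]
  rcases h with rfl | rfl
  · rfl
  · rw [nn_negIdx]

/-- The step crosses a wall belonging to $N(t)$, and the side of such a wall is fixed by $J$. -/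
theorem s_mul_notMem_setF {w : P.weylGroup} (hw : w ∈ setF q L J t) {i : Fin n}
    (h : nn q L (B.simple i) (L.tw w t) = 0) : B.s i * w ∉ setF q L J t := by
  intro hs
  obtain ⟨k, hk, hk'⟩ := exists_mem_R0pos_eq (B := B) w i
  have hN : k ∈ setN B q L t := ⟨hk, by rw [← nn_eq_of_eq hk'] at h; exact h⟩
  have h1 := hs.1.trans hw.1.symm
  have h2 := mem_inversionSet_s_mul_of_eq hk hk'
  have h3 := congrArg (k ∈ ·) h1
  simp only [Set.mem_inter_iff, hN, and_true, h2, eq_iff_iff] at h3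
  tauto

/-- The only root whose side changes is invisible to both conditions that define $F_J(t)$. -/
theorem s_mul_mem_setF_of_notMem {w : P.weylGroup} (hw : w ∈ setF q L J t) {i : Fin n} {k : ι}
    (hk : k ∈ B.R0pos) (hk' : k = w⁻¹ • B.simple i ∨ k = negIdx P (w⁻¹ • B.simple i))
    (hN : k ∉ setN B q L t) (hD : k ∉ setD B L t) : B.s i * w ∈ setF q L J t := by
  have key : ∀ S : Set ι, S ⊆ B.R0pos → k ∉ S →
      B.inversionSet (B.s i * w)⁻¹ ∩ S = B.inversionSet w⁻¹ ∩ S := by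
    intro S hS hkS
    ext m
    simp only [Set.mem_inter_iff]
    refine and_congr_left fun hm => ?_
    have hne : m ≠ k := fun h => hkS (h ▸ hm)
    have hneg : m ≠ negIdx P k := by
      intro h
      have h1 := (B.mem_R0pos.1 (hS hm)).2
      have h2 := (B.mem_R0pos.1 hk).2
      rw [h, root_negIdx, map_neg] at h1
      linarith
    rcases hk' with rfl | rfl
    · exact mem_inversionSet_s_mul hne hneg
    · rw [negIdx_negIdx] at hneg
      exact mem_inversionSet_s_mul hneg hne
  exact ⟨by rw [key _ (fun _ h => h.1) hN]; exact hw.1, by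
    rw [key _ (fun _ h => h.1) hD]; exact hw.2⟩

theorem s_mul_mem_setF {w : P.weylGroup} (hw : w ∈ setF q L J t) {i : Fin n}
    (hd : L.eval (L.tw w t) (dElt L (B.simple i)) ≠ 0)
    (h : nn q L (B.simple i) (L.tw w t) ≠ 0) : B.s i * w ∈ setF q L J t := by
  obtain ⟨k, hk, hk'⟩ := exists_mem_R0pos_eq (B := B) w i
  refine s_mul_mem_setF_of_notMem hw hk hk' (fun hN => h ?_) (fun hD => hd ?_)
  · rw [← nn_eq_of_eq hk']; exact hN.2
  · rw [eval_dElt_tw, eval_dElt_eq_zero_iff]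
    have h1 := (eval_dElt_eq_zero_iff L t k).1 hD.2
    rcases hk' with rfl | rfl
    · exact h1
    · rw [L.coroot_negIdx, AddChar.map_neg_eq_inv, inv_eq_one] at h1
      exact h1

/-- `F_J(t)` is connected under left multiplication by simple reflections. -/
theorem setF_induction {p : P.weylGroup → Prop}
    (hp : ∀ v ∈ setF q L J t, ∀ i, B.s i * v ∈ setF q L J t → p v → p (B.s i * v))
    {w w' : P.weylGroup} (hw : w ∈ setF q L J t) (hw' : w' ∈ setF q L J t) (h : p w) : p w' := by
  -- Induction on the number of roots of $R_0^+$ whose walls separate $w$ from $w'$.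
  have key : ∀ N : ℕ, ∀ w ∈ setF q L J t, p w →
      {k | k ∈ B.R0pos ∧ ¬(k ∈ B.inversionSet w⁻¹ ↔ k ∈ B.inversionSet w'⁻¹)}.ncard = N →
      p w' := by
    intro N
    induction N using Nat.strong_induction_on with
    | _ N ih =>
    intro w hw h hN
    -- If $w'w^{-1}\alpha_i$ is negative, the wall of $w^{-1}\alpha_i$ separates $w$ from $w'$.
    -- Elements of $F_J(t)$ lie on the same side of every wall of $N(t)$ and $D(t)$, so this wall
    -- belongs to neither set and may be crossed, which removes exactly one separating wall.
    by_cases hgood : ∃ i, B.ht (P.root ((w' * w⁻¹) • B.simple i)) < 0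
    · obtain ⟨i, hi⟩ := hgood
      obtain ⟨k, hk, hk'⟩ := exists_mem_R0pos_eq (B := B) w i
      have hsep : ¬(k ∈ B.inversionSet w⁻¹ ↔ k ∈ B.inversionSet w'⁻¹) := by
        obtain ⟨h0, hp⟩ := B.mem_R0pos.1 hk
        simp only [B.mem_inversionSet, h0, hp, true_and]
        rw [mul_smul] at hi
        rcases hk' with rfl | rfl
        · rw [smul_inv_smul, B.ht_simple]
          intro h
          have := h.2 hi
          linarith
        · rw [smul_negIdx, smul_inv_smul, root_negIdx, map_neg, B.ht_simple, smul_negIdx,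
            root_negIdx, map_neg]
          intro h
          have := h.1 (by norm_num)
          linarith
      have hNk : k ∉ setN B q L t := by
        intro hN
        apply hsep
        have h3 := congrArg (k ∈ ·) (hw.1.trans hw'.1.symm)
        simpa only [Set.mem_inter_iff, hN, and_true, eq_iff_iff] using h3
      have hDk : k ∉ setD B L t := by
        intro hD
        apply hsep
        have h3 := congrArg (k ∈ ·) (hw.2.trans hw'.2.symm)
        simpa only [Set.mem_inter_iff, hD, and_true, eq_iff_iff] using h3
      have hsw := s_mul_mem_setF_of_notMem hw hk hk' hNk hDk
      refine ih _ ?_ _ hsw (hp w hw i hsw h) rfl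
      have hsub : {m | m ∈ B.R0pos ∧ ¬(m ∈ B.inversionSet (B.s i * w)⁻¹ ↔
          m ∈ B.inversionSet w'⁻¹)} ⊂
          {m | m ∈ B.R0pos ∧ ¬(m ∈ B.inversionSet w⁻¹ ↔ m ∈ B.inversionSet w'⁻¹)} := by
        rw [Set.ssubset_iff_of_subset]
        · refine ⟨k, ⟨hk, hsep⟩, fun hc => hc.2 ?_⟩
          rw [mem_inversionSet_s_mul_of_eq hk hk']
          tauto
        · intro m hm
          refine ⟨hm.1, ?_⟩
          by_cases hmk : m = w⁻¹ • B.simple i ∨ m = negIdx P (w⁻¹ • B.simple i)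
          · exfalso
            have : m = k := by
              have h1 := (B.mem_R0pos.1 hm.1).2
              have h2 := (B.mem_R0pos.1 hk).2
              rcases hmk with rfl | rfl <;> rcases hk' with rfl | rfl
              · rfl
              · rw [root_negIdx, map_neg] at h2; linarith
              · rw [root_negIdx, map_neg] at h1; linarith
              · rfl
            apply hm.2
            rw [this, mem_inversionSet_s_mul_of_eq hk hk']
            tauto
          · push Not at hmk
            rw [← mem_inversionSet_s_mul hmk.1 hmk.2]
            exact hm.2
      rw [← hN]
      exact Set.ncard_lt_ncard hsub
    · have : w' * w⁻¹ = 1 := by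
        apply B.eq_one_of_forall_ht_pos
        intro i
        push Not at hgood
        exact lt_of_le_of_ne (hgood i) (B.ht_root_ne_zero _).symm
      rw [mul_inv_eq_one] at this
      rwa [this]
  exact key _ w hw h rfl

end

end CalibratedHecke

namespace CalibratedHecke
open RootPairing MulOpposite

variable {ι V V' : Type*} [AddCommGroup V] [Module ℝ V] [AddCommGroup V'] [Module ℝ V']
  {P : RootPairing ι ℝ V V'} {n : ℕ} {B : SimpleSystem P n} (q : ParameterSystem B)
  (L : TranslationLattice P)

/-! ### The coefficients of the operators -/

/-- `q_i^{1/2}`. -/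
noncomputable def sq (i : Fin n) : ℂ := (√(q.q i) : ℝ)

/-- `q_0^{1/2}`. -/
noncomputable def sq0 : ℂ := (√(q.q0) : ℝ)

/-- `q_i^{1/2} - q_i^{-1/2}`. -/
noncomputable def sqDiff (i : Fin n) : ℂ := sq q i - (sq q i)⁻¹

/-- `q_i^{1/2} b_i(χ)`. -/
noncomputable def diagCoeff (i : Fin n) (χ : AddChar L.carrier ℂ) : ℂ :=
  sq q i * bVal q L (B.simple i) χ

/-- `q_i^{1/2} c_i(χ)`. -/
noncomputable def offCoeff (i : Fin n) (χ : AddChar L.carrier ℂ) : ℂ :=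
  sq q i * cVal q L (B.simple i) χ

theorem sq_ne_zero (i : Fin n) : sq q i ≠ 0 := by
  rw [sq, Complex.ofReal_ne_zero]
  exact (Real.sqrt_pos.2 (zero_lt_one.trans (q.one_lt_q i))).ne'

theorem sq0_ne_zero : sq0 q ≠ 0 := by
  rw [sq0, Complex.ofReal_ne_zero]
  exact (Real.sqrt_pos.2 (zero_lt_one.trans q.one_lt_q0)).ne'

theorem sq_sq (i : Fin n) : sq q i ^ 2 = q.q i := by
  rw [sq, ← Complex.ofReal_pow, Real.sq_sqrt (zero_lt_one.trans (q.one_lt_q i)).le]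

variable {L} in
theorem char_ne_zero (χ : AddChar L.carrier ℂ) (v : L.carrier) : χ v ≠ 0 :=
  (χ.val_isUnit v).ne_zero

theorem diagCoeff_of_notMem_R2 {i : Fin n} (hi : B.simple i ∉ R2 P) (χ : AddChar L.carrier ℂ) :
    diagCoeff q L i χ = sqDiff q i / (1 - (χ (L.coroot (B.simple i)))⁻¹) := by
  rw [diagCoeff, bVal, eval_aElt_of_notMem_R2 q L χ hi, eval_dElt, qRoot_simple, ← sq_sq, sqDiff,
    ← mul_div_assoc]
  congr 1
  have := sq_ne_zero q i
  field_simp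

theorem diagCoeff_of_mem_R2 [Finite ι] {i : Fin n} (hi : B.simple i ∈ R2 P)
    (χ : AddChar L.carrier ℂ) :
    diagCoeff q L i χ = (sqDiff q i + (sq0 q - (sq0 q)⁻¹) * (χ (L.halfCoroot (B.simple i)))⁻¹) /
      (1 - (χ (L.halfCoroot (B.simple i)))⁻¹ ^ 2) := by
  rw [diagCoeff, bVal, eval_aElt_of_mem_R2 q L χ hi, eval_dElt, qRoot_simple, ← sq_sq, sqDiff,
    ← mul_div_assoc, ← L.halfCoroot_add_self hi, AddChar.map_add_eq_mul]
  change sq q i * (1 - (sq q i ^ 2)⁻¹ + (sq0 q * (sq q i)⁻¹ - (sq0 q)⁻¹ * (sq q i)⁻¹) * _) / _ = _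
  have := sq_ne_zero q i
  have := sq0_ne_zero q
  have := char_ne_zero χ (L.halfCoroot (B.simple i))
  congr 1
  · field_simp
  · rw [mul_inv]; ring

theorem offCoeff_of_notMem_R2 {i : Fin n} (hi : B.simple i ∉ R2 P) (χ : AddChar L.carrier ℂ) :
    offCoeff q L i χ = (sq q i - (sq q i)⁻¹ * (χ (L.coroot (B.simple i)))⁻¹) /
      (1 - (χ (L.coroot (B.simple i)))⁻¹) := by
  rw [offCoeff, cVal, eval_nElt_of_notMem_R2 q L χ hi, eval_dElt, qRoot_simple, ← sq_sq,
    ← mul_div_assoc]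
  congr 1
  have := sq_ne_zero q i
  have := char_ne_zero χ (L.coroot (B.simple i))
  field_simp

theorem offCoeff_of_mem_R2 [Finite ι] {i : Fin n} (hi : B.simple i ∈ R2 P)
    (χ : AddChar L.carrier ℂ) :
    offCoeff q L i χ = sq q i *
      ((1 - (sq0 q)⁻¹ * (sq q i)⁻¹ * (χ (L.halfCoroot (B.simple i)))⁻¹) *
        (1 + sq0 q * (sq q i)⁻¹ * (χ (L.halfCoroot (B.simple i)))⁻¹)) /
      (1 - (χ (L.halfCoroot (B.simple i)))⁻¹ ^ 2) := by
  rw [offCoeff, cVal, eval_nElt_of_mem_R2 q L χ hi, eval_dElt, qRoot_simple,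
    ← mul_div_assoc, ← L.halfCoroot_add_self hi, AddChar.map_add_eq_mul]
  congr 1
  rw [mul_inv]; ring

theorem nn_of_notMem_R2 {i : Fin n} (hi : B.simple i ∉ R2 P) (χ : AddChar L.carrier ℂ) :
    nn q L (B.simple i) χ = (1 - (sq q i)⁻¹ ^ 2 * (χ (L.coroot (B.simple i)))⁻¹) *
      (1 - (sq q i)⁻¹ ^ 2 * χ (L.coroot (B.simple i))) := by
  have h1 : q.qRoot (negIdx P (B.simple i)) = q.q i := q.qRoot_smul (B.s i) i
  have h2 : negIdx P (B.simple i) ∉ R2 P := mt (smul_mem_R2_iff (B.s i)).1 hi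
  rw [nn, eval_nElt_of_notMem_R2 q L χ hi, eval_nElt_of_notMem_R2 q L χ h2, h1, qRoot_simple,
    ← sq_sq, L.coroot_negIdx, AddChar.map_neg_eq_inv, inv_inv, inv_pow]

theorem nn_of_mem_R2 [Finite ι] {i : Fin n} (hi : B.simple i ∈ R2 P) (χ : AddChar L.carrier ℂ) :
    nn q L (B.simple i) χ =
      (1 - (sq0 q)⁻¹ * (sq q i)⁻¹ * (χ (L.halfCoroot (B.simple i)))⁻¹) *
        (1 + sq0 q * (sq q i)⁻¹ * (χ (L.halfCoroot (B.simple i)))⁻¹) *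
      ((1 - (sq0 q)⁻¹ * (sq q i)⁻¹ * χ (L.halfCoroot (B.simple i))) *
        (1 + sq0 q * (sq q i)⁻¹ * χ (L.halfCoroot (B.simple i)))) := by
  have h1 : q.qRoot (negIdx P (B.simple i)) = q.q i := q.qRoot_smul (B.s i) i
  have h2 : negIdx P (B.simple i) ∈ R2 P := negIdx_mem_R2 hi
  rw [nn, eval_nElt_of_mem_R2 q L χ hi, eval_nElt_of_mem_R2 q L χ h2, h1, qRoot_simple,
    L.halfCoroot_negIdx hi, AddChar.map_neg_eq_inv, inv_inv]
  rfl

theorem coroot_simple_tw_s (i : Fin n) (χ : AddChar L.carrier ℂ) :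
    L.tw (B.s i) χ (L.coroot (B.simple i)) = (χ (L.coroot (B.simple i)))⁻¹ := by
  rw [L.tw_coroot, B.s_inv, SimpleSystem.s, ofIdx_smul_self, L.coroot_negIdx,
    AddChar.map_neg_eq_inv]

theorem halfCoroot_simple_tw_s [Finite ι] {i : Fin n} (hi : B.simple i ∈ R2 P)
    (χ : AddChar L.carrier ℂ) :
    L.tw (B.s i) χ (L.halfCoroot (B.simple i)) = (χ (L.halfCoroot (B.simple i)))⁻¹ := by
  rw [L.tw_halfCoroot _ _ hi, B.s_inv, SimpleSystem.s, ofIdx_smul_self, L.halfCoroot_negIdx hi,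
    AddChar.map_neg_eq_inv]

theorem coroot_eq_halfCoroot_sq [Finite ι] {k : ι} (hk : k ∈ R2 P) (χ : AddChar L.carrier ℂ) :
    χ (L.coroot k) = χ (L.halfCoroot k) ^ 2 := by
  rw [← L.halfCoroot_add_self hk, AddChar.map_add_eq_mul, pow_two]

/-- This is the trace of $T_i$ on the span of $e_w$ and $e_{s_iw}$, the sum of the roots of its
quadratic equation. -/
theorem diagCoeff_add [Finite ι] {i : Fin n} {χ : AddChar L.carrier ℂ}
    (hd : χ (L.coroot (B.simple i)) ≠ 1) :
    diagCoeff q L i χ + diagCoeff q L i (L.tw (B.s i) χ) = sqDiff q i := by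
  by_cases hi : B.simple i ∈ R2 P
  · rw [coroot_eq_halfCoroot_sq L hi] at hd
    rw [diagCoeff_of_mem_R2 q L hi, diagCoeff_of_mem_R2 q L hi, halfCoroot_simple_tw_s L hi]
    have h0 := char_ne_zero χ (L.halfCoroot (B.simple i))
    set h := χ (L.halfCoroot (B.simple i))
    have h1 : h ^ 2 - 1 ≠ 0 := sub_ne_zero.2 hd
    have h2 : 1 - h ^ 2 ≠ 0 := sub_ne_zero.2 hd.symm
    rw [inv_inv]
    generalize sqDiff q i = a
    generalize sq0 q - (sq0 q)⁻¹ = b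
    have h3 : 1 - h⁻¹ ^ 2 = (h ^ 2 - 1) / h ^ 2 := by field_simp
    rw [h3]
    field_simp
    ring
  · rw [diagCoeff_of_notMem_R2 q L hi, diagCoeff_of_notMem_R2 q L hi, coroot_simple_tw_s]
    have h0 := char_ne_zero χ (L.coroot (B.simple i))
    set h := χ (L.coroot (B.simple i))
    have h1 : h - 1 ≠ 0 := sub_ne_zero.2 hd
    have h2 : 1 - h ≠ 0 := sub_ne_zero.2 hd.symm
    rw [inv_inv]
    generalize sqDiff q i = a
    have h3 : 1 - h⁻¹ = (h - 1) / h := by field_simp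
    rw [h3]
    field_simp
    ring

/-- Together with `diagCoeff_add`, this says that the matrix of $T_i$ on the span of $e_w$ and
$e_{s_iw}$ has determinant $-1$. -/
theorem diagCoeff_sq_add [Finite ι] {i : Fin n} {χ : AddChar L.carrier ℂ}
    (hd : χ (L.coroot (B.simple i)) ≠ 1) :
    diagCoeff q L i χ ^ 2 + offCoeff q L i χ * offCoeff q L i (L.tw (B.s i) χ) =
      1 + sqDiff q i * diagCoeff q L i χ := by
  have hs := sq_ne_zero q i
  have hs0 := sq0_ne_zero q
  by_cases hi : B.simple i ∈ R2 P
  · rw [coroot_eq_halfCoroot_sq L hi] at hd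
    rw [diagCoeff_of_mem_R2 q L hi, offCoeff_of_mem_R2 q L hi, offCoeff_of_mem_R2 q L hi,
      halfCoroot_simple_tw_s L hi]
    have h0 := char_ne_zero χ (L.halfCoroot (B.simple i))
    set h := χ (L.halfCoroot (B.simple i))
    have h1 : h ^ 2 - 1 ≠ 0 := sub_ne_zero.2 hd
    have h2 : 1 - h ^ 2 ≠ 0 := sub_ne_zero.2 hd.symm
    have h3 : 1 - h⁻¹ ^ 2 = (h ^ 2 - 1) / h ^ 2 := by field_simp
    have h4 : 1 - h ^ 2 = -(h ^ 2 - 1) := by ring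
    rw [inv_inv, sqDiff, h3, h4]
    field_simp
    ring
  · rw [diagCoeff_of_notMem_R2 q L hi, offCoeff_of_notMem_R2 q L hi,
      offCoeff_of_notMem_R2 q L hi, coroot_simple_tw_s]
    have h0 := char_ne_zero χ (L.coroot (B.simple i))
    set h := χ (L.coroot (B.simple i))
    have h1 : h - 1 ≠ 0 := sub_ne_zero.2 hd
    have h3 : 1 - h⁻¹ = (h - 1) / h := by field_simp
    have h4 : 1 - h = -(h - 1) := by ring
    rw [inv_inv, sqDiff, h3, h4]
    field_simp
    ring

/-- The product of the two off-diagonal entries contains $n_\alpha n_{-\alpha}$, which is why $N(t)$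
is defined by this product and not by $n_\alpha$ alone. -/
theorem offCoeff_mul_tw_s [Finite ι] (i : Fin n) (χ : AddChar L.carrier ℂ) :
    offCoeff q L i χ * offCoeff q L i (L.tw (B.s i) χ) =
      sq q i ^ 2 * nn q L (B.simple i) χ /
        (L.eval χ (dElt L (B.simple i)) * L.eval (L.tw (B.s i) χ) (dElt L (B.simple i))) := by
  have h := eval_nElt_tw q L (B.s i) 1 χ i
  rw [one_smul, B.s_inv, SimpleSystem.s, ofIdx_smul_self] at h
  rw [offCoeff, offCoeff, cVal, cVal, SimpleSystem.s, h, nn, mul_mul_mul_comm, div_mul_div_comm]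
  ring

/-- At a blocked wall the off-diagonal product disappears, so the diagonal entry alone solves the
quadratic equation. -/
theorem diagCoeff_sq [Finite ι] {i : Fin n} {χ : AddChar L.carrier ℂ}
    (hd : χ (L.coroot (B.simple i)) ≠ 1) (hn : nn q L (B.simple i) χ = 0) :
    diagCoeff q L i χ ^ 2 = 1 + sqDiff q i * diagCoeff q L i χ := by
  rw [← diagCoeff_sq_add q L hd, offCoeff_mul_tw_s, hn]
  simp

theorem offCoeff_ne_zero {i : Fin n} {χ : AddChar L.carrier ℂ}
    (hd : χ (L.coroot (B.simple i)) ≠ 1) (hn : nn q L (B.simple i) χ ≠ 0) :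
    offCoeff q L i χ ≠ 0 :=
  mul_ne_zero (sq_ne_zero q i) (div_ne_zero (left_ne_zero_of_mul hn)
    (mt (eval_dElt_eq_zero_iff L χ _).1 hd))

/-! ### The operators on basis vectors -/

section

variable {L} {J : Set ι} {t : AddChar L.carrier ℂ}

theorem e_of_mem {w : P.weylGroup} (hw : w ∈ setF q L J t) :
    e q L J t w = Finsupp.single ⟨w, hw⟩ 1 := dif_pos hw

theorem e_of_notMem {w : P.weylGroup} (hw : w ∉ setF q L J t) : e q L J t w = 0 := dif_neg hw

theorem opT_e {w : P.weylGroup} (hw : w ∈ setF q L J t) (i : Fin n) :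
    opT q L J t i (e q L J t w) = diagCoeff q L i (L.tw w t) • e q L J t w +
      offCoeff q L i (L.tw w t) • e q L J t (B.s i * w) := by
  rw [e_of_mem q hw, opT, Finsupp.linearCombination_single, one_smul, e_of_mem q hw]
  rfl

theorem opX_e (w : P.weylGroup) (v : L.carrier) :
    opX q L J t v (e q L J t w) = L.tw w t v • e q L J t w := by
  by_cases hw : w ∈ setF q L J t
  · rw [e_of_mem q hw, opX, Finsupp.linearCombination_single, one_smul, e_of_mem q hw]
  · rw [e_of_notMem q hw, map_zero, smul_zero]

theorem end_ext {f g : Module.End ℂ (ModuleSpace q L J t)}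
    (h : ∀ w ∈ setF q L J t, f (e q L J t w) = g (e q L J t w)) : f = g := by
  refine Finsupp.lhom_ext' fun w => LinearMap.ext_ring ?_
  have := h w.1 w.2
  rwa [e_of_mem q w.2] at this

theorem linearCombination_opX_e (f : L.GroupAlg) (w : P.weylGroup) :
    Finsupp.linearCombination ℂ (opX q L J t) f.coeff (e q L J t w) =
      L.eval (L.tw w t) f • e q L J t w := by
  rw [Finsupp.linearCombination_apply, Finsupp.sum, LinearMap.sum_apply,
    TranslationLattice.eval, AddMonoidAlgebra.lift_apply, Finsupp.sum, Finset.sum_smul]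
  refine Finset.sum_congr rfl fun v _ => ?_
  rw [LinearMap.smul_apply, opX_e, smul_smul]
  rfl

/-! ### The quadratic and the Bernstein relations -/

section

variable [Finite ι] [P.IsRootSystem] [P.IsCrystallographic]

theorem e_s_mul_eq_zero {w : P.weylGroup} (hw : w ∈ setF q L J t) {i : Fin n}
    (h : nn q L (B.simple i) (L.tw w t) = 0) : e q L J t (B.s i * w) = 0 :=
  e_of_notMem q (s_mul_notMem_setF hw h)

/-- If $s_iw\in F_J(t)$, this is the Cayley–Hamilton identity for a matrix with the trace and
determinant found above; otherwise $e_w$ is an eigenvector. -/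
theorem opT_mul_self
    (hd : ∀ w ∈ setF q L J t, ∀ i, L.tw w t (L.coroot (B.simple i)) ≠ 1)
    (i : Fin n) :
    opT q L J t i * opT q L J t i = 1 + sqDiff q i • opT q L J t i := by
  apply end_ext
  intro w hw
  have hdw := hd w hw i
  by_cases hn : nn q L (B.simple i) (L.tw w t) = 0
  · have h1 : opT q L J t i (e q L J t w) = diagCoeff q L i (L.tw w t) • e q L J t w := by
      rw [opT_e q hw, e_s_mul_eq_zero q hw hn, smul_zero, add_zero]
    rw [Module.End.mul_apply, h1, map_smul, h1, smul_smul, ← pow_two, diagCoeff_sq q L hdw hn,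
      LinearMap.add_apply, LinearMap.smul_apply, h1, Module.End.one_apply]
    module
  · have hs := s_mul_mem_setF hw (mt (eval_dElt_eq_zero_iff L _ _).1 hdw) hn
    have h1 := diagCoeff_add q L hdw
    have h2 := diagCoeff_sq_add q L hdw
    have h3 : B.s i * (B.s i * w) = w := by rw [← mul_assoc, B.s_mul_self, one_mul]
    rw [Module.End.mul_apply, opT_e q hw, map_add, map_smul, map_smul, opT_e q hw, opT_e q hs,
      h3, L.tw_mul, LinearMap.add_apply, LinearMap.smul_apply, opT_e q hw, Module.End.one_apply]
    linear_combination (norm := module) h2 • e q L J t w +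
      (offCoeff q L i (L.tw w t) • h1) • e q L J t (B.s i * w)

end

/-- The $e_{s_iw}$-terms cancel because $(s_iwt)^{s_i\lambda}=(wt)^\lambda$; what is left is the
definition of $b_i$ with its denominator cleared. -/
theorem opT_mul_opX
    (hd : ∀ w ∈ setF q L J t, ∀ i, L.tw w t (L.coroot (B.simple i)) ≠ 1)
    (i : Fin n) (v : L.carrier) :
    opT q L J t i * opX q L J t v - opX q L J t (L.act (B.s i) v) * opT q L J t i =
      sq q i • Finsupp.linearCombination ℂ (opX q L J t)
        (aElt q L (B.simple i) * L.divDiff (B.simple i) v).coeff := by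
  apply end_ext
  intro w hw
  have h1 := congrArg (L.eval (L.tw w t)) (L.mul_divDiff (B.simple i) v)
  rw [map_mul, map_sub (L.eval (L.tw w t)) (L.mon v), L.eval_mon, L.eval_mon] at h1
  change L.eval _ (dElt L (B.simple i)) * _ = _ - L.tw w t (L.act (B.s i) v) at h1
  have h2 : L.eval (L.tw w t) (dElt L (B.simple i)) ≠ 0 :=
    mt (eval_dElt_eq_zero_iff L _ _).1 (hd w hw i)
  have h3 : L.tw (B.s i * w) t (L.act (B.s i) v) = L.tw w t v := by
    rw [L.tw_mul, L.tw_apply, L.act_inv_act]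
  rw [LinearMap.sub_apply, Module.End.mul_apply, Module.End.mul_apply, opX_e, map_smul, opT_e q hw,
    map_add, map_smul, map_smul, opX_e, opX_e, h3, LinearMap.smul_apply, linearCombination_opX_e,
    map_mul]
  have h4 : diagCoeff q L i (L.tw w t) * (L.tw w t v - L.tw w t (L.act (B.s i) v)) =
      sq q i * (L.eval (L.tw w t) (aElt q L (B.simple i)) *
        L.eval (L.tw w t) (L.divDiff (B.simple i) v)) := by
    rw [← h1, diagCoeff, bVal]
    field_simp
  linear_combination (norm := module) h4 • e q L J t w

end

end CalibratedHecke

namespace CalibratedHecke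
open RootPairing MulOpposite

/-! ### Yang–Baxter identities -/

section YangBaxter

variable {K A : Type*} [Field K] [Ring A] [Algebra K A] {S T : A} {p k : K}

theorem yangBaxter_two (S T : A) (r₁ r₂ : K) :
    (T - r₂ • 1) * (S - r₁ • 1) - T * S = (S - r₁ • 1) * (T - r₂ • 1) - S * T := by
  simp only [sub_mul, mul_sub, smul_mul_assoc, mul_smul_comm, one_mul, mul_one]
  module

/-- Only the quadratic relations are used, not the braid relation, which is to be deduced from this
identity. After expansion the two sides differ by a multiple of $S-T$, and `h` is the vanishing of
the multiplier. The versions of length four and six have as obstructions the differences $TS-ST$ and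
$TSTS-STST$ of shorter alternating words. -/
theorem yangBaxter_three (hS : S * S = 1 + p • S) (hT : T * T = 1 + p • T) {r₁ r₂ r₃ : K}
    (h : r₁ * r₂ + r₂ * r₃ - p * r₂ - r₁ * r₃ = 0) :
    (S - r₃ • 1) * (T - r₂ • 1) * (S - r₁ • 1) - S * T * S =
      (T - r₁ • 1) * (S - r₂ • 1) * (T - r₃ • 1) - T * S * T := by
  simp only [sub_mul, mul_sub, smul_mul_assoc, mul_smul_comm, one_mul, mul_one, smul_sub, hS, hT]
  linear_combination (norm := module) h • (S - T)

theorem yangBaxter_four (hS : S * S = 1 + p • S) (hT : T * T = 1 + k • T) {r₁ r₂ r₃ r₄ : K}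
    (h : r₃ * r₄ + r₂ * r₃ + r₁ * r₂ - p * r₂ - k * r₃ - r₁ * r₄ = 0) :
    (T - r₄ • 1) * (S - r₃ • 1) * (T - r₂ • 1) * (S - r₁ • 1) - T * S * T * S =
      (S - r₁ • 1) * (T - r₂ • 1) * (S - r₃ • 1) * (T - r₄ • 1) - S * T * S * T := by
  simp only [mul_assoc, sub_mul, mul_sub, smul_mul_assoc, mul_smul_comm, one_mul, mul_one,
    smul_sub, mul_add, add_mul, smul_add, hS, hT]
  linear_combination (norm := module) h • (T * S - S * T)

theorem yangBaxter_six (hS : S * S = 1 + p • S) (hT : T * T = 1 + k • T)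
    {r₁ r₂ r₃ r₄ r₅ r₆ : K}
    (h₁ : r₁ * r₂ + r₂ * r₃ + r₃ * r₄ + r₄ * r₅ + r₅ * r₆ - p * r₂ - k * r₃ - p * r₄ - k * r₅ -
      r₁ * r₆ = 0)
    (h₂ : r₃ * r₄ * r₅ * r₆ + r₂ * r₃ * r₅ * r₆ - k * r₃ * r₅ * r₆ + r₁ * r₂ * r₅ * r₆ -
      p * r₂ * r₅ * r₆ + r₄ * r₆ + r₂ * r₃ * r₄ * r₅ - k * r₃ * r₄ * r₅ + r₁ * r₂ * r₄ * r₅ -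
      p * r₂ * r₄ * r₅ - k * r₂ * r₃ * r₅ + r₃ * r₅ + k * k * r₃ * r₅ - k * r₁ * r₂ * r₅ +
      k * p * r₂ * r₅ + r₁ * r₂ * r₃ * r₄ - p * r₂ * r₃ * r₄ - p * r₁ * r₂ * r₄ + r₂ * r₄ +
      p * p * r₂ * r₄ - k * r₄ + r₁ * r₃ - p * r₃ - r₁ * r₂ * r₃ * r₆ - r₁ * r₃ * r₄ * r₆ +
      k * r₁ * r₃ * r₆ - r₁ * r₄ * r₅ * r₆ + p * r₁ * r₄ * r₆ - r₁ * r₅ - r₂ * r₆ = 0) :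
    (T - r₆ • 1) * (S - r₅ • 1) * (T - r₄ • 1) * (S - r₃ • 1) * (T - r₂ • 1) * (S - r₁ • 1) -
        T * S * T * S * T * S =
      (S - r₁ • 1) * (T - r₂ • 1) * (S - r₃ • 1) * (T - r₄ • 1) * (S - r₅ • 1) * (T - r₆ • 1) -
        S * T * S * T * S * T := by
  simp only [mul_assoc, sub_mul, mul_sub, smul_mul_assoc, mul_smul_comm, one_mul, mul_one,
    smul_sub, mul_add, add_mul, smul_add, hS, hT]
  linear_combination (norm := module) h₁ • (T * (S * (T * S)) - S * (T * (S * T))) +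
     h₂ • (T * S - S * T)

end YangBaxter

/-! ### Scalar conditions of the Yang–Baxter identities, for $z=\chi(\alpha_i^\vee)$ and
$y=\chi(\alpha_j^\vee)$. -/

section Scalars

variable {K : Type*} [Field K] {z y : K} (p k : K)

theorem scalar_three (hz : z ≠ 0) (hy : y ≠ 0) (h₁ : z ≠ 1) (h₂ : z * y ≠ 1) (h₃ : y ≠ 1) :
    p / (1 - z⁻¹) * (p / (1 - (z * y)⁻¹)) + p / (1 - (z * y)⁻¹) * (p / (1 - y⁻¹)) -
      p * (p / (1 - (z * y)⁻¹)) - p / (1 - z⁻¹) * (p / (1 - y⁻¹)) = 0 := by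
  have key : ∀ a : K, a ≠ 0 → 1 - a⁻¹ = (a - 1) / a := fun a ha => by field_simp
  have h₁' := sub_ne_zero.2 h₁
  have h₂' := sub_ne_zero.2 h₂
  have h₃' := sub_ne_zero.2 h₃
  rw [key z hz, key y hy, key _ (mul_ne_zero hz hy)]
  field_simp
  ring

/-- The variable $h$ is a square root of $\chi(\alpha_j^\vee)$. In type $BC_2$ it is the value at
$\alpha_j^\vee/2$ and $k_0=q_0^{1/2}-q_0^{-1/2}$; the reduced type $C_2$ is the specialization
$k_0=0$, where the sign of $h$ does not matter. -/
theorem scalar_four (k₀ : K) {h : K} (hz : z ≠ 0) (hh : h ≠ 0) (h₁ : z ≠ 1) (h₂ : (z * h) ^ 2 ≠ 1)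
    (h₃ : z * h ^ 2 ≠ 1) (h₄ : h ^ 2 ≠ 1) {r₁ r₂ r₃ r₄ : K} (e₁ : r₁ = p / (1 - z⁻¹))
    (e₂ : r₂ = (k + k₀ * (z * h)⁻¹) / (1 - (z * h)⁻¹ ^ 2)) (e₃ : r₃ = p / (1 - (z * h ^ 2)⁻¹))
    (e₄ : r₄ = (k + k₀ * h⁻¹) / (1 - h⁻¹ ^ 2)) :
    r₃ * r₄ + r₂ * r₃ + r₁ * r₂ - p * r₂ - k * r₃ - r₁ * r₄ = 0 := by
  have key : ∀ a : K, a ≠ 0 → 1 - a⁻¹ = (a - 1) / a := fun a ha => by field_simp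
  have h₁' := sub_ne_zero.2 h₁
  have h₂' : z ^ 2 * h ^ 2 - 1 ≠ 0 := by rw [← mul_pow]; exact sub_ne_zero.2 h₂
  have h₃' := sub_ne_zero.2 h₃
  have h₄' := sub_ne_zero.2 h₄
  have hzh := mul_ne_zero hz hh
  rw [e₁, e₂, e₃, e₄, inv_pow, inv_pow, key z hz, key _ (pow_ne_zero 2 hzh),
    key _ (pow_ne_zero 2 hh), key _ (mul_ne_zero hz (pow_ne_zero 2 hh)), mul_pow]
  field_simp
  ring

theorem scalar_six (hz : z ≠ 0) (hy : y ≠ 0) (h₁ : z ≠ 1) (h₂ : z * y ≠ 1)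
    (h₃ : z ^ 2 * y ^ 3 ≠ 1) (h₄ : z * y ^ 2 ≠ 1) (h₅ : z * y ^ 3 ≠ 1) (h₆ : y ≠ 1)
    {r₁ r₂ r₃ r₄ r₅ r₆ : K} (e₁ : r₁ = p / (1 - z⁻¹)) (e₂ : r₂ = k / (1 - (z * y)⁻¹))
    (e₃ : r₃ = p / (1 - (z ^ 2 * y ^ 3)⁻¹)) (e₄ : r₄ = k / (1 - (z * y ^ 2)⁻¹))
    (e₅ : r₅ = p / (1 - (z * y ^ 3)⁻¹)) (e₆ : r₆ = k / (1 - y⁻¹)) :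
    r₁ * r₂ + r₂ * r₃ + r₃ * r₄ + r₄ * r₅ + r₅ * r₆ - p * r₂ - k * r₃ - p * r₄ - k * r₅ -
      r₁ * r₆ = 0 ∧
    r₃ * r₄ * r₅ * r₆ + r₂ * r₃ * r₅ * r₆ - k * r₃ * r₅ * r₆ + r₁ * r₂ * r₅ * r₆ -
      p * r₂ * r₅ * r₆ + r₄ * r₆ + r₂ * r₃ * r₄ * r₅ - k * r₃ * r₄ * r₅ + r₁ * r₂ * r₄ * r₅ -
      p * r₂ * r₄ * r₅ - k * r₂ * r₃ * r₅ + r₃ * r₅ + k * k * r₃ * r₅ - k * r₁ * r₂ * r₅ +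
      k * p * r₂ * r₅ + r₁ * r₂ * r₃ * r₄ - p * r₂ * r₃ * r₄ - p * r₁ * r₂ * r₄ + r₂ * r₄ +
      p * p * r₂ * r₄ - k * r₄ + r₁ * r₃ - p * r₃ - r₁ * r₂ * r₃ * r₆ - r₁ * r₃ * r₄ * r₆ +
      k * r₁ * r₃ * r₆ - r₁ * r₄ * r₅ * r₆ + p * r₁ * r₄ * r₆ - r₁ * r₅ - r₂ * r₆ = 0 := by
  have key : ∀ a : K, a ≠ 0 → a ≠ 1 → ∀ c : K, c / (1 - a⁻¹) = c * (a / (a - 1)) := by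
    intro a ha ha' c
    have := sub_ne_zero.2 ha'
    rw [show 1 - a⁻¹ = (a - 1) / a by field_simp]
    field_simp
  have h₁' := sub_ne_zero.2 h₁
  have h₂' := sub_ne_zero.2 h₂
  have h₃' := sub_ne_zero.2 h₃
  have h₄' := sub_ne_zero.2 h₄
  have h₅' := sub_ne_zero.2 h₅
  have h₆' := sub_ne_zero.2 h₆
  rw [key z hz h₁] at e₁
  rw [key _ (by simp [hz, hy]) h₂] at e₂
  rw [key _ (by simp [hz, hy]) h₃] at e₃
  rw [key _ (by simp [hz, hy]) h₄] at e₄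
  rw [key _ (by simp [hz, hy]) h₅] at e₅
  rw [key y hy h₆] at e₆
  constructor
  · rw [e₁, e₂, e₃, e₄, e₅, e₆]
    field_simp
    ring
  · rw [e₁, e₂, e₃, e₄, e₅, e₆]
    field_simp
    ring

end Scalars
end CalibratedHecke

namespace CalibratedHecke
open RootPairing MulOpposite

variable {ι V V' : Type*} [AddCommGroup V] [Module ℝ V] [AddCommGroup V'] [Module ℝ V']
  {P : RootPairing ι ℝ V V'} {n : ℕ}

/-! ### Pairs of simple roots -/

namespace SimpleSystem

variable (B : SimpleSystem P n)

/-- The shape $v+x\alpha_i+y\alpha_j$ is reproduced, so powers of $s_is_j$ can be computed on an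
arbitrary vector by repeated rewriting. -/
theorem s_mul_s_smul {i j : Fin n} (v : V) (x y : ℝ) :
    (B.s i * B.s j) • (v + (x • P.root (B.simple i) + y • P.root (B.simple j))) =
      v + ((-x - P.toLinearMap v (P.coroot (B.simple i)) - P.pairing (B.simple j) (B.simple i) *
          (-y - P.toLinearMap v (P.coroot (B.simple j)) -
            P.pairing (B.simple i) (B.simple j) * x)) • P.root (B.simple i) +
        (-y - P.toLinearMap v (P.coroot (B.simple j)) - P.pairing (B.simple i) (B.simple j) * x) •
          P.root (B.simple j)) := by
  rw [mul_smul, s, s, ofIdx_smul_vec, ofIdx_smul_vec]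
  simp only [map_add, map_sub, map_smul, LinearMap.add_apply, LinearMap.sub_apply,
    LinearMap.smul_apply, P.root_coroot_eq_pairing, P.pairing_same, smul_eq_mul]
  module

variable [P.IsRootSystem]

/-- The root $s_j\alpha_i$ has $\alpha_i$-coordinate $1$, so it is positive, and its
$\alpha_j$-coordinate is minus the pairing. -/
theorem pairing_nonpos {i j : Fin n} (hij : i ≠ j) :
    P.pairing (B.simple i) (B.simple j) ≤ 0 := by
  have h1 : B.basis.coord i (P.root (B.s j • B.simple i)) = 1 := by
    rw [B.coord_s_smul hij, coord_simple, if_pos rfl]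
  have h2 := B.coord_nonneg (B.ht_pos_of_coord_pos (h1 ▸ one_pos)) j
  rw [s, root_ofIdx_smul, map_sub, map_smul, coord_simple, coord_simple, if_neg hij.symm,
    if_pos rfl] at h2
  simpa using h2

/-- Among the pairs of integers allowed by the crystallographic condition, linear independence
excludes the product $4$ and `pairing_nonpos` excludes positive signs. -/
theorem pairing_cases [Finite ι] [P.IsCrystallographic] {i j : Fin n} (hij : i ≠ j) :
    (P.pairing (B.simple i) (B.simple j) = 0 ∧ P.pairing (B.simple j) (B.simple i) = 0) ∨
    (P.pairing (B.simple i) (B.simple j) = -1 ∧ P.pairing (B.simple j) (B.simple i) = -1) ∨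
    (P.pairing (B.simple i) (B.simple j) = -2 ∧ P.pairing (B.simple j) (B.simple i) = -1) ∨
    (P.pairing (B.simple i) (B.simple j) = -1 ∧ P.pairing (B.simple j) (B.simple i) = -2) ∨
    (P.pairing (B.simple i) (B.simple j) = -3 ∧ P.pairing (B.simple j) (B.simple i) = -1) ∨
    (P.pairing (B.simple i) (B.simple j) = -1 ∧ P.pairing (B.simple j) (B.simple i) = -3) := by
  have h1 := B.pairing_nonpos hij
  have h2 := B.pairing_nonpos hij.symm
  have h3 := P.pairingIn_pairingIn_mem_set_of_isCrystallographic (B.simple i) (B.simple j)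
  have h4 : P.coxeterWeightIn ℤ (B.simple i) (B.simple j) ≠ 4 := by
    rw [← P.linearIndependent_iff_coxeterWeightIn_ne_four]
    have h := B.linearIndependent.comp ![i, j] (by
      intro a b
      fin_cases a <;> fin_cases b <;> simp [hij, hij.symm])
    have e : ![P.root (B.simple i), P.root (B.simple j)] =
        (fun i => P.root (B.simple i)) ∘ ![i, j] := by
      ext a
      fin_cases a <;> rfl
    rw [e]
    exact h
  rw [RootPairing.coxeterWeightIn] at h4
  simp only [← P.algebraMap_pairingIn ℤ, algebraMap_int_eq, eq_intCast] at h1 h2 ⊢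
  simp only [Set.mem_insert_iff, Set.mem_singleton_iff, Prod.mk.injEq] at h3
  norm_cast at h1 h2 ⊢
  rcases h3 with h | h | h | h | h | h | h | h | h | h | h | h | h | h | h | h | h <;>
  · obtain ⟨ha, hb⟩ := h
    rw [ha, hb] at h4
    rw [ha] at h1
    rw [hb] at h2
    omega

theorem orderOf_s_mul_s_two {i j : Fin n} (hij : i ≠ j)
    (h1 : P.pairing (B.simple i) (B.simple j) = 0)
    (h2 : P.pairing (B.simple j) (B.simple i) = 0) :
    orderOf (B.s i * B.s j) = 2 := by
  -- The zero summands bring the vector into the form to which `s_mul_s_smul` applies.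
  have key : ∀ (m : ℕ) (v : V), (B.s i * B.s j) ^ m • v = (B.s i * B.s j) ^ m •
    (v + ((0 : ℝ) • P.root (B.simple i) + (0 : ℝ) • P.root (B.simple j))) := by simp
  have key' : ∀ m : ℕ, (B.s i * B.s j) ^ m = 1 → P.root (B.simple i) = (B.s i * B.s j) ^ m •
      (P.root (B.simple i) + ((0 : ℝ) • P.root (B.simple i) + (0 : ℝ) • P.root (B.simple j))) := by
    intro m hm
    rw [hm, one_smul]
    simp
  have hm : (B.s i * B.s j) ^ 2 = 1 := by
    apply weylGroup_smul_eq_self_of_forall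
    intro v
    rw [key]
    simp only [pow_succ, pow_zero, mul_smul _ (B.s i * B.s j), one_mul, s_mul_s_smul,
      h1, h2]
    module
  have : Fact (Nat.Prime 2) := ⟨by norm_num⟩
  refine orderOf_eq_prime hm fun h => ?_
  rw [← pow_one (B.s i * B.s j)] at h
  have e := key' _ h
  simp only [pow_succ, pow_zero, one_mul, s_mul_s_smul, h1, h2,
    P.root_coroot_eq_pairing, P.pairing_same] at e
  have e' := congrArg (B.basis.coord i) e
  simp only [map_add, map_smul, coord_simple, if_pos, if_neg hij, smul_eq_mul] at e'
  norm_num at e'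

theorem orderOf_s_mul_s_three {i j : Fin n} (hij : i ≠ j)
    (h1 : P.pairing (B.simple i) (B.simple j) = -1)
    (h2 : P.pairing (B.simple j) (B.simple i) = -1) :
    orderOf (B.s i * B.s j) = 3 := by
  have key : ∀ (m : ℕ) (v : V), (B.s i * B.s j) ^ m • v = (B.s i * B.s j) ^ m •
    (v + ((0 : ℝ) • P.root (B.simple i) + (0 : ℝ) • P.root (B.simple j))) := by simp
  have key' : ∀ m : ℕ, (B.s i * B.s j) ^ m = 1 → P.root (B.simple i) = (B.s i * B.s j) ^ m •
      (P.root (B.simple i) + ((0 : ℝ) • P.root (B.simple i) + (0 : ℝ) • P.root (B.simple j))) := by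
    intro m hm
    rw [hm, one_smul]
    simp
  have hm : (B.s i * B.s j) ^ 3 = 1 := by
    apply weylGroup_smul_eq_self_of_forall
    intro v
    rw [key]
    simp only [pow_succ, pow_zero, mul_smul _ (B.s i * B.s j), one_mul, s_mul_s_smul,
      h1, h2]
    module
  have : Fact (Nat.Prime 3) := ⟨by norm_num⟩
  refine orderOf_eq_prime hm fun h => ?_
  rw [← pow_one (B.s i * B.s j)] at h
  have e := key' _ h
  simp only [pow_succ, pow_zero, one_mul, s_mul_s_smul, h1, h2,
    P.root_coroot_eq_pairing, P.pairing_same] at e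
  have e' := congrArg (B.basis.coord i) e
  simp only [map_add, map_smul, coord_simple, if_pos, if_neg hij, smul_eq_mul] at e'
  norm_num at e'

theorem orderOf_s_mul_s_four {i j : Fin n} (hij : i ≠ j)
    (h1 : P.pairing (B.simple i) (B.simple j) = -2)
    (h2 : P.pairing (B.simple j) (B.simple i) = -1) :
    orderOf (B.s i * B.s j) = 4 := by
  have key : ∀ (m : ℕ) (v : V), (B.s i * B.s j) ^ m • v = (B.s i * B.s j) ^ m •
    (v + ((0 : ℝ) • P.root (B.simple i) + (0 : ℝ) • P.root (B.simple j))) := by simp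
  have key' : ∀ m : ℕ, (B.s i * B.s j) ^ m = 1 → P.root (B.simple i) = (B.s i * B.s j) ^ m •
      (P.root (B.simple i) + ((0 : ℝ) • P.root (B.simple i) + (0 : ℝ) • P.root (B.simple j))) := by
    intro m hm
    rw [hm, one_smul]
    simp
  have hm : (B.s i * B.s j) ^ 4 = 1 := by
    apply weylGroup_smul_eq_self_of_forall
    intro v
    rw [key]
    simp only [pow_succ, pow_zero, mul_smul _ (B.s i * B.s j), one_mul, s_mul_s_smul,
      h1, h2]
    module
  -- Once the fourth power is trivial, the order is $4$ as soon as the square is not; this is tested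
  -- on $\alpha_i$.
  refine orderOf_eq_prime_pow (p := 2) (n := 1) ?_ hm
  rw [pow_one]
  intro h
  have e := key' _ h
  simp only [pow_succ, pow_zero, mul_smul _ (B.s i * B.s j), one_mul, s_mul_s_smul, h1, h2,
    P.root_coroot_eq_pairing, P.pairing_same] at e
  have e' := congrArg (B.basis.coord i) e
  simp only [map_add, map_smul, coord_simple, if_pos, if_neg hij, smul_eq_mul] at e'
  norm_num at e'

theorem orderOf_s_mul_s_six {i j : Fin n} (hij : i ≠ j)
    (h1 : P.pairing (B.simple i) (B.simple j) = -1)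
    (h2 : P.pairing (B.simple j) (B.simple i) = -3) :
    orderOf (B.s i * B.s j) = 6 := by
  have key : ∀ (m : ℕ) (v : V), (B.s i * B.s j) ^ m • v = (B.s i * B.s j) ^ m •
    (v + ((0 : ℝ) • P.root (B.simple i) + (0 : ℝ) • P.root (B.simple j))) := by simp
  have key' : ∀ m : ℕ, (B.s i * B.s j) ^ m = 1 → P.root (B.simple i) = (B.s i * B.s j) ^ m •
      (P.root (B.simple i) + ((0 : ℝ) • P.root (B.simple i) + (0 : ℝ) • P.root (B.simple j))) := by
    intro m hm
    rw [hm, one_smul]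
    simp
  have hm : (B.s i * B.s j) ^ 6 = 1 := by
    apply weylGroup_smul_eq_self_of_forall
    intro v
    rw [key]
    simp only [pow_succ, pow_zero, mul_smul _ (B.s i * B.s j), one_mul, s_mul_s_smul,
      h1, h2]
    module
  have hm2 : (B.s i * B.s j) ^ 2 ≠ 1 := by
    intro h
    have e := key' _ h
    simp only [pow_succ, pow_zero, mul_smul _ (B.s i * B.s j), one_mul, s_mul_s_smul, h1, h2,
      P.root_coroot_eq_pairing, P.pairing_same] at e
    have e' := congrArg (B.basis.coord j) e
    simp only [map_add, map_smul, coord_simple, if_pos, if_neg hij.symm, smul_eq_mul] at e'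
    norm_num at e'
  have hm3 : (B.s i * B.s j) ^ 3 ≠ 1 := by
    intro h
    have e := key' _ h
    simp only [pow_succ, pow_zero, mul_smul _ (B.s i * B.s j), one_mul, s_mul_s_smul, h1, h2,
      P.root_coroot_eq_pairing, P.pairing_same] at e
    have e' := congrArg (B.basis.coord i) e
    simp only [map_add, map_smul, coord_simple, if_pos, if_neg hij, smul_eq_mul] at e'
    norm_num at e'
  refine orderOf_eq_of_pow_and_pow_div_prime (by norm_num) hm fun p hp hdvd => ?_
  have hp6 : p ≤ 6 := Nat.le_of_dvd (by norm_num) hdvd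
  interval_cases p <;> first | exact hm3 | exact hm2 | (exfalso; revert hp hdvd; norm_num)


end SimpleSystem
end CalibratedHecke

namespace CalibratedHecke
open RootPairing MulOpposite

variable {ι V V' : Type*} [AddCommGroup V] [Module ℝ V] [AddCommGroup V'] [Module ℝ V']
  {P : RootPairing ι ℝ V V'} {n : ℕ} {B : SimpleSystem P n} (q : ParameterSystem B)
  (L : TranslationLattice P)

/-! ### Coefficients attached to roots -/

/-- `q_α^{1/2} b_α(χ)`. -/
noncomputable def rootDiag (k : ι) (χ : AddChar L.carrier ℂ) : ℂ :=
  (√(q.qRoot k) : ℝ) * bVal q L k χ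

/-- `q_α^{1/2} c_α(χ)`, or `0` if `n_α(χ) n_{-α}(χ) = 0`. -/
noncomputable def rootOff (k : ι) (χ : AddChar L.carrier ℂ) : ℂ :=
  if nn q L k χ = 0 then 0 else (√(q.qRoot k) : ℝ) * cVal q L k χ

theorem eval_aElt_tw [Finite ι] (w : P.weylGroup) (χ : AddChar L.carrier ℂ) (i : Fin n) :
    L.eval (L.tw w χ) (aElt q L (B.simple i)) = L.eval χ (aElt q L (w⁻¹ • B.simple i)) := by
  have h : q.qRoot (w⁻¹ • B.simple i) = q.qRoot (B.simple i) := by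
    rw [q.qRoot_smul, qRoot_simple]
  by_cases hk : B.simple i ∈ R2 P
  · rw [eval_aElt_of_mem_R2 q L _ hk, eval_aElt_of_mem_R2 q L _ (smul_mem_R2 _ hk), h,
      L.tw_halfCoroot _ _ hk]
  · rw [eval_aElt_of_notMem_R2 q L _ hk,
      eval_aElt_of_notMem_R2 q L _ (mt (smul_mem_R2_iff _).1 hk), h]

theorem diagCoeff_tw [Finite ι] (w : P.weylGroup) (χ : AddChar L.carrier ℂ) (i : Fin n) :
    diagCoeff q L i (L.tw w χ) = rootDiag q L (w⁻¹ • B.simple i) χ := by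
  rw [diagCoeff, rootDiag, bVal, bVal, eval_aElt_tw, eval_dElt_tw, q.qRoot_smul]
  rfl

theorem offCoeff_tw [Finite ι] (w : P.weylGroup) (χ : AddChar L.carrier ℂ) (i : Fin n) :
    offCoeff q L i (L.tw w χ) =
      (√(q.qRoot (w⁻¹ • B.simple i)) : ℝ) * cVal q L (w⁻¹ • B.simple i) χ := by
  have h := eval_nElt_tw q L w 1 χ i
  rw [one_smul] at h
  rw [offCoeff, cVal, cVal, h, eval_dElt_tw, q.qRoot_smul]
  rfl

theorem rootDiag_of_notMem_R2 [Finite ι] {u : P.weylGroup} {k : ι} {i : Fin n}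
    (hk : u • B.simple i = k) (hi : B.simple i ∉ R2 P) (χ : AddChar L.carrier ℂ) :
    rootDiag q L k χ = sqDiff q i / (1 - (χ (L.coroot k))⁻¹) := by
  have h := diagCoeff_tw q L u⁻¹ χ i
  rw [inv_inv, hk] at h
  rw [← h, diagCoeff_of_notMem_R2 q L hi, L.tw_coroot, inv_inv, hk]

theorem rootDiag_of_mem_R2 [Finite ι] {u : P.weylGroup} {k : ι} {i : Fin n}
    (hk : u • B.simple i = k) (hi : B.simple i ∈ R2 P) (χ : AddChar L.carrier ℂ) :
    rootDiag q L k χ = (sqDiff q i + (sq0 q - (sq0 q)⁻¹) * (χ (L.halfCoroot k))⁻¹) /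
      (1 - (χ (L.halfCoroot k))⁻¹ ^ 2) := by
  have h := diagCoeff_tw q L u⁻¹ χ i
  rw [inv_inv, hk] at h
  rw [← h, diagCoeff_of_mem_R2 q L hi, L.tw_halfCoroot _ _ hi, inv_inv, hk]

namespace TranslationLattice

theorem act_s_coroot_self (i : Fin n) :
    L.act (B.s i) (L.coroot (B.simple i)) = -L.coroot (B.simple i) := by
  rw [L.act_coroot, SimpleSystem.s, ofIdx_smul_self, L.coroot_negIdx]

theorem act_s_coroot {i j : Fin n} {m : ℤ} (h : P.pairing (B.simple i) (B.simple j) = m) :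
    L.act (B.s i) (L.coroot (B.simple j)) =
      L.coroot (B.simple j) - m • L.coroot (B.simple i) := by
  rw [SimpleSystem.s, L.act_reflection]
  have h1 := L.pair_spec (B.simple i) (L.coroot (B.simple j))
  change P.toLinearMap _ (P.coroot _) = _ at h1
  rw [P.root_coroot_eq_pairing, h] at h1
  rw [← (Int.cast_injective h1 : m = _)]

theorem act_s_halfCoroot [Finite ι] {i j : Fin n} {m : ℤ} (hj : B.simple j ∈ R2 P)
    (h : P.pairing (B.simple i) (B.simple j) = 2 * m) :
    L.act (B.s i) (L.halfCoroot (B.simple j)) =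
      L.halfCoroot (B.simple j) - m • L.coroot (B.simple i) := by
  rw [SimpleSystem.s, L.act_reflection]
  have h1 := L.pair_spec (B.simple i) (L.halfCoroot (B.simple j))
  rw [L.coe_halfCoroot hj, map_smul, P.root_coroot_eq_pairing, h, smul_eq_mul] at h1
  have h2 : (m : ℝ) = (L.pair (B.simple i) (L.halfCoroot (B.simple j)) : ℝ) := by
    rw [← h1]; ring
  rw [← (Int.cast_injective h2 : m = _)]

end TranslationLattice

/-! ### Chains of intertwiners -/

/-- The product of the operators `T_i - q_i^{1/2} b_i` along a word, read from the vector `e_{u w}`,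
where `χ = w t`. -/
noncomputable def opChain (J : Set ι) (t χ : AddChar L.carrier ℂ) :
    List (Fin n) → P.weylGroup → Module.End ℂ (ModuleSpace q L J t)
  | [], _ => 1
  | i :: l, u => opChain J t χ l (B.s i * u) *
      (opT q L J t i - rootDiag q L (u⁻¹ • B.simple i) χ • 1)

/-- The coefficient produced by `opChain`. -/
noncomputable def offChain (χ : AddChar L.carrier ℂ) : List (Fin n) → P.weylGroup → ℂ
  | [], _ => 1
  | i :: l, u => rootOff q L (u⁻¹ • B.simple i) χ * offChain χ l (B.s i * u)

variable (B) in
/-- The end point of the chain along a word. -/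
noncomputable def chainEnd : List (Fin n) → P.weylGroup → P.weylGroup
  | [], u => u
  | i :: l, u => chainEnd l (B.s i * u)

section

variable [Finite ι] [P.IsRootSystem] [P.IsCrystallographic]
variable {q L} {J : Set ι} {t : AddChar L.carrier ℂ}

/-- Each factor subtracts exactly the diagonal entry of $T_i$ at the current vector, so only the
next basis vector survives. The scalar $C$ permits the chain to continue after leaving $F_J(t)$:
from then on the coefficient is $0$, and membership is required only while it is nonzero. -/
theorem opChain_apply (hd : ∀ w ∈ setF q L J t, ∀ i, L.tw w t (L.coroot (B.simple i)) ≠ 1)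
    (w : P.weylGroup) (l : List (Fin n)) (u : P.weylGroup) (C : ℂ)
    (hC : C ≠ 0 → u * w ∈ setF q L J t) :
    opChain q L J t (L.tw w t) l u (C • e q L J t (u * w)) =
      (C * offChain q L (L.tw w t) l u) • e q L J t (chainEnd B l u * w) := by
  induction l generalizing u C with
  | nil => simp [opChain, offChain, chainEnd]
  | cons i l ih =>
    have hnn := nn_simple_tw q L u (L.tw w t) i
    have key : (opT q L J t i - rootDiag q L (u⁻¹ • B.simple i) (L.tw w t) • 1)
        (C • e q L J t (u * w)) =
        (C * rootOff q L (u⁻¹ • B.simple i) (L.tw w t)) • e q L J t (B.s i * u * w) := by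
      by_cases h0 : C = 0
      · simp [h0]
      · have hu := hC h0
        rw [map_smul, LinearMap.sub_apply, opT_e q hu, L.tw_mul u w t, diagCoeff_tw,
          LinearMap.smul_apply, Module.End.one_apply, add_sub_cancel_left, mul_smul, rootOff,
          ← hnn, offCoeff_tw]
        -- At a blocked wall $c_i$ itself need not vanish, but $e_{s_iw}$ does; this is the reason
        -- for the cut-off in `rootOff`.
        split_ifs with h
        · rw [← L.tw_mul] at h
          rw [e_s_mul_eq_zero q hu h, smul_zero, zero_smul]
        · rw [mul_assoc]
    rw [opChain, Module.End.mul_apply, key, ih, offChain, chainEnd, mul_assoc C]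
    intro h
    have hu := hC (left_ne_zero_of_mul h)
    have hn : nn q L (B.simple i) (L.tw (u * w) t) ≠ 0 := by
      rw [L.tw_mul, hnn]
      intro h0
      apply right_ne_zero_of_mul h
      rw [rootOff, if_pos h0]
    rw [mul_assoc]
    exact s_mul_mem_setF hu (mt (eval_dElt_eq_zero_iff L _ _).1 (hd _ hu i)) hn

/-- In the applications $X$ and $X'$ are the two alternating words of a braid relation, and `h` is a
Yang–Baxter identity. The chains agree on $e_w$, hence so do the words. -/
theorem apply_e_eq_of_opChain
    (hd : ∀ w ∈ setF q L J t, ∀ i, L.tw w t (L.coroot (B.simple i)) ≠ 1)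
    {w : P.weylGroup} (hw : w ∈ setF q L J t) {l l' : List (Fin n)}
    {X X' : Module.End ℂ (ModuleSpace q L J t)}
    (h : opChain q L J t (L.tw w t) l 1 - X = opChain q L J t (L.tw w t) l' 1 - X')
    (hend : chainEnd B l 1 = chainEnd B l' 1)
    (hoff : offChain q L (L.tw w t) l 1 = offChain q L (L.tw w t) l' 1) :
    X (e q L J t w) = X' (e q L J t w) := by
  have h1 := opChain_apply hd w l 1 1 (fun _ => by rwa [one_mul])
  have h2 := opChain_apply hd w l' 1 1 (fun _ => by rwa [one_mul])
  rw [one_smul, one_mul] at h1 h2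
  rw [hend, hoff, ← h2] at h1
  have h3 := LinearMap.congr_fun h (e q L J t w)
  rw [LinearMap.sub_apply, LinearMap.sub_apply, h1] at h3
  exact sub_right_injective h3

end

end CalibratedHecke

namespace CalibratedHecke
open RootPairing MulOpposite

variable {ι V V' : Type*} [AddCommGroup V] [Module ℝ V] [AddCommGroup V'] [Module ℝ V']
  {P : RootPairing ι ℝ V V'} {n : ℕ} {B : SimpleSystem P n} {q : ParameterSystem B}
  {L : TranslationLattice P}

/-! ### The braid relations at regular weights -/

theorem chi_ne_one_of_isRegularAt {i j : Fin n} {χ : AddChar L.carrier ℂ}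
    (h : IsRegularAt B L i j χ) {u : P.weylGroup} (hu : u ∈ Subgroup.closure {B.s i, B.s j}) :
    χ (L.coroot (u • B.simple i)) ≠ 1 ∧ χ (L.coroot (u • B.simple j)) ≠ 1 := by
  have := h u⁻¹ (inv_mem hu)
  rwa [L.tw_coroot, L.tw_coroot, inv_inv] at this

theorem s_left_mem_closure (i j : Fin n) : B.s i ∈ Subgroup.closure {B.s i, B.s j} :=
  Subgroup.subset_closure (Set.mem_insert _ _)

theorem s_right_mem_closure (i j : Fin n) : B.s j ∈ Subgroup.closure {B.s i, B.s j} :=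
  Subgroup.subset_closure (Set.mem_insert_of_mem _ rfl)

/-- If $2\alpha$ is a root, then $\alpha^\vee=2(2\alpha)^\vee$ pairs with every root to an even
integer. -/
theorem notMem_R2_of_pairing_eq [Finite ι] [P.IsCrystallographic] {k m : ι} {a : ℤ} (ha : Odd a)
    (h : P.pairing k m = a) : m ∉ R2 P := by
  rintro ⟨m', hm'⟩
  have : IsAddTorsionFree V' := .of_isTorsionFree ℝ V'
  have h1 := P.smul_coroot_eq_of_root_eq_smul m m' 2 hm'
  obtain ⟨z, hz⟩ := exists_int_pairing (P := P) k m'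
  rw [← P.root_coroot_eq_pairing, ← h1, map_smul, P.root_coroot_eq_pairing, hz, smul_eq_mul] at h
  have h2 : 2 * z = a := by exact_mod_cast h
  rw [← h2] at ha
  exact Int.not_even_iff_odd.2 ha (even_two_mul z)

section

variable [Finite ι] [P.IsRootSystem] [P.IsCrystallographic] {J : Set ι} {t : AddChar L.carrier ℂ}

/-- No regularity is needed, since `yangBaxter_two` holds for arbitrary scalars. -/
theorem braid_two_apply (hd : ∀ w ∈ setF q L J t, ∀ i, L.tw w t (L.coroot (B.simple i)) ≠ 1)
    {i j : Fin n} (hij : i ≠ j) (h1 : P.pairing (B.simple i) (B.simple j) = 0)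
    (h2 : P.pairing (B.simple j) (B.simple i) = 0) {w : P.weylGroup} (hw : w ∈ setF q L J t) :
    (opT q L J t j * opT q L J t i) (e q L J t w) =
      (opT q L J t i * opT q L J t j) (e q L J t w) := by
  have r1 : B.s i • B.simple j = B.simple j := by
    apply P.root.injective
    rw [SimpleSystem.s, root_ofIdx_smul, h2, zero_smul, sub_zero]
  have r2 : B.s j • B.simple i = B.simple i := by
    apply P.root.injective
    rw [SimpleSystem.s, root_ofIdx_smul, h1, zero_smul, sub_zero]
  refine apply_e_eq_of_opChain (l := [i, j]) (l' := [j, i]) hd hw ?_ ?_ ?_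
  · simp only [opChain, mul_one, one_mul, inv_one, one_smul, B.s_inv, r1, r2]
    exact yangBaxter_two (K := ℂ) (A := Module.End ℂ (ModuleSpace q L J t)) _ _ _ _
  · simp only [chainEnd, mul_one]
    have h := pow_orderOf_eq_one (B.s i * B.s j)
    rw [B.orderOf_s_mul_s_two hij h1 h2] at h
    rw [pow_two, mul_eq_one_iff_eq_inv, mul_inv_rev, B.s_inv, B.s_inv] at h
    exact h.symm
  · simp only [offChain, mul_one, inv_one, one_smul, B.s_inv, r1, r2]
    ring

theorem braid_three_apply (hd : ∀ w ∈ setF q L J t, ∀ i, L.tw w t (L.coroot (B.simple i)) ≠ 1)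
    {i j : Fin n} (hij : i ≠ j) (h1 : P.pairing (B.simple i) (B.simple j) = -1)
    (h2 : P.pairing (B.simple j) (B.simple i) = -1) {w : P.weylGroup} (hw : w ∈ setF q L J t)
    (hreg : IsRegularAt B L i j (L.tw w t)) :
    (opT q L J t i * opT q L J t j * opT q L J t i) (e q L J t w) =
      (opT q L J t j * opT q L J t i * opT q L J t j) (e q L J t w) := by
  have r1 : B.s i • B.s j • B.simple i = B.simple j := by
    apply P.root.injective
    simp only [root_smul, SimpleSystem.s, ofIdx_smul_vec, map_sub, map_smul, LinearMap.sub_apply,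
      LinearMap.smul_apply, P.root_coroot_eq_pairing, P.pairing_same, h1, h2, smul_eq_mul]
    module
  have r2 : B.s j • B.s i • B.simple j = B.simple i := by
    apply P.root.injective
    simp only [root_smul, SimpleSystem.s, ofIdx_smul_vec, map_sub, map_smul, LinearMap.sub_apply,
      LinearMap.smul_apply, P.root_coroot_eq_pairing, P.pairing_same, h1, h2, smul_eq_mul]
    module
  have r3 : B.s j • B.simple i = B.s i • B.simple j := by
    rw [← r1, B.s_smul_s_smul]
  have hgrp : B.s i * (B.s j * B.s i) = B.s j * (B.s i * B.s j) := by
    have h := pow_orderOf_eq_one (B.s i * B.s j)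
    rw [B.orderOf_s_mul_s_three hij h1 h2] at h
    have h' : B.s i * (B.s j * B.s i) * (B.s j * (B.s i * B.s j)) = 1 := by
      rw [← h]; simp only [pow_succ, pow_zero, one_mul, mul_assoc]
    rw [mul_eq_one_iff_eq_inv] at h'
    simpa only [mul_inv_rev, B.s_inv, mul_assoc] using h'
  have hi2 : B.simple i ∉ R2 P := notMem_R2_of_pairing_eq (a := -1) (by decide) (by simpa using h2)
  have hj2 : B.simple j ∉ R2 P := notMem_R2_of_pairing_eq (a := -1) (by decide) (by simpa using h1)
  -- The braid relation of length three in $W_0$ conjugates $s_i$ into $s_j$, so the parameters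
  -- agree.
  have hq : sqDiff q i = sqDiff q j := by
    have : q.q i = q.q j := by
      apply q.q_eq_of_isConj
      rw [isConj_iff]
      refine ⟨B.s i * B.s j, ?_⟩
      have := congrArg (· * (B.s j * B.s i)) hgrp
      have hs := B.s_mul_self
      simp only [mul_assoc] at this
      rw [mul_inv_rev, B.s_inv, B.s_inv]
      calc B.s i * B.s j * B.s i * (B.s j * B.s i) = B.s i * (B.s j * (B.s i * (B.s j * B.s i))) := by
            simp only [mul_assoc]
        _ = B.s j * (B.s i * (B.s j * (B.s j * B.s i))) := this
        _ = B.s j := by rw [← mul_assoc (B.s j) (B.s j), hs, one_mul, hs, mul_one]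
    rw [sqDiff, sqDiff, sq, sq, this]
  have hcl := s_left_mem_closure (B := B) i j
  have hcr := s_right_mem_closure (B := B) i j
  have c2 : L.coroot (B.s i • B.simple j) = L.coroot (B.simple i) + L.coroot (B.simple j) := by
    rw [← L.act_coroot, L.act_s_coroot (m := -1) (by simpa using h1)]
    abel
  have n1 := (chi_ne_one_of_isRegularAt hreg (one_mem _)).1
  have n2 := (chi_ne_one_of_isRegularAt hreg hcl).2
  have n3 := (chi_ne_one_of_isRegularAt hreg (one_mem _)).2
  rw [one_smul] at n1 n3
  have e1 := rootDiag_of_notMem_R2 q L (one_smul P.weylGroup (B.simple i)) hi2 (L.tw w t)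
  have e2 := rootDiag_of_notMem_R2 q L (rfl : B.s i • B.simple j = _) hj2 (L.tw w t)
  have e3 := rootDiag_of_notMem_R2 q L (one_smul P.weylGroup (B.simple j)) hj2 (L.tw w t)
  rw [c2, AddChar.map_add_eq_mul] at n2 e2
  refine apply_e_eq_of_opChain (l := [i, j, i]) (l' := [j, i, j]) hd hw ?_ ?_ ?_
  · simp only [opChain, mul_one, one_mul, inv_one, one_smul, B.s_inv, mul_inv_rev, mul_smul, r2,
      r3, B.s_smul_s_smul]
    refine yangBaxter_three (K := ℂ) (A := Module.End ℂ (ModuleSpace q L J t)) (S := opT q L J t i)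
      (T := opT q L J t j) (p := sqDiff q i) (opT_mul_self q hd i)
      (by rw [hq]; exact opT_mul_self q hd j) ?_
    rw [e1, e2, e3, ← hq]
    exact scalar_three _ (char_ne_zero _ _) (char_ne_zero _ _) n1 n2 n3
  · simp only [chainEnd, mul_one]
    exact hgrp
  · simp only [offChain, mul_one, inv_one, one_smul, B.s_inv, mul_inv_rev, mul_smul, r2, r3,
      B.s_smul_s_smul]
    ring

theorem braid_four_apply (hd : ∀ w ∈ setF q L J t, ∀ i, L.tw w t (L.coroot (B.simple i)) ≠ 1)
    {i j : Fin n} (hij : i ≠ j) (h1 : P.pairing (B.simple i) (B.simple j) = -2)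
    (h2 : P.pairing (B.simple j) (B.simple i) = -1) {w : P.weylGroup} (hw : w ∈ setF q L J t)
    (hreg : IsRegularAt B L i j (L.tw w t)) :
    (opT q L J t j * opT q L J t i * opT q L J t j * opT q L J t i) (e q L J t w) =
      (opT q L J t i * opT q L J t j * opT q L J t i * opT q L J t j) (e q L J t w) := by
  have r1 : B.s i • B.s j • B.s i • B.simple j = B.simple j := by
    apply P.root.injective
    simp only [root_smul, SimpleSystem.s, ofIdx_smul_vec, map_sub, map_smul, LinearMap.sub_apply,
      LinearMap.smul_apply, P.root_coroot_eq_pairing, P.pairing_same, h1, h2, smul_eq_mul]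
    module
  have r2 : B.s j • B.s i • B.s j • B.simple i = B.simple i := by
    apply P.root.injective
    simp only [root_smul, SimpleSystem.s, ofIdx_smul_vec, map_sub, map_smul, LinearMap.sub_apply,
      LinearMap.smul_apply, P.root_coroot_eq_pairing, P.pairing_same, h1, h2, smul_eq_mul]
    module
  have r3 : B.s j • B.s i • B.simple j = B.s i • B.simple j := by
    rw [← B.s_smul_s_smul i (B.s j • B.s i • B.simple j), r1]
  have r4 : B.s i • B.s j • B.simple i = B.s j • B.simple i := by
    rw [← B.s_smul_s_smul j (B.s i • B.s j • B.simple i), r2]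
  have hgrp : B.s j * (B.s i * (B.s j * B.s i)) = B.s i * (B.s j * (B.s i * B.s j)) := by
    have h := pow_orderOf_eq_one (B.s i * B.s j)
    rw [B.orderOf_s_mul_s_four hij h1 h2] at h
    have h' : B.s i * (B.s j * (B.s i * B.s j)) * (B.s i * (B.s j * (B.s i * B.s j))) = 1 := by
      rw [← h]; simp only [pow_succ, pow_zero, one_mul, mul_assoc]
    rw [mul_eq_one_iff_eq_inv] at h'
    simpa only [mul_inv_rev, B.s_inv, mul_assoc] using h'.symm
  have hi2 : B.simple i ∉ R2 P := notMem_R2_of_pairing_eq (a := -1) (by decide) (by simpa using h2)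
  have hcl := s_left_mem_closure (B := B) i j
  have hcr := s_right_mem_closure (B := B) i j
  have n1 := (chi_ne_one_of_isRegularAt hreg (one_mem _)).1
  have n2 := (chi_ne_one_of_isRegularAt hreg hcl).2
  have n3 := (chi_ne_one_of_isRegularAt hreg hcr).1
  have n4 := (chi_ne_one_of_isRegularAt hreg (one_mem _)).2
  rw [one_smul] at n1 n4
  have e1 := rootDiag_of_notMem_R2 q L (one_smul P.weylGroup (B.simple i)) hi2 (L.tw w t)
  have e3 := rootDiag_of_notMem_R2 q L (rfl : B.s j • B.simple i = _) hi2 (L.tw w t)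
  have c2 : L.coroot (B.s i • B.simple j) =
      L.coroot (B.simple j) + (2 : ℕ) • L.coroot (B.simple i) := by
    rw [← L.act_coroot, L.act_s_coroot (m := -2) (by simpa using h1)]
    module
  have c3 : L.coroot (B.s j • B.simple i) = L.coroot (B.simple i) + L.coroot (B.simple j) := by
    rw [← L.act_coroot, L.act_s_coroot (m := -1) (by simpa using h2)]
    module
  rw [c2, AddChar.map_add_eq_mul, AddChar.map_nsmul_eq_pow] at n2
  rw [c3, AddChar.map_add_eq_mul] at n3 e3
  have hz := char_ne_zero (L.tw w t) (L.coroot (B.simple i))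
  -- Types $C_2$ and $BC_2$ are treated together: $h$ is the value at $\alpha_j^\vee/2$ if
  -- $2\alpha_j$ is a root, and otherwise any complex square root of the value at $\alpha_j^\vee$,
  -- with $k_0=0$.
  obtain ⟨h, k₀, hh, hy, e2, e4⟩ : ∃ h k₀ : ℂ, h ≠ 0 ∧
      L.tw w t (L.coroot (B.simple j)) = h ^ 2 ∧
      rootDiag q L (B.s i • B.simple j) (L.tw w t) =
        (sqDiff q j + k₀ * (L.tw w t (L.coroot (B.simple i)) * h)⁻¹) /
          (1 - (L.tw w t (L.coroot (B.simple i)) * h)⁻¹ ^ 2) ∧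
      rootDiag q L (B.simple j) (L.tw w t) =
        (sqDiff q j + k₀ * h⁻¹) / (1 - h⁻¹ ^ 2) := by
    by_cases hj2 : B.simple j ∈ R2 P
    · refine ⟨L.tw w t (L.halfCoroot (B.simple j)), sq0 q - (sq0 q)⁻¹, char_ne_zero _ _,
        coroot_eq_halfCoroot_sq L hj2 _, ?_,
        rootDiag_of_mem_R2 q L (one_smul P.weylGroup (B.simple j)) hj2 _⟩
      rw [rootDiag_of_mem_R2 q L (rfl : B.s i • B.simple j = _) hj2, ← L.act_halfCoroot _ hj2,
        L.act_s_halfCoroot (m := -1) hj2 (by rw [h1]; norm_num), neg_smul, one_smul, sub_neg_eq_add,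
        AddChar.map_add_eq_mul, mul_comm (L.tw w t (L.halfCoroot (B.simple j)))]
    · obtain ⟨h, hh⟩ := IsAlgClosed.exists_pow_nat_eq (L.tw w t (L.coroot (B.simple j))) two_pos
      refine ⟨h, 0, fun h0 => char_ne_zero (L.tw w t) (L.coroot (B.simple j)) ?_, hh.symm, ?_, ?_⟩
      · rw [← hh, h0]; simp
      · rw [rootDiag_of_notMem_R2 q L (rfl : B.s i • B.simple j = _) hj2, c2,
          AddChar.map_add_eq_mul, AddChar.map_nsmul_eq_pow, ← hh]
        congr 1
        · ring
        · rw [inv_pow, mul_pow, mul_comm]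
      · rw [rootDiag_of_notMem_R2 q L (one_smul P.weylGroup (B.simple j)) hj2, ← hh, inv_pow]
        congr 1
        ring
  rw [hy] at n2 n3 n4 e3
  refine apply_e_eq_of_opChain (l := [i, j, i, j]) (l' := [j, i, j, i]) hd hw ?_ ?_ ?_
  · simp only [opChain, mul_one, one_mul, inv_one, one_smul, B.s_inv, mul_inv_rev, mul_smul,
      r3, r4, B.s_smul_s_smul, mul_assoc]
    have := yangBaxter_four (K := ℂ) (A := Module.End ℂ (ModuleSpace q L J t)) (S := opT q L J t i)
      (T := opT q L J t j) (p := sqDiff q i)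
      (k := sqDiff q j) (opT_mul_self q hd i) (opT_mul_self q hd j)
      (scalar_four _ _ k₀ hz hh n1 (by rwa [mul_pow, mul_comm]) n3 n4 e1 e2 e3 e4)
    simpa only [mul_assoc] using this
  · simp only [chainEnd, mul_one]
    exact hgrp
  · simp only [offChain, mul_one, inv_one, one_smul, B.s_inv, mul_inv_rev, mul_smul, r3, r4,
      B.s_smul_s_smul]
    ring

theorem braid_six_apply (hd : ∀ w ∈ setF q L J t, ∀ i, L.tw w t (L.coroot (B.simple i)) ≠ 1)
    {i j : Fin n} (hij : i ≠ j) (h1 : P.pairing (B.simple i) (B.simple j) = -1)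
    (h2 : P.pairing (B.simple j) (B.simple i) = -3) {w : P.weylGroup} (hw : w ∈ setF q L J t)
    (hreg : IsRegularAt B L i j (L.tw w t)) :
    (opT q L J t j * opT q L J t i * opT q L J t j * opT q L J t i * opT q L J t j *
        opT q L J t i) (e q L J t w) =
      (opT q L J t i * opT q L J t j * opT q L J t i * opT q L J t j * opT q L J t i *
        opT q L J t j) (e q L J t w) := by
  have r1 : B.s i • B.s j • B.s i • B.s j • B.s i • B.simple j = B.simple j := by
    apply P.root.injective
    simp only [root_smul, SimpleSystem.s, ofIdx_smul_vec, map_sub, map_smul, LinearMap.sub_apply,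
      LinearMap.smul_apply, P.root_coroot_eq_pairing, P.pairing_same, h1, h2, smul_eq_mul]
    module
  have r2 : B.s j • B.s i • B.s j • B.s i • B.s j • B.simple i = B.simple i := by
    apply P.root.injective
    simp only [root_smul, SimpleSystem.s, ofIdx_smul_vec, map_sub, map_smul, LinearMap.sub_apply,
      LinearMap.smul_apply, P.root_coroot_eq_pairing, P.pairing_same, h1, h2, smul_eq_mul]
    module
  have r3 : B.s j • B.s i • B.s j • B.s i • B.simple j = B.s i • B.simple j := by
    rw [← B.s_smul_s_smul i (B.s j • B.s i • B.s j • B.s i • B.simple j), r1]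
  have r4 : B.s i • B.s j • B.s i • B.s j • B.simple i = B.s j • B.simple i := by
    rw [← B.s_smul_s_smul j (B.s i • B.s j • B.s i • B.s j • B.simple i), r2]
  have r5 : B.s i • B.s j • B.s i • B.simple j = B.s j • B.s i • B.simple j := by
    rw [← B.s_smul_s_smul j (B.s i • B.s j • B.s i • B.simple j), r3]
  have r6 : B.s j • B.s i • B.s j • B.simple i = B.s i • B.s j • B.simple i := by
    rw [← B.s_smul_s_smul i (B.s j • B.s i • B.s j • B.simple i), r4]
  have hgrp : B.s j * (B.s i * (B.s j * (B.s i * (B.s j * B.s i)))) =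
      B.s i * (B.s j * (B.s i * (B.s j * (B.s i * B.s j)))) := by
    have h := pow_orderOf_eq_one (B.s i * B.s j)
    rw [B.orderOf_s_mul_s_six hij h1 h2] at h
    have h' : B.s i * (B.s j * (B.s i * (B.s j * (B.s i * B.s j)))) *
        (B.s i * (B.s j * (B.s i * (B.s j * (B.s i * B.s j))))) = 1 := by
      rw [← h]; simp only [pow_succ, pow_zero, one_mul, mul_assoc]
    rw [mul_eq_one_iff_eq_inv] at h'
    simpa only [mul_inv_rev, B.s_inv, mul_assoc] using h'.symm
  have hi2 : B.simple i ∉ R2 P := notMem_R2_of_pairing_eq (a := -3) (by decide) (by simpa using h2)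
  have hj2 : B.simple j ∉ R2 P := notMem_R2_of_pairing_eq (a := -1) (by decide) (by simpa using h1)
  have hcl := s_left_mem_closure (B := B) i j
  have hcr := s_right_mem_closure (B := B) i j
  have n1 := (chi_ne_one_of_isRegularAt hreg (one_mem _)).1
  have n2 := (chi_ne_one_of_isRegularAt hreg hcl).2
  have n3 := (chi_ne_one_of_isRegularAt hreg (mul_mem hcl hcr)).1
  have n4 := (chi_ne_one_of_isRegularAt hreg (mul_mem hcr hcl)).2
  have n5 := (chi_ne_one_of_isRegularAt hreg hcr).1
  have n6 := (chi_ne_one_of_isRegularAt hreg (one_mem _)).2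
  rw [one_smul] at n1 n6
  rw [mul_smul] at n3 n4
  have e1 := rootDiag_of_notMem_R2 q L (one_smul P.weylGroup (B.simple i)) hi2 (L.tw w t)
  have e2 := rootDiag_of_notMem_R2 q L (rfl : B.s i • B.simple j = _) hj2 (L.tw w t)
  have e3 := rootDiag_of_notMem_R2 q L (mul_smul (B.s i) (B.s j) (B.simple i)) hi2 (L.tw w t)
  have e4 := rootDiag_of_notMem_R2 q L (mul_smul (B.s j) (B.s i) (B.simple j)) hj2 (L.tw w t)
  have e5 := rootDiag_of_notMem_R2 q L (rfl : B.s j • B.simple i = _) hi2 (L.tw w t)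
  have e6 := rootDiag_of_notMem_R2 q L (one_smul P.weylGroup (B.simple j)) hj2 (L.tw w t)
  have a1 := L.act_s_coroot (B := B) (i := i) (j := j) (m := -1) (by simpa using h1)
  have a2 := L.act_s_coroot (B := B) (i := j) (j := i) (m := -3) (by simpa using h2)
  have a3 := L.act_s_coroot_self (B := B) i
  have a4 := L.act_s_coroot_self (B := B) j
  have c2 : L.coroot (B.s i • B.simple j) = L.coroot (B.simple i) + L.coroot (B.simple j) := by
    rw [← L.act_coroot, a1]
    module
  have c5 : L.coroot (B.s j • B.simple i) =
      L.coroot (B.simple i) + (3 : ℕ) • L.coroot (B.simple j) := by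
    rw [← L.act_coroot, a2]
    module
  have c3 : L.coroot (B.s i • B.s j • B.simple i) =
      (2 : ℕ) • L.coroot (B.simple i) + (3 : ℕ) • L.coroot (B.simple j) := by
    rw [← L.act_coroot, c5, map_add, map_nsmul, a1, a3]
    module
  have c4 : L.coroot (B.s j • B.s i • B.simple j) =
      L.coroot (B.simple i) + (2 : ℕ) • L.coroot (B.simple j) := by
    rw [← L.act_coroot, c2, map_add, a2, a4]
    module
  rw [c2, AddChar.map_add_eq_mul] at n2 e2
  rw [c3, AddChar.map_add_eq_mul, AddChar.map_nsmul_eq_pow, AddChar.map_nsmul_eq_pow] at n3 e3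
  rw [c4, AddChar.map_add_eq_mul, AddChar.map_nsmul_eq_pow] at n4 e4
  rw [c5, AddChar.map_add_eq_mul, AddChar.map_nsmul_eq_pow] at n5 e5
  have hs := scalar_six _ _ (char_ne_zero _ _) (char_ne_zero _ _) n1 n2 n3 n4 n5 n6 e1 e2 e3 e4 e5 e6
  refine apply_e_eq_of_opChain (l := [i, j, i, j, i, j]) (l' := [j, i, j, i, j, i]) hd hw ?_ ?_ ?_
  · simp only [opChain, mul_one, one_mul, inv_one, one_smul, B.s_inv, mul_inv_rev, mul_smul,
      r5, r6, B.s_smul_s_smul]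
    exact yangBaxter_six (K := ℂ) (A := Module.End ℂ (ModuleSpace q L J t)) (S := opT q L J t i)
      (T := opT q L J t j) (p := sqDiff q i)
      (k := sqDiff q j) (opT_mul_self q hd i) (opT_mul_self q hd j) hs.1 hs.2
  · simp only [chainEnd, mul_one]
    exact hgrp
  · simp only [offChain, mul_one, inv_one, one_smul, B.s_inv, mul_inv_rev, mul_smul,
      r5, r6, B.s_smul_s_smul]
    ring

end

end CalibratedHecke

namespace CalibratedHecke
open RootPairing MulOpposite

variable {ι V V' : Type*} [AddCommGroup V] [Module ℝ V] [AddCommGroup V'] [Module ℝ V']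
  {P : RootPairing ι ℝ V V'} {n : ℕ} {B : SimpleSystem P n} {q : ParameterSystem B}
  {L : TranslationLattice P}

/-! ### The braid relations at exceptional weights -/

section LinearAlgebra

variable {K M : Type*} [Field K] [AddCommGroup M] [Module K M]

/-- By Cayley–Hamilton, trace $-1$ and determinant $1$ give $X^2+X+1=0$, hence $X^3=1$. -/
theorem iterate_three_apply_eq {X : Module.End K M} {a b : M} {A A' C C' : K}
    (ha : X a = A • a + C • b) (hb : X b = C' • a + A' • b) (htr : A + A' = -1)
    (hdet : A * A' - C * C' = 1) : X (X (X a)) = a := by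
  obtain rfl : A' = -1 - A := by linear_combination htr
  have h2 : X (X a) = (-1 - A) • a + (-C) • b := by
    rw [ha, map_add, map_smul, map_smul, ha, hb]
    linear_combination (norm := module) -(hdet • a)
  rw [h2, map_add, map_smul, map_smul, ha, hb]
  linear_combination (norm := module) hdet • a

/-- Both $S$ and $T$ have determinant $-1$ on the span of $a$ and $b$, and $ST$ and $TS$ have the
same trace $-1$. So $(ST)^3$ and $(TS)^3$ both fix $a$. -/
theorem altProd_six_apply_eq {S T : Module.End K M} {a b : M} {x x' g g' y y' : K}
    (hSa : S a = x • a + g • b) (hSb : S b = x' • b + g' • a) (hTa : T a = y • a)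
    (hTb : T b = y' • b) (hy : y * y' = -1) (hxy : y * x + y' * x' = -1)
    (hdet : x * x' - g * g' = -1) :
    altProd S T 6 a = altProd T S 6 a := by
  have h1 := iterate_three_apply_eq (X := S * T) (a := a) (b := b) (A := y * x) (A' := y' * x')
    (C := y * g) (C' := y' * g')
    (by rw [Module.End.mul_apply, hTa, map_smul, hSa]; module)
    (by rw [Module.End.mul_apply, hTb, map_smul, hSb]; module) hxy
    (by linear_combination (y * y') * hdet - hy)
  have h2 := iterate_three_apply_eq (X := T * S) (a := a) (b := b) (A := y * x) (A' := y' * x')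
    (C := y' * g) (C' := y * g')
    (by rw [Module.End.mul_apply, hSa, map_add, map_smul, map_smul, hTa, hTb]; module)
    (by rw [Module.End.mul_apply, hSb, map_add, map_smul, map_smul, hTa, hTb]; module) hxy
    (by linear_combination (y * y') * hdet - hy)
  exact h1.trans h2.symm

theorem altProd_apply_eq_of_eigenvector {S T : Module.End K M} {a : M} {x y : K}
    (hS : S a = x • a) (hT : T a = y • a) (m : ℕ) :
    altProd S T (2 * m) a = altProd T S (2 * m) a := by
  have key : ∀ {S T : Module.End K M} {x y : K}, S a = x • a → T a = y • a →
      altProd S T (2 * m) a = (x * y) ^ m • a := by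
    intro S T x y hS hT
    induction m with
    | zero => simp [altProd]
    | succ m ih =>
      change S (T (altProd S T (2 * m) a)) = _
      rw [ih, map_smul, hT, map_smul, map_smul, hS]
      module
  rw [key hS hT, key hT hS, mul_comm x]

end LinearAlgebra

theorem notMem_R2_of_mem_R1 {k : ι} (h : k ∈ R1 P) : k ∉ R2 P := fun ⟨m, hm⟩ => h.2 m hm

theorem simple_left_mem_subsystem (i j : Fin n) : B.simple i ∈ subsystem B i j :=
  ⟨1, 0, by simp⟩

theorem simple_right_mem_subsystem (i j : Fin n) : B.simple j ∈ subsystem B i j :=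
  ⟨0, 1, by simp⟩

theorem nn_eq_zero_of_notMem_R2 {i : Fin n} (hi : B.simple i ∉ R2 P) {χ : AddChar L.carrier ℂ}
    (h : χ (L.coroot (B.simple i)) = (q.q i : ℝ) ∨ χ (L.coroot (B.simple i)) = ((q.q i)⁻¹ : ℝ)) :
    nn q L (B.simple i) χ = 0 := by
  have h0 := pow_ne_zero 2 (sq_ne_zero q i)
  rw [Complex.ofReal_inv, ← sq_sq] at h
  rw [nn_of_notMem_R2 q L hi, inv_pow]
  rcases h with h | h
  · rw [h, inv_mul_cancel₀ h0, sub_self, mul_zero]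
  · rw [h, inv_inv, inv_mul_cancel₀ h0, sub_self, zero_mul]

theorem nn_eq_zero_of_mem_R2 [Finite ι] {i : Fin n} (hi : B.simple i ∈ R2 P)
    {χ : AddChar L.carrier ℂ}
    (h : χ (L.halfCoroot (B.simple i)) = sq0 q * sq q i ∨
      χ (L.halfCoroot (B.simple i)) = (sq0 q)⁻¹ * (sq q i)⁻¹ ∨
      χ (L.halfCoroot (B.simple i)) = -(sq0 q * (sq q i)⁻¹) ∨
      χ (L.halfCoroot (B.simple i)) = -((sq0 q)⁻¹ * sq q i)) :
    nn q L (B.simple i) χ = 0 := by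
  have h0 := sq0_ne_zero q
  have h1 := sq_ne_zero q i
  rw [nn_of_mem_R2 q L hi]
  rcases h with h | h | h | h <;> rw [h] <;> field_simp <;> ring

theorem sq_eq_cube {i j : Fin n} (h : q.q i = q.q j ^ 3) : sq q i = sq q j ^ 3 := by
  rw [sq, sq, ← Complex.ofReal_pow, h, pow_succ, pow_succ (√(q.q j)),
    Real.sqrt_mul (sq_nonneg _), Real.sqrt_sq (zero_lt_one.trans (q.one_lt_q j)).le,
    Real.sq_sqrt (zero_lt_one.trans (q.one_lt_q j)).le]

theorem sq_eq_of_eq {i j : Fin n} (h : q.q i = q.q j) : sq q i = sq q j := by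
  rw [sq, sq, h]

theorem sq_sq_ne_one (i : Fin n) : sq q i ^ 2 ≠ 1 := by
  rw [sq_sq]
  exact_mod_cast (q.one_lt_q i).ne'

theorem sq_sq_add_one_ne_zero (i : Fin n) : sq q i ^ 2 + 1 ≠ 0 := by
  have := q.one_lt_q i
  rw [sq_sq]
  exact_mod_cast (by linarith : q.q i + 1 ≠ 0)

theorem opT_e_of_nn_eq_zero [Finite ι] [P.IsRootSystem] [P.IsCrystallographic] {J : Set ι}
    {t : AddChar L.carrier ℂ} {w : P.weylGroup} (hw : w ∈ setF q L J t) {i : Fin n}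
    (h : nn q L (B.simple i) (L.tw w t) = 0) :
    opT q L J t i (e q L J t w) = diagCoeff q L i (L.tw w t) • e q L J t w := by
  rw [opT_e q hw, e_s_mul_eq_zero q hw h, smul_zero, add_zero]

/-- The braid relation of length six on a two-dimensional space spanned by `e_w` and `e_{s_i w}`. -/
theorem braid_six_apply_of_sq [Finite ι] [P.IsRootSystem] [P.IsCrystallographic] {J : Set ι}
    {t : AddChar L.carrier ℂ} {w : P.weylGroup} (hw : w ∈ setF q L J t) {i j : Fin n}
    (hi : B.simple i ∉ R2 P) (hj : B.simple j ∉ R2 P)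
    (hq : sq q j = sq q i ∨ sq q j = sq q i ^ 3)
    (hz : (L.tw w t (L.coroot (B.simple i)) = sq q i ^ 4 ∧
        L.tw w t (L.coroot (B.simple j)) = (sq q j ^ 2)⁻¹ ∧
        L.tw (B.s i) (L.tw w t) (L.coroot (B.simple j)) = sq q j ^ 2) ∨
      (L.tw w t (L.coroot (B.simple i)) = (sq q i ^ 4)⁻¹ ∧
        L.tw w t (L.coroot (B.simple j)) = sq q j ^ 2 ∧
        L.tw (B.s i) (L.tw w t) (L.coroot (B.simple j)) = (sq q j ^ 2)⁻¹)) :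
    altProd (opT q L J t i) (opT q L J t j) 6 (e q L J t w) =
      altProd (opT q L J t j) (opT q L J t i) 6 (e q L J t w) := by
  have hi0 := sq_ne_zero q i
  have hj0 := sq_ne_zero q j
  have hi1 := sub_ne_zero.2 (sq_sq_ne_one (q := q) i)
  have hj1 := sub_ne_zero.2 (sq_sq_ne_one (q := q) j)
  have hi2 := sq_sq_add_one_ne_zero (q := q) i
  have hi4 : sq q i ^ 4 - 1 ≠ 0 := by
    rw [show sq q i ^ 4 - 1 = (sq q i ^ 2 - 1) * (sq q i ^ 2 + 1) by ring]
    exact mul_ne_zero hi1 hi2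
  have hi6 : sq q i ^ 6 - 1 ≠ 0 := by
    have h1 : sq q i ^ 6 = ((q.q i ^ 3 : ℝ) : ℂ) := by
      rw [Complex.ofReal_pow, ← sq_sq]; ring
    rw [h1, sub_ne_zero]
    exact_mod_cast (one_lt_pow₀ (q.one_lt_q i) three_ne_zero).ne'
  have hdi : L.tw w t (L.coroot (B.simple i)) ≠ 1 := by
    intro h
    rcases hz with hz | hz
    · exact hi4 (sub_eq_zero.2 (hz.1.symm.trans h))
    · exact hi4 (sub_eq_zero.2 (inv_eq_one.1 (hz.1.symm.trans h)))
  -- The value $q_i^{\pm2}$ differs from $q_i^{\pm1}$, so the wall of $\alpha_i$ is free and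
  -- $e_{s_iw}$ is a genuine second basis vector, while $T_j$ is diagonal on both.
  have hni : nn q L (B.simple i) (L.tw w t) ≠ 0 := by
    rw [nn_of_notMem_R2 q L hi]
    have h1 : 1 - (sq q i)⁻¹ ^ 2 * (sq q i ^ 4)⁻¹ ≠ 0 := by
      rw [show 1 - (sq q i)⁻¹ ^ 2 * (sq q i ^ 4)⁻¹ = (sq q i ^ 6 - 1) / sq q i ^ 6 by field_simp]
      exact div_ne_zero hi6 (pow_ne_zero _ hi0)
    have h2 : 1 - (sq q i)⁻¹ ^ 2 * sq q i ^ 4 ≠ 0 := by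
      rw [show 1 - (sq q i)⁻¹ ^ 2 * sq q i ^ 4 = -(sq q i ^ 2 - 1) by field_simp; ring]
      exact neg_ne_zero.2 hi1
    rcases hz with hz | hz
    · rw [hz.1]; exact mul_ne_zero h1 h2
    · rw [hz.1, inv_inv]; exact mul_ne_zero h2 h1
  have hs : B.s i * w ∈ setF q L J t :=
    s_mul_mem_setF hw (mt (eval_dElt_eq_zero_iff L _ _).1 hdi) hni
  have hSb := opT_e q hs i
  rw [← mul_assoc, B.s_mul_self, one_mul, L.tw_mul] at hSb
  have hTa := opT_e_of_nn_eq_zero hw (nn_eq_zero_of_notMem_R2 hj (by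
    rw [Complex.ofReal_inv, ← sq_sq]
    rcases hz with hz | hz
    · exact Or.inr hz.2.1
    · exact Or.inl hz.2.1))
  have hTb := opT_e_of_nn_eq_zero hs (nn_eq_zero_of_notMem_R2 hj (by
    rw [Complex.ofReal_inv, ← sq_sq, L.tw_mul]
    rcases hz with hz | hz
    · exact Or.inl hz.2.2
    · exact Or.inr hz.2.2))
  rw [L.tw_mul] at hTb
  have e1 := diagCoeff_add q L hdi
  have e2 := diagCoeff_sq_add q L hdi
  refine altProd_six_apply_eq (opT_e q hw i) hSb hTa hTb ?_ ?_
    (by linear_combination diagCoeff q L i (L.tw w t) * e1 - e2)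
  -- The eigenvalues of $T_j$ on $e_w$ and $e_{s_iw}$ are $q_j^{1/2}$ and $-q_j^{-1/2}$ in some
  -- order, so their product is $-1$.
  · rw [diagCoeff_of_notMem_R2 q L hj, diagCoeff_of_notMem_R2 q L hj, sqDiff]
    have h1 : 1 - (sq q j ^ 2)⁻¹ = (sq q j ^ 2 - 1) / sq q j ^ 2 := by field_simp
    have h2 : 1 - sq q j ^ 2 = -(sq q j ^ 2 - 1) := by ring
    rcases hz with hz | hz <;> rw [hz.2.1, hz.2.2, inv_inv, h1, h2] <;> field_simp
  · rw [diagCoeff_of_notMem_R2 q L hj, diagCoeff_of_notMem_R2 q L hj,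
      diagCoeff_of_notMem_R2 q L hi, diagCoeff_of_notMem_R2 q L hi, coroot_simple_tw_s, sqDiff,
      sqDiff]
    have h1 : 1 - (sq q j ^ 2)⁻¹ = (sq q j ^ 2 - 1) / sq q j ^ 2 := by field_simp
    have h2 : 1 - sq q j ^ 2 = -(sq q j ^ 2 - 1) := by ring
    have h3 : 1 - (sq q i ^ 4)⁻¹ = (sq q i ^ 2 - 1) * (sq q i ^ 2 + 1) / sq q i ^ 4 := by
      field_simp; ring
    have h4 : 1 - sq q i ^ 4 = -((sq q i ^ 2 - 1) * (sq q i ^ 2 + 1)) := by ring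
    rcases hz with hz | hz <;> rw [hz.1, hz.2.1, hz.2.2, inv_inv, inv_inv, h1, h2, h3, h4] <;>
      rcases hq with hq | hq <;> rw [hq] at hj1 ⊢ <;> field_simp <;> ring

end CalibratedHecke

namespace CalibratedHecke
open RootPairing MulOpposite

variable {ι V V' : Type*} [AddCommGroup V] [Module ℝ V] [AddCommGroup V'] [Module ℝ V']
  {P : RootPairing ι ℝ V V'} {n : ℕ} {B : SimpleSystem P n} {q : ParameterSystem B}
  {L : TranslationLattice P}
  {J : Set ι} {t : AddChar L.carrier ℂ}

/-! ### Assembling the braid relations at all calibratable weights. -/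

theorem orderOf_s_mul_s_comm (i j : Fin n) :
    orderOf (B.s i * B.s j) = orderOf (B.s j * B.s i) := by
  rw [← orderOf_inv, mul_inv_rev, B.s_inv, B.s_inv]

theorem IsRegularAt.symm {i j : Fin n} {χ : AddChar L.carrier ℂ} (h : IsRegularAt B L i j χ) :
    IsRegularAt B L j i χ := fun w hw => (h w (by rwa [Set.pair_comm])).symm

/-- For $i=j$ the exceptional cases would make $\langle\alpha_i,\alpha_i^\vee\rangle=2$ negative, so
only regularity remains. -/
theorem coroot_ne_one_of_isCalibratable {i : Fin n} {χ : AddChar L.carrier ℂ}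
    (h : IsCalibratable q L i i χ) : χ (L.coroot (B.simple i)) ≠ 1 := by
  have hex : ¬IsExceptionalAt q L i i χ := by
    have h2 := P.pairing_same (B.simple i)
    rintro (⟨⟨-, h1, -⟩, -⟩ | ⟨⟨-, h1, -⟩, -⟩ | ⟨⟨-, h1, -⟩, -⟩) <;> rw [h2] at h1 <;> norm_num at h1
  rcases h with h | h | h
  · have := (h 1 (one_mem _)).1
    rwa [L.tw_one] at this
  · exact absurd h hex
  · exact absurd h hex

/-- The images of the generators of the Hecke algebra. -/
noncomputable def genOp (q : ParameterSystem B) (L : TranslationLattice P) (J : Set ι)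
    (t : AddChar L.carrier ℂ) : Fin n ⊕ L.carrier → Module.End ℂ (ModuleSpace q L J t) :=
  Sum.elim (opT q L J t) (opX q L J t)

theorem lift_freeT (i : Fin n) :
    FreeAlgebra.lift ℂ (genOp q L J t) (freeT L i) = opT q L J t i := by
  rw [freeT, FreeAlgebra.lift_ι_apply]; rfl

theorem lift_freeX (v : L.carrier) :
    FreeAlgebra.lift ℂ (genOp q L J t) (freeX L v) = opX q L J t v := by
  rw [freeX, FreeAlgebra.lift_ι_apply]; rfl

theorem map_altProd {A A' F : Type*} [Monoid A] [Monoid A'] [FunLike F A A'] [MonoidHomClass F A A']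
    (f : F) (a b : A) (m : ℕ) : f (altProd a b m) = altProd (f a) (f b) m := by
  induction m generalizing a b with
  | zero => exact map_one f
  | succ m ih => rw [altProd, altProd, map_mul, ih]

variable [Finite ι] [P.IsRootSystem] [P.IsCrystallographic]

theorem altProd_apply_of_nn_eq_zero {w : P.weylGroup} (hw : w ∈ setF q L J t) {i j : Fin n}
    (hi : nn q L (B.simple i) (L.tw w t) = 0) (hj : nn q L (B.simple j) (L.tw w t) = 0) (m : ℕ) :
    altProd (opT q L J t i) (opT q L J t j) (2 * m) (e q L J t w) =
      altProd (opT q L J t j) (opT q L J t i) (2 * m) (e q L J t w) :=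
  altProd_apply_eq_of_eigenvector (opT_e_of_nn_eq_zero hw hi) (opT_e_of_nn_eq_zero hw hj) m

/-- In types $C_2$ and $BC_2$, and for half of the $G_2$ weights, both simple roots are blocked and
$e_w$ is a common eigenvector. The other $G_2$ weights reduce to `braid_six_apply_of_sq`. When
$q_i=q_j^3$, the indices change roles there, because it is $\alpha_j$ whose wall is free. -/
theorem braid_apply_of_isExceptionalAt {w : P.weylGroup} (hw : w ∈ setF q L J t) {i j : Fin n}
    (hij : i ≠ j) (h : IsExceptionalAt q L i j (L.tw w t)) :
    altProd (opT q L J t i) (opT q L J t j) (orderOf (B.s i * B.s j)) (e q L J t w) =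
      altProd (opT q L J t j) (opT q L J t i) (orderOf (B.s i * B.s j)) (e q L J t w) := by
  have hi0 := sq_ne_zero q i
  have hj0 := sq_ne_zero q j
  rcases h with ⟨⟨hR, h1, h2⟩, h⟩ | ⟨⟨hR, h1, h2⟩, h⟩ | ⟨⟨hj, h1, h2⟩, h⟩
  · have hi := notMem_R2_of_mem_R1 (hR (simple_left_mem_subsystem i j))
    have hj := notMem_R2_of_mem_R1 (hR (simple_right_mem_subsystem i j))
    rw [orderOf_s_mul_s_comm, B.orderOf_s_mul_s_four hij.symm h1 h2]
    refine altProd_apply_of_nn_eq_zero hw (nn_eq_zero_of_notMem_R2 hi ?_)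
      (nn_eq_zero_of_notMem_R2 hj ?_) 2 <;>
    · rcases h with ⟨hq, h⟩ | ⟨hq, h⟩
      · rw [hq] at h
        try rw [hq]
        tauto
      · try rw [hq]
        tauto
  · have hi := notMem_R2_of_mem_R1 (hR (simple_left_mem_subsystem i j))
    have hj := notMem_R2_of_mem_R1 (hR (simple_right_mem_subsystem i j))
    rw [B.orderOf_s_mul_s_six hij h2 h1]
    have hti : L.tw (B.s i) (L.tw w t) (L.coroot (B.simple j)) =
        L.tw w t (L.coroot (B.simple j)) * L.tw w t (L.coroot (B.simple i)) := by
      rw [L.tw_apply, B.s_inv, L.act_s_coroot (m := -1) (by simpa using h2), neg_smul, one_smul,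
        sub_neg_eq_add, AddChar.map_add_eq_mul]
    have htj : L.tw (B.s j) (L.tw w t) (L.coroot (B.simple i)) =
        L.tw w t (L.coroot (B.simple i)) * L.tw w t (L.coroot (B.simple j)) ^ 3 := by
      rw [L.tw_apply, B.s_inv, L.act_s_coroot (m := -3) (by simpa using h1),
        show ∀ a b : L.carrier, a - (-3 : ℤ) • b = a + (3 : ℕ) • b by intro a b; module,
        AddChar.map_add_eq_mul, AddChar.map_nsmul_eq_pow]
    rcases h with ⟨hq, h⟩ | ⟨hq, h⟩
    · have hs := sq_eq_of_eq hq
      have hsq := sq_sq q i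
      rcases h with h | h | h | h
      · exact altProd_apply_of_nn_eq_zero hw (nn_eq_zero_of_notMem_R2 hi (Or.inr h.1))
          (nn_eq_zero_of_notMem_R2 hj (by rw [← hq]; exact Or.inl h.2)) 3
      · exact altProd_apply_of_nn_eq_zero hw (nn_eq_zero_of_notMem_R2 hi (Or.inl h.1))
          (nn_eq_zero_of_notMem_R2 hj (by rw [← hq]; exact Or.inr h.2)) 3
      · obtain ⟨h3, h4⟩ := h
        push_cast at h3 h4
        rw [← hsq] at h3 h4
        refine braid_six_apply_of_sq hw hi hj (Or.inl hs.symm) (Or.inl ⟨?_, ?_, ?_⟩)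
        · rw [h3]; ring
        · rw [h4, hs]
        · rw [hti, h3, h4, hs]; field_simp
      · obtain ⟨h3, h4⟩ := h
        push_cast at h3 h4
        rw [← hsq] at h3 h4
        refine braid_six_apply_of_sq hw hi hj (Or.inl hs.symm) (Or.inr ⟨?_, ?_, ?_⟩)
        · rw [h3]; ring
        · rw [h4, hs]
        · rw [hti, h3, h4, hs]; field_simp
    · have hs := sq_eq_cube hq
      have hsq := sq_sq q j
      rcases h with h | h | h | h
      · exact altProd_apply_of_nn_eq_zero hw
          (nn_eq_zero_of_notMem_R2 hi (by rw [hq]; exact Or.inl h.1))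
          (nn_eq_zero_of_notMem_R2 hj (Or.inr h.2)) 3
      · exact altProd_apply_of_nn_eq_zero hw
          (nn_eq_zero_of_notMem_R2 hi (by rw [hq]; exact Or.inr h.1))
          (nn_eq_zero_of_notMem_R2 hj (Or.inl h.2)) 3
      · obtain ⟨h3, h4⟩ := h
        push_cast at h3 h4
        rw [← hsq] at h3 h4
        refine (braid_six_apply_of_sq hw hj hi (Or.inr hs) (Or.inl ⟨?_, ?_, ?_⟩)).symm
        · rw [h4]; ring
        · rw [h3, hs]; ring
        · rw [htj, h3, h4, hs]; field_simp
      · obtain ⟨h3, h4⟩ := h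
        push_cast at h3 h4
        rw [← hsq] at h3 h4
        refine (braid_six_apply_of_sq hw hj hi (Or.inr hs) (Or.inr ⟨?_, ?_, ?_⟩)).symm
        · rw [h4]; ring
        · rw [h3, hs]; ring
        · rw [htj, h3, h4, hs]; field_simp
  · have hi : B.simple i ∉ R2 P :=
      notMem_R2_of_pairing_eq (a := -1) (by decide) (by simpa using h2)
    rw [B.orderOf_s_mul_s_four hij h1 h2]
    have key : (L.tw w t (L.coroot (B.simple i)) = (q.q i : ℝ) ∨
        L.tw w t (L.coroot (B.simple i)) = ((q.q i)⁻¹ : ℝ)) ∧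
      (L.tw w t (L.halfCoroot (B.simple j)) = sq0 q * sq q j ∨
      L.tw w t (L.halfCoroot (B.simple j)) = (sq0 q)⁻¹ * (sq q j)⁻¹ ∨
      L.tw w t (L.halfCoroot (B.simple j)) = -(sq0 q * (sq q j)⁻¹) ∨
      L.tw w t (L.halfCoroot (B.simple j)) = -((sq0 q)⁻¹ * sq q j)) := by
      rcases h with ⟨hq, h⟩ | ⟨hq, h⟩ | ⟨hq, h⟩ | ⟨hq, h⟩
      · rw [hq]
        push_cast at h ⊢
        rw [mul_inv]
        change (_ ∧ _ = (sq0 q)⁻¹ * (sq q j)⁻¹) ∨ (_ ∧ _ = sq0 q * sq q j) at h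
        tauto
      · rcases hq with hq | hq <;> rw [hq] <;> push_cast at h ⊢ <;> rw [mul_inv, inv_inv] <;>
        · change (_ ∧ _ = -(sq0 q * (sq q j)⁻¹)) ∨ (_ ∧ _ = -((sq0 q)⁻¹ * sq q j)) at h
          tauto
      · have hq' : (q.q i : ℂ) = sq0 q * sq q j := by rw [hq]; push_cast; rfl
        push_cast at h ⊢
        rw [hq', mul_inv] at h ⊢
        tauto
      · rcases hq with hq | hq
        · have hq' : (q.q i : ℂ) = (sq0 q)⁻¹ * sq q j := by rw [hq]; push_cast; rfl
          push_cast at h ⊢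
          rw [hq', mul_inv, inv_inv] at h ⊢
          tauto
        · have hq' : (q.q i : ℂ) = sq0 q * (sq q j)⁻¹ := by rw [hq]; push_cast; rfl
          push_cast at h ⊢
          rw [hq', mul_inv, inv_inv] at h ⊢
          tauto
    exact altProd_apply_of_nn_eq_zero hw (nn_eq_zero_of_notMem_R2 hi key.1)
      (nn_eq_zero_of_mem_R2 hj key.2) 2

theorem altProd_opT_apply (hd : ∀ w ∈ setF q L J t, ∀ i, L.tw w t (L.coroot (B.simple i)) ≠ 1)
    (hcal : ∀ w ∈ setF q L J t, ∀ i j : Fin n, IsCalibratable q L i j (L.tw w t))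
    {i j : Fin n} (hij : i ≠ j) {w : P.weylGroup} (hw : w ∈ setF q L J t) :
    altProd (opT q L J t i) (opT q L J t j) (orderOf (B.s i * B.s j)) (e q L J t w) =
      altProd (opT q L J t j) (opT q L J t i) (orderOf (B.s i * B.s j)) (e q L J t w) := by
  rcases hcal w hw i j with hreg | hex | hex
  · rcases B.pairing_cases hij with ⟨h1, h2⟩ | ⟨h1, h2⟩ | ⟨h1, h2⟩ | ⟨h1, h2⟩ | ⟨h1, h2⟩ | ⟨h1, h2⟩
    · have h := braid_two_apply hd hij h1 h2 hw
      rw [B.orderOf_s_mul_s_two hij h1 h2]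
      simp only [altProd, mul_one] at h ⊢
      exact h.symm
    · have h := braid_three_apply hd hij h1 h2 hw hreg
      rw [B.orderOf_s_mul_s_three hij h1 h2]
      simp only [altProd, mul_one, mul_assoc] at h ⊢
      exact h
    · have h := braid_four_apply hd hij h1 h2 hw hreg
      rw [B.orderOf_s_mul_s_four hij h1 h2]
      simp only [altProd, mul_one, mul_assoc] at h ⊢
      exact h.symm
    · have h := braid_four_apply hd hij.symm h2 h1 hw hreg.symm
      rw [orderOf_s_mul_s_comm, B.orderOf_s_mul_s_four hij.symm h2 h1]
      simp only [altProd, mul_one, mul_assoc] at h ⊢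
      exact h
    · have h := braid_six_apply hd hij.symm h2 h1 hw hreg.symm
      rw [orderOf_s_mul_s_comm, B.orderOf_s_mul_s_six hij.symm h2 h1]
      simp only [altProd, mul_one, mul_assoc] at h ⊢
      exact h
    · have h := braid_six_apply hd hij h1 h2 hw hreg
      rw [B.orderOf_s_mul_s_six hij h1 h2]
      simp only [altProd, mul_one, mul_assoc] at h ⊢
      exact h.symm
  · exact braid_apply_of_isExceptionalAt hw hij hex
  · have h := braid_apply_of_isExceptionalAt hw hij.symm hex
    rw [orderOf_s_mul_s_comm] at h
    exact h.symm

/-! ### The representation -/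

theorem lift_eq_of_heckeRel
    (hcal : ∀ w ∈ setF q L J t, ∀ i j : Fin n, IsCalibratable q L i j (L.tw w t))
    {x y : FreeAlg n L} (h : HeckeRel q L x y) :
    FreeAlgebra.lift ℂ (genOp q L J t) x = FreeAlgebra.lift ℂ (genOp q L J t) y := by
  have hd : ∀ w ∈ setF q L J t, ∀ i, L.tw w t (L.coroot (B.simple i)) ≠ 1 :=
    fun w hw i => coroot_ne_one_of_isCalibratable (hcal w hw i i)
  cases h with
  | quadratic i =>
    rw [map_mul, map_add, map_one, map_smul, lift_freeT, opT_mul_self q hd i, sqDiff, sq]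
    push_cast
    rfl
  | braid i j hij =>
    rw [map_altProd, map_altProd, lift_freeT, lift_freeT]
    exact end_ext q fun w hw => altProd_opT_apply hd hcal hij hw
  | x_zero =>
    rw [lift_freeX, map_one]
    refine end_ext q fun w hw => ?_
    rw [opX_e, AddChar.map_zero_eq_one, one_smul, Module.End.one_apply]
  | x_add u v =>
    rw [map_mul, lift_freeX, lift_freeX, lift_freeX]
    refine end_ext q fun w hw => ?_
    rw [Module.End.mul_apply, opX_e, opX_e, map_smul, opX_e, smul_smul, AddChar.map_add_eq_mul,
      mul_comm]
  | bernstein i v =>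
    rw [map_sub, map_mul, map_mul, map_smul, lift_freeT, lift_freeX, lift_freeX,
      opT_mul_opX q hd i v, freeOfGroupAlg, Finsupp.linearCombination_apply,
      Finsupp.linearCombination_apply, Finsupp.sum, Finsupp.sum, map_sum]
    simp only [map_smul, lift_freeX]
    rfl

variable (q L J t) in
/-- The representation of the affine Hecke algebra on `M_J(t)`. -/
noncomputable def heckeRep
    (hcal : ∀ w ∈ setF q L J t, ∀ i j : Fin n, IsCalibratable q L i j (L.tw w t)) :
    Hecke q L →ₐ[ℂ] Module.End ℂ (ModuleSpace q L J t) :=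
  RingQuot.liftAlgHom ℂ ⟨FreeAlgebra.lift ℂ (genOp q L J t), fun _ _ h => lift_eq_of_heckeRel hcal h⟩

theorem heckeRep_T
    (hcal : ∀ w ∈ setF q L J t, ∀ i j : Fin n, IsCalibratable q L i j (L.tw w t)) (i : Fin n) :
    heckeRep q L J t hcal (Hecke.T q L i) = opT q L J t i := by
  rw [heckeRep, Hecke.T, RingQuot.liftAlgHom_mkAlgHom_apply, lift_freeT]

theorem heckeRep_X
    (hcal : ∀ w ∈ setF q L J t, ∀ i j : Fin n, IsCalibratable q L i j (L.tw w t)) (v : L.carrier) :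
    heckeRep q L J t hcal (Hecke.X q L v) = opX q L J t v := by
  rw [heckeRep, Hecke.X, RingQuot.liftAlgHom_mkAlgHom_apply, lift_freeX]

end CalibratedHecke

namespace CalibratedHecke
open RootPairing MulOpposite

/-! ### Irreducibility for distinct weights -/

/-- The orbit $\rho(A)x$ of a nonzero vector is a stable complex subspace containing $x$, so testing
complex subspaces is enough. -/
theorem isIrreducibleRep_of_forall {A M : Type*} [Ring A] [Algebra ℂ A] [AddCommGroup M]
    [Module ℂ M] [Nontrivial M] {ρ : A →ₐ[ℂ] Module.End ℂ M}
    (h : ∀ N : Submodule ℂ M, (∀ a, ∀ x ∈ N, ρ a x ∈ N) → N ≠ ⊥ → N = ⊤) :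
    IsIrreducibleRep ρ := by
  let _ : Module A M := Module.compHom M ρ.toRingHom
  change IsSimpleModule A M
  rw [isSimpleModule_iff_toSpanSingleton_surjective]
  refine ⟨inferInstance, fun x hx y => ?_⟩
  have hN := h (LinearMap.range (ρ.toLinearMap.flip x)) ?_ ?_
  · have hy : y ∈ LinearMap.range (ρ.toLinearMap.flip x) := hN ▸ Submodule.mem_top
    obtain ⟨a, ha⟩ := hy
    exact ⟨a, ha⟩
  · rintro a _ ⟨b, rfl⟩
    refine ⟨a * b, ?_⟩
    change ρ (a * b) x = ρ a (ρ b x)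
    rw [map_mul, Module.End.mul_apply]
  · intro h0
    have hx' : x ∈ LinearMap.range (ρ.toLinearMap.flip x) := by
      refine ⟨1, ?_⟩
      change ρ 1 x = x
      rw [map_one, Module.End.one_apply]
    rw [h0] at hx'
    exact hx hx'

variable {ι V V' : Type*} [AddCommGroup V] [Module ℝ V] [AddCommGroup V'] [Module ℝ V']
  {P : RootPairing ι ℝ V V'} {n : ℕ} {B : SimpleSystem P n} {q : ParameterSystem B}
  {L : TranslationLattice P} {J : Set ι} {t : AddChar L.carrier ℂ}

theorem opX_apply (v : L.carrier) (x : ModuleSpace q L J t) (w : setF q L J t) :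
    opX q L J t v x w = L.tw w t v * x w := by
  induction x using Finsupp.induction_linear with
  | zero => simp
  | add x y hx hy => rw [map_add, Finsupp.add_apply, hx, hy, Finsupp.add_apply, mul_add]
  | single u c =>
    have h := opX_e q (J := J) (t := t) u.1 v
    rw [e_of_mem q u.2] at h
    rw [← mul_one c, ← smul_eq_mul, ← Finsupp.smul_single, map_smul, h]
    by_cases huw : u = w
    · subst huw
      simp
      ring
    · simp [huw]

/-- The usual separation of eigenvectors: if the support contains two elements, subtracting a
suitable eigenvalue of some $x^\lambda$ removes one of them and keeps the other. -/
theorem exists_e_mem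
    (hdist : ∀ w ∈ setF q L J t, ∀ w' ∈ setF q L J t, w ≠ w' → L.tw w t ≠ L.tw w' t)
    {N : Submodule ℂ (ModuleSpace q L J t)} (hN : ∀ v, ∀ x ∈ N, opX q L J t v x ∈ N)
    {x : ModuleSpace q L J t} (hx : x ∈ N) (hx0 : x ≠ 0) :
    ∃ w ∈ setF q L J t, e q L J t w ∈ N := by
  induction hk : x.support.card using Nat.strong_induction_on generalizing x with
  | _ k ih =>
    subst hk
    obtain ⟨w, hw⟩ := Finsupp.support_nonempty_iff.2 hx0
    by_cases hw' : ∃ w' ∈ x.support, w' ≠ w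
    · obtain ⟨w', hw', hne⟩ := hw'
      have h1 := hdist w' w'.2 w w.2 (fun h => hne (Subtype.ext h))
      obtain ⟨v, hv⟩ : ∃ v, L.tw w' t v ≠ L.tw w t v := by
        by_contra! h
        exact h1 (DFunLike.ext _ _ h)
      have happ : ∀ u, (opX q L J t v x - L.tw w t v • x) u =
          (L.tw u t v - L.tw w t v) * x u := by
        intro u
        rw [Finsupp.sub_apply, opX_apply, Finsupp.smul_apply, smul_eq_mul, sub_mul]
      refine ih _ (Finset.card_lt_card ?_)
        (N.sub_mem (hN v x hx) (N.smul_mem (L.tw w t v) hx)) ?_ rfl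
      · refine Finset.ssubset_iff_subset_ne.2 ⟨fun u hu => ?_, fun h => ?_⟩
        · rw [Finsupp.mem_support_iff, happ] at hu
          exact Finsupp.mem_support_iff.2 (right_ne_zero_of_mul hu)
        · rw [← h, Finsupp.mem_support_iff, happ, sub_self, zero_mul] at hw
          exact hw rfl
      · intro h
        have h2 := happ w'
        rw [h, Finsupp.zero_apply] at h2
        exact mul_ne_zero (sub_ne_zero.2 hv) (Finsupp.mem_support_iff.1 hw') h2.symm
    · push Not at hw'
      refine ⟨w, w.2, ?_⟩
      have h1 : x = Finsupp.single w (x w) := by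
        ext u
        by_cases hu : u = w
        · rw [hu, Finsupp.single_eq_same]
        · rw [Finsupp.single_eq_of_ne hu]
          by_contra h
          exact hu (hw' u (Finsupp.mem_support_iff.2 h))
      have h2 : e q L J t w = (x w)⁻¹ • x := by
        rw [e_of_mem q w.2]
        conv_rhs => rw [h1]
        rw [Finsupp.single_eq_same, Finsupp.smul_single, smul_eq_mul,
          inv_mul_cancel₀ (Finsupp.mem_support_iff.1 hw)]
      rw [h2]
      exact N.smul_mem _ hx

variable [Finite ι] [P.IsRootSystem] [P.IsCrystallographic]

theorem isIrreducibleRep_of_injective_weights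
    (hd : ∀ w ∈ setF q L J t, ∀ i, L.tw w t (L.coroot (B.simple i)) ≠ 1)
    (hF : (setF q L J t).Nonempty)
    (hdist : ∀ w ∈ setF q L J t, ∀ w' ∈ setF q L J t, w ≠ w' → L.tw w t ≠ L.tw w' t)
    {ρ : Hecke q L →ₐ[ℂ] Module.End ℂ (ModuleSpace q L J t)}
    (hT : ∀ i, ρ (Hecke.T q L i) = opT q L J t i) (hX : ∀ v, ρ (Hecke.X q L v) = opX q L J t v) :
    IsIrreducibleRep ρ := by
  obtain ⟨w₀, hw₀⟩ := hF
  have : Nonempty (setF q L J t) := ⟨⟨w₀, hw₀⟩⟩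
  refine isIrreducibleRep_of_forall fun N hN hN0 => ?_
  obtain ⟨x, hx, hx0⟩ := (Submodule.ne_bot_iff N).1 hN0
  obtain ⟨w, hw, hwN⟩ := exists_e_mem hdist (fun v x hx => hX v ▸ hN _ x hx) hx hx0
  have key : ∀ w' ∈ setF q L J t, e q L J t w' ∈ N := by
    intro w' hw'
    refine setF_induction (p := fun w => e q L J t w ∈ N) (fun v hv i hs h => ?_) hw hw' hwN
    have h1 : opT q L J t i (e q L J t v) ∈ N := hT i ▸ hN _ _ h
    have h2 := opT_e q hv i
    -- A step that stays inside $F_J(t)$ crosses no wall of $N(t)$, so $n_{\alpha_i}n_{-\alpha_i}$,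
    -- and in particular $c_i$, is nonzero at $vt$.
    have h3 : offCoeff q L i (L.tw v t) ≠ 0 :=
      offCoeff_ne_zero q L (hd v hv i) fun h0 => s_mul_notMem_setF hv h0 hs
    have h4 : e q L J t (B.s i * v) = (offCoeff q L i (L.tw v t))⁻¹ •
        (opT q L J t i (e q L J t v) - diagCoeff q L i (L.tw v t) • e q L J t v) := by
      rw [h2, add_sub_cancel_left, smul_smul, inv_mul_cancel₀ h3, one_smul]
    change e q L J t (B.s i * v) ∈ N
    rw [h4]
    exact N.smul_mem _ (N.sub_mem h1 (N.smul_mem _ h))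
  rw [eq_top_iff]
  rintro y -
  induction y using Finsupp.induction_linear with
  | zero => exact N.zero_mem
  | add y z hy hz => exact N.add_mem hy hz
  | single u c =>
    have h := key u u.2
    rw [e_of_mem q u.2] at h
    rw [← mul_one c, ← smul_eq_mul, ← Finsupp.smul_single]
    exact N.smul_mem c h

end CalibratedHecke

namespace CalibratedHecke
open RootPairing MulOpposite

variable {ι V V' : Type*} [AddCommGroup V] [Module ℝ V] [AddCommGroup V'] [Module ℝ V']
  {P : RootPairing ι ℝ V V'} {n : ℕ}

/-! ### The affine Weyl group -/

theorem rootForm_root_pos [Fintype ι] (k : ι) : 0 < P.RootForm (P.root k) (P.root k) := by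
  rw [P.rootForm_root_self]
  refine Finset.sum_pos' (fun i _ => mul_self_nonneg _) ⟨k, Finset.mem_univ k, ?_⟩
  rw [P.pairing_same]
  norm_num

theorem two_mul_rootForm [Fintype ι] (v : V) (k : ι) :
    2 * P.RootForm (P.root k) v =
      P.RootForm (P.root k) (P.root k) * P.toLinearMap v (P.coroot k) := by
  have h := congrArg (P.toLinearMap v) (P.rootForm_self_smul_coroot k)
  rw [map_smul, map_nsmul, P.toLinearMap_apply_apply_Polarization] at h
  simpa [mul_comm] using h.symm

theorem rootForm_pos_iff [Fintype ι] (v : V) (k : ι) :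
    0 < P.RootForm (P.root k) v ↔ 0 < P.toLinearMap v (P.coroot k) := by
  have h := two_mul_rootForm (P := P) v k
  have hp := rootForm_root_pos (P := P) k
  rw [← mul_pos_iff_of_pos_left (two_pos : (0 : ℝ) < 2), h, mul_pos_iff_of_pos_left hp]

/-- The roots span $V$, so an element is determined by its permutation of the finitely many roots.
-/
instance finite_weylGroup [Finite ι] [P.IsRootSystem] : Finite P.weylGroup := by
  refine Finite.of_injective (fun w : P.weylGroup => fun k : ι => w • k) fun w w' h => ?_
  have h1 : ∀ v : V, (w⁻¹ * w') • v = v := by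
    intro v
    have hv : v ∈ Submodule.span ℝ (Set.range P.root) := by
      rw [IsRootSystem.span_root_eq_top]; trivial
    induction hv using Submodule.span_induction with
    | mem x hx =>
      obtain ⟨k, rfl⟩ := hx
      have hk : w • k = w' • k := congrFun h k
      rw [mul_smul, ← root_smul, ← hk, ← root_smul, inv_smul_smul]
    | zero => simp
    | add x y _ _ hx hy => rw [smul_add, hx, hy]
    | smul a x _ hx => rw [smul_comm, hx]
  exact inv_mul_eq_one.1 (weylGroup_smul_eq_self_of_forall h1)

/-- A vector on which no coroot vanishes has a trivial stabilizer. -/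
theorem eq_one_of_smul_eq_self [Finite ι] [P.IsRootSystem] [P.IsCrystallographic]
    (B : SimpleSystem P n) {p : V} (hp : ∀ k, P.toLinearMap p (P.coroot k) ≠ 0) {g : P.weylGroup}
    (hg : g • p = p) : g = 1 := by
  have := Fintype.ofFinite ι
  -- A simple reflection $s_i$ changes the height of $hp$ by $-\langle hp,\alpha_i^\vee\rangle$, so
  -- maximal height in the orbit makes $hp$ strictly dominant.
  obtain ⟨h, hh⟩ := Finite.exists_max fun w : P.weylGroup => B.ht (w • p)
  have hdom : ∀ i, 0 < P.toLinearMap (h • p) (P.coroot (B.simple i)) := by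
    intro i
    have h1 := hh (B.s i * h)
    rw [mul_smul, SimpleSystem.s, ofIdx_smul_vec, map_sub, B.ht.map_smul, B.ht_simple, smul_eq_mul,
      mul_one] at h1
    refine lt_of_le_of_ne (by linarith) (Ne.symm ?_)
    rw [toLinearMap_smul_coroot]
    exact hp _
  have hpos : ∀ k, 0 < P.toLinearMap (h • p) (P.coroot k) → 0 < B.ht (P.root k) := by
    intro k hk
    by_contra hneg
    have h1 : 0 < B.ht (P.root (negIdx P k)) := by
      rw [root_negIdx, map_neg]
      exact neg_pos.2 (lt_of_le_of_ne (not_lt.1 hneg) (B.ht_root_ne_zero k))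
    have h2 : 0 ≤ P.RootForm (P.root (negIdx P k)) (h • p) := by
      rw [B.root_eq_sum_coord (P.root (negIdx P k)), map_sum, LinearMap.sum_apply]
      refine Finset.sum_nonneg fun i _ => ?_
      rw [LinearMap.map_smul, LinearMap.smul_apply, smul_eq_mul]
      exact mul_nonneg (B.coord_nonneg h1 i) ((rootForm_pos_iff _ _).2 (hdom i)).le
    have h3 := (rootForm_pos_iff _ _).2 hk
    rw [root_negIdx, map_neg, LinearMap.neg_apply] at h2
    linarith
  have hfix : (h * g * h⁻¹) • h • p = h • p := by
    rw [smul_smul, mul_assoc, inv_mul_cancel, mul_one, mul_smul, hg]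
  -- The conjugate of $g$ fixes the strictly dominant vector $hp$, so it sends simple roots to roots
  -- whose coroots are positive on $hp$, that is, to positive roots.
  have h1 : h * g * h⁻¹ = 1 := by
    refine B.eq_one_of_forall_ht_pos fun i => hpos _ ?_
    have h2 := toLinearMap_smul_coroot_smul (P := P) (h * g * h⁻¹) (h • p) (B.simple i)
    rw [hfix] at h2
    rw [h2]
    exact hdom i
  rwa [mul_inv_eq_one, mul_eq_left] at h1

/-- The root lattice. -/
def rootLattice (P : RootPairing ι ℝ V V') : AddSubgroup V :=
  AddSubgroup.closure (Set.range P.root)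

theorem root_mem_rootLattice (k : ι) : P.root k ∈ rootLattice P :=
  AddSubgroup.subset_closure (Set.mem_range_self k)

theorem smul_mem_rootLattice (w : P.weylGroup) {v : V} (hv : v ∈ rootLattice P) :
    w • v ∈ rootLattice P := by
  induction hv using AddSubgroup.closure_induction with
  | mem x hx =>
    obtain ⟨k, rfl⟩ := hx
    rw [← root_smul]
    exact root_mem_rootLattice _
  | zero => rw [smul_zero]; exact zero_mem _
  | add x y _ _ hx hy => rw [smul_add]; exact add_mem hx hy
  | neg x _ hx => rw [smul_neg]; exact neg_mem hx

theorem exists_int_of_mem_rootLattice [P.IsCrystallographic] {v : V} (hv : v ∈ rootLattice P)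
    (k : ι) : ∃ m : ℤ, P.toLinearMap v (P.coroot k) = m := by
  induction hv using AddSubgroup.closure_induction with
  | mem x hx =>
    obtain ⟨m, rfl⟩ := hx
    rw [P.root_coroot_eq_pairing]
    exact exists_int_pairing m k
  | zero => exact ⟨0, by simp⟩
  | add x y _ _ hx hy =>
    obtain ⟨a, ha⟩ := hx
    obtain ⟨b, hb⟩ := hy
    exact ⟨a + b, by rw [map_add, LinearMap.add_apply, ha, hb]; push_cast; rfl⟩
  | neg x _ hx =>
    obtain ⟨a, ha⟩ := hx
    exact ⟨-a, by rw [map_neg, LinearMap.neg_apply, ha]; push_cast; rfl⟩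

theorem exists_list_of_mem_rootLattice {v : V} (hv : v ∈ rootLattice P) :
    ∃ l : List ι, (l.map P.root).sum = v := by
  induction hv using AddSubgroup.closure_induction with
  | mem x hx =>
    obtain ⟨k, rfl⟩ := hx
    exact ⟨[k], by simp⟩
  | zero => exact ⟨[], rfl⟩
  | add x y _ _ hx hy =>
    obtain ⟨a, ha⟩ := hx
    obtain ⟨b, hb⟩ := hy
    exact ⟨a ++ b, by simp [ha, hb]⟩
  | neg x _ hx =>
    obtain ⟨a, ha⟩ := hx
    refine ⟨a.map (negIdx P), ?_⟩
    rw [← ha, List.map_map, List.sum_neg, List.map_map]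
    congr 2
    ext k
    exact root_negIdx P k

/-- There are no minuscule vectors in the root lattice. -/
theorem eq_zero_of_mem_rootLattice [Finite ι] [P.IsCrystallographic] {v : V}
    (hv : v ∈ rootLattice P) (h : ∀ k, P.toLinearMap v (P.coroot k) < 2) : v = 0 := by
  obtain ⟨l₀, hl₀⟩ := exists_list_of_mem_rootLattice hv
  have key : ∀ N : ℕ, ∀ l : List ι, l.length = N → (l.map P.root).sum = v → v = 0 := by
    intro N
    induction N using Nat.strong_induction_on with
    | _ N ih =>
      rintro l rfl hlv
      cases l with
      | nil => exact hlv.symm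
      | cons a l =>
        -- In a sum of roots, two roots with negative pairing can be cancelled or replaced by their
        -- sum, which shortens the list. If nothing pairs negatively with the first root $a$, then
        -- $\langle v,a^\vee\rangle\ge2$.
        by_cases hneg : ∃ b ∈ l, P.pairing b a < 0
        · obtain ⟨b, hb, hab⟩ := hneg
          obtain ⟨l₁, l₂, rfl⟩ := List.append_of_mem hb
          by_cases h0 : P.root b = -P.root a
          · refine ih (l₁ ++ l₂).length (by simp) _ rfl ?_
            rw [← hlv]
            simp [h0]
            abel
          · have hab' : P.pairingIn ℤ b a < 0 := by
              rw [← P.algebraMap_pairingIn ℤ, eq_intCast] at hab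
              exact_mod_cast hab
            obtain ⟨c, hc⟩ := P.root_add_root_mem_of_pairingIn_neg hab' h0
            refine ih (c :: (l₁ ++ l₂)).length (by simp) _ rfl ?_
            rw [← hlv]
            simp [hc]
            abel
        · push Not at hneg
          exfalso
          have h1 := h a
          rw [← hlv, List.map_cons, List.sum_cons, map_add, LinearMap.add_apply,
            P.root_coroot_eq_pairing, P.pairing_same] at h1
          have h2 : ∀ l : List ι, (∀ b ∈ l, 0 ≤ P.pairing b a) →
              0 ≤ P.toLinearMap (l.map P.root).sum (P.coroot a) := by
            intro l hl
            induction l with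
            | nil => simp
            | cons b l ihl =>
              rw [List.map_cons, List.sum_cons, map_add, LinearMap.add_apply,
                P.root_coroot_eq_pairing]
              exact add_nonneg (hl b List.mem_cons_self)
                (ihl fun c hc => hl c (List.mem_cons_of_mem _ hc))
          linarith [h2 l hneg]
  exact key _ l₀ rfl hl₀

/-- A vector with non-integral values on all coroots can be moved by the root lattice into the
region where these values are less than `1`. -/
theorem exists_sub_mem_rootLattice [Finite ι] [P.IsCrystallographic] {p : V}
    (hp : ∀ k, ∀ m : ℤ, P.toLinearMap p (P.coroot k) ≠ m) :
    ∃ ν ∈ rootLattice P, ∀ k, P.toLinearMap (p - ν) (P.coroot k) < 1 := by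
  have := Fintype.ofFinite ι
  rcases isEmpty_or_nonempty ι with hι | hι
  · exact ⟨0, zero_mem _, fun k => hι.elim k⟩
  -- The least value $\delta$ bounds from below the loss of squared length in each translation. It
  -- is positive because no value on a coroot is integral.
  obtain ⟨k₀, hk₀⟩ := Finite.exists_min fun k =>
    P.RootForm (P.root k) (P.root k) * Int.fract (P.toLinearMap p (P.coroot k))
  set δ := P.RootForm (P.root k₀) (P.root k₀) * Int.fract (P.toLinearMap p (P.coroot k₀))
  have hδ : 0 < δ := mul_pos (rootForm_root_pos k₀)
    (Int.fract_pos.2 fun h => hp k₀ _ h)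
  have key : ∀ N : ℕ, ∀ ν ∈ rootLattice P, P.RootForm (p - ν) (p - ν) < N * δ →
      ∃ ν ∈ rootLattice P, ∀ k, P.toLinearMap (p - ν) (P.coroot k) < 1 := by
    intro N
    induction N with
    | zero =>
      intro ν _ h
      have h0 : 0 ≤ P.RootForm (p - ν) (p - ν) := by
        rw [P.rootForm_apply_apply]
        exact Finset.sum_nonneg fun i _ => mul_self_nonneg _
      rw [Nat.cast_zero, zero_mul] at h
      exact absurd h0 (not_le.2 h)
    | succ N ih =>
      intro ν hν h
      by_cases hk : ∀ k, P.toLinearMap (p - ν) (P.coroot k) < 1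
      · exact ⟨ν, hν, hk⟩
      · push Not at hk
        obtain ⟨k, hk⟩ := hk
        -- If $c=\langle p-\nu,\alpha^\vee\rangle\ge1$, subtracting $\alpha$ lowers the squared
        -- length by $|\alpha|^2(c-1)$. Since $c-1\ge0$ is congruent to $\langle
        -- p,\alpha^\vee\rangle$ modulo $\mathbb Z$, it is at least the fractional part of the
        -- latter.
        refine ih (ν + P.root k) (add_mem hν (root_mem_rootLattice k)) ?_
        obtain ⟨m, hm⟩ := exists_int_of_mem_rootLattice hν k
        have h1 : Int.fract (P.toLinearMap p (P.coroot k)) ≤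
            P.toLinearMap (p - ν) (P.coroot k) - 1 := by
          rw [map_sub, LinearMap.sub_apply, hm] at hk ⊢
          rw [← Int.fract_sub_intCast _ (m + 1)]
          have h2 : P.toLinearMap p (P.coroot k) - ((m + 1 : ℤ) : ℝ) =
            P.toLinearMap p (P.coroot k) - m - 1 := by push_cast; ring
          rw [h2, Int.fract, sub_le_self_iff]
          exact_mod_cast Int.floor_nonneg.2 (by linarith)
        have h3 := two_mul_rootForm (P := P) (p - ν) k
        have h4 := hk₀ k
        have h5 := mul_le_mul_of_nonneg_left h1 (rootForm_root_pos (P := P) k).le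
        have h6 : P.RootForm (p - ν) (P.root k) = P.RootForm (P.root k) (p - ν) :=
          P.rootForm_symmetric.eq _ _
        have h7 : P.RootForm (p - (ν + P.root k)) (p - (ν + P.root k)) =
            P.RootForm (p - ν) (p - ν) - 2 * P.RootForm (P.root k) (p - ν) +
              P.RootForm (P.root k) (P.root k) := by
          rw [← sub_sub]
          generalize p - ν = u at h6 ⊢
          rw [map_sub, map_sub, LinearMap.sub_apply, LinearMap.sub_apply, h6]
          ring
        rw [h7, h3]
        push_cast at h
        linarith
  obtain ⟨N, hN⟩ := exists_nat_gt (P.RootForm (p - 0) (p - 0) / δ)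
  exact key N 0 (zero_mem _) ((div_lt_iff₀ hδ).1 hN)

theorem toLinearMap_coroot_negIdx (v : V) (k : ι) :
    P.toLinearMap v (P.coroot (negIdx P k)) = -P.toLinearMap v (P.coroot k) := by
  rw [coroot_negIdx, map_neg]

/-- An element of the Weyl group that moves a vector with non-integral values on all coroots by an
element of the root lattice is trivial. -/
theorem eq_one_of_smul_sub_mem_rootLattice [Finite ι] [P.IsRootSystem] [P.IsCrystallographic]
    (B : SimpleSystem P n) {p : V} (hp : ∀ k, ∀ m : ℤ, P.toLinearMap p (P.coroot k) ≠ m)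
    {g : P.weylGroup} (hg : g • p - p ∈ rootLattice P) : g = 1 := by
  obtain ⟨ν, hν, h⟩ := exists_sub_mem_rootLattice hp
  have h' : ∀ k, -1 < P.toLinearMap (p - ν) (P.coroot k) := by
    intro k
    have := h (negIdx P k)
    rw [toLinearMap_coroot_negIdx] at this
    linarith
  refine eq_one_of_smul_eq_self B (p := p - ν) (fun k h0 => ?_) ?_
  · obtain ⟨m, hm⟩ := exists_int_of_mem_rootLattice hν k
    rw [map_sub, LinearMap.sub_apply, sub_eq_zero, hm] at h0
    exact hp k m h0
  -- The vector $g(p-\nu)-(p-\nu)$ lies in the root lattice, and its value on each coroot is a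
  -- difference of two numbers in $(-1,1)$, hence less than $2$.
  · rw [← sub_eq_zero]
    refine eq_zero_of_mem_rootLattice (P := P) ?_ fun k => ?_
    · have h1 : g • (p - ν) - (p - ν) = g • p - p - g • ν + ν := by rw [smul_sub]; abel
      rw [h1]
      exact add_mem (sub_mem hg (smul_mem_rootLattice g hν)) hν
    · rw [map_sub, LinearMap.sub_apply, toLinearMap_smul_coroot]
      linarith [h (g⁻¹ • k), h' k]

end CalibratedHecke

namespace CalibratedHecke
open RootPairing MulOpposite

/-! ### Weights for the coweight lattice -/

theorem finite_setOf_quadratic_eq_zero {a b c : ℝ} (h : a ≠ 0 ∨ b ≠ 0 ∨ c ≠ 0) :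
    {ε : ℝ | a + ε * b + ε ^ 2 * c = 0}.Finite := by
  let f : Polynomial ℝ := Polynomial.C a + Polynomial.C b * Polynomial.X +
    Polynomial.C c * Polynomial.X ^ 2
  have hf : f ≠ 0 := by
    intro h0
    have h1 := congrArg (Polynomial.coeff · 0) h0
    have h2 := congrArg (Polynomial.coeff · 1) h0
    have h3 := congrArg (Polynomial.coeff · 2) h0
    simp [f, Polynomial.coeff_X, Polynomial.coeff_C] at h1 h2 h3
    rcases h with h | h | h
    · exact h h1
    · exact h h2
    · exact h h3
  refine f.roots.toFinset.finite_toSet.subset fun ε hε => ?_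
  rw [Finset.mem_coe, Multiset.mem_toFinset, Polynomial.mem_roots hf, Polynomial.IsRoot.def]
  simp only [f, Polynomial.eval_add, Polynomial.eval_mul, Polynomial.eval_C, Polynomial.eval_X,
    Polynomial.eval_pow]
  rw [← hε.out]
  ring

/-- Every condition excludes only the zeros of a nonzero polynomial, so countably many conditions
cannot exhaust $\mathbb R$. -/
theorem exists_forall_quadratic_ne_int {κ : Type*} [Finite κ] {a b c : κ → ℝ}
    (h : ∀ k, (∀ m : ℤ, a k ≠ m) ∨ b k ≠ 0 ∨ c k ≠ 0) :
    ∃ ε : ℝ, ∀ k, ∀ m : ℤ, a k + ε * b k + ε ^ 2 * c k ≠ m := by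
  by_contra! hc
  apply Cardinal.not_countable_real
  have h1 : (Set.univ : Set ℝ) ⊆
      ⋃ k, ⋃ m : ℤ, {ε : ℝ | (a k - m) + ε * b k + ε ^ 2 * c k = 0} := by
    intro ε _
    obtain ⟨k, m, hkm⟩ := hc ε
    refine Set.mem_iUnion₂.2 ⟨k, m, ?_⟩
    change a k - m + ε * b k + ε ^ 2 * c k = 0
    linarith
  refine (Set.countable_iUnion fun k => Set.countable_iUnion fun m => ?_).mono h1
  refine (finite_setOf_quadratic_eq_zero ?_).countable
  exact (h k).imp_left fun h' => sub_ne_zero.2 (h' m)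

variable {ι V V' : Type*} [AddCommGroup V] [Module ℝ V] [AddCommGroup V'] [Module ℝ V']
  {P : RootPairing ι ℝ V V'} {n : ℕ} (B : SimpleSystem P n) [P.IsRootSystem]

/-- A strictly dominant vector. -/
theorem exists_pos_iff_ht_pos [Finite ι] :
    ∃ v : V, ∀ k, 0 < B.ht (P.root k) → 0 < P.toLinearMap v (P.coroot k) := by
  have := Fintype.ofFinite ι
  have := Module.Finite.of_basis B.basis
  -- The height functional is turned into a vector by the invariant form.
  refine ⟨(P.RootForm.toDual P.rootForm_nondegenerate).symm B.ht, fun k hk => ?_⟩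
  rw [← rootForm_pos_iff, ← P.rootForm_symmetric.eq, RingHom.id_apply,
    LinearMap.BilinForm.apply_toDual_symm_apply]
  exact hk

/-- A strictly dominant vector is averaged over the powers of $g$; these permute $D$, so every
summand stays positive on it. -/
theorem exists_smul_eq_self_and_pos [Finite ι] {D : Set ι} (hD : ∀ k ∈ D, 0 < B.ht (P.root k))
    {g : P.weylGroup} (hg : ∀ k ∈ D, g • k ∈ D) :
    ∃ v : V, g • v = v ∧ ∀ k ∈ D, 0 < P.toLinearMap v (P.coroot k) := by
  obtain ⟨v₀, hv₀⟩ := exists_pos_iff_ht_pos B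
  refine ⟨∑ j ∈ Finset.range (orderOf g), g ^ j • v₀, ?_, fun k hk => ?_⟩
  · rw [Finset.smul_sum]
    have h1 := Finset.sum_range_succ (fun j => g ^ j • v₀) (orderOf g)
    rw [Finset.sum_range_succ', pow_orderOf_eq_one, pow_zero] at h1
    rw [← add_right_cancel h1]
    refine Finset.sum_congr rfl fun j _ => ?_
    rw [smul_smul, pow_succ']
  · rw [map_sum, LinearMap.sum_apply]
    refine Finset.sum_pos (fun j _ => ?_) ⟨0, Finset.mem_range.2 (orderOf_pos g)⟩
    rw [toLinearMap_smul_coroot]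
    have h1 : (g ^ j)⁻¹ ∈ Submonoid.powers g :=
      mem_powers_iff_mem_zpowers.2 (inv_mem (pow_mem (Subgroup.mem_zpowers g) j))
    obtain ⟨i, hi⟩ := h1
    have h2 : ∀ i : ℕ, g ^ i • k ∈ D := by
      intro i
      induction i with
      | zero => rwa [pow_zero, one_smul]
      | succ i ih => rw [pow_succ', mul_smul]; exact hg _ ih
    rw [← hi]
    exact hv₀ _ (hD _ (h2 i))

/-- The fundamental coweights. -/
theorem exists_fundamentalCoweight (i : Fin n) :
    ∃ ω : V', ∀ v : V, P.toLinearMap v ω = B.basis.coord i v := by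
  obtain ⟨ω, hω⟩ := P.flip.toLinearMap.toPerfPair.surjective (B.basis.coord i)
  refine ⟨ω, fun v => ?_⟩
  rw [← hω]
  rfl

variable {L : TranslationLattice P}



theorem exists_fundamentalCoweight_mem (hL : L.carrier = coweightLattice P) (i : Fin n) :
    ∃ ω : L.carrier, ∀ v : V, P.toLinearMap v ω = B.basis.coord i v := by
  obtain ⟨ω, hω⟩ := exists_fundamentalCoweight B i
  refine ⟨⟨ω, ?_⟩, hω⟩
  rw [hL]
  intro k
  rw [hω]
  exact B.exists_int_coord k i

theorem eq_zero_of_forall_lattice (B : SimpleSystem P n)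
    (hL : L.carrier = coweightLattice P)
    {v : V} (h : ∀ μ : L.carrier, P.toLinearMap v μ = 0) : v = 0 := by
  rw [B.root_eq_sum_coord v]
  refine Finset.sum_eq_zero fun i _ => ?_
  obtain ⟨ω, hω⟩ := exists_fundamentalCoweight_mem B hL i
  rw [← hω, h, zero_smul]

/-- The coordinates in the simple roots are the values on the fundamental coweights. These belong to
$L$ because $L=P$; for a smaller $L$ the dual lattice can exceed the root lattice. -/
theorem mem_rootLattice_of_forall_lattice (B : SimpleSystem P n)
    (hL : L.carrier = coweightLattice P) {v : V}
    (h : ∀ μ : L.carrier, ∃ m : ℤ, P.toLinearMap v μ = m) : v ∈ rootLattice P := by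
  rw [B.root_eq_sum_coord v]
  refine sum_mem fun i _ => ?_
  obtain ⟨ω, hω⟩ := exists_fundamentalCoweight_mem B hL i
  obtain ⟨m, hm⟩ := h ω
  rw [← hω, hm, Int.cast_smul_eq_zsmul]
  exact zsmul_mem (root_mem_rootLattice _) m

/-- The logarithm of a character of the coweight lattice. -/
theorem exists_log (B : SimpleSystem P n)
    (hL : L.carrier = coweightLattice P) (t : AddChar L.carrier ℂ) :
    ∃ x y : V, ∀ μ : L.carrier,
    t μ = 1 ↔ (∃ m : ℤ, P.toLinearMap x μ = m) ∧ P.toLinearMap y μ = 0 := by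
  choose ω hω using exists_fundamentalCoweight_mem B hL
  let θ : Fin n → ℂ := fun i => Complex.log (t (ω i))
  have hθ : ∀ i, Complex.exp (θ i) = t (ω i) := fun i => Complex.exp_log (char_ne_zero t (ω i))
  -- With these choices $t^\mu=\exp(\langle\mu,y\rangle+2\pi i\langle\mu,x\rangle)$.
  refine ⟨∑ i, ((θ i).im / (2 * Real.pi)) • P.root (B.simple i),
    ∑ i, (θ i).re • P.root (B.simple i), fun μ => ?_⟩
  have hμ : μ = ∑ i, L.pair (B.simple i) μ • ω i := by
    apply Subtype.ext
    apply P.flip.toLinearMap.toPerfPair.injective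
    ext v
    change P.toLinearMap v μ = P.toLinearMap v (∑ i, L.pair (B.simple i) μ • ω i : L.carrier)
    rw [AddSubgroup.val_finsetSum, map_sum]
    conv_lhs => rw [B.root_eq_sum_coord v]
    rw [map_sum, LinearMap.sum_apply]
    refine Finset.sum_congr rfl fun i _ => ?_
    rw [LinearMap.map_smul, LinearMap.smul_apply, L.pair_spec, AddSubgroup.coe_zsmul,
      map_zsmul, hω, zsmul_eq_mul, smul_eq_mul, mul_comm]
  have ht : t μ = Complex.exp (∑ i, L.pair (B.simple i) μ * θ i) := by
    rw [Complex.exp_sum]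
    conv_lhs => rw [hμ]
    change t.toMonoidHom (Multiplicative.ofAdd (∑ i, L.pair (B.simple i) μ • ω i)) = _
    rw [ofAdd_sum, map_prod]
    refine Finset.prod_congr rfl fun i _ => ?_
    change t (L.pair (B.simple i) μ • ω i) = _
    rw [AddChar.map_zsmul_eq_zpow, Complex.exp_int_mul, hθ]
  have hre : (∑ i, (L.pair (B.simple i) μ : ℂ) * θ i).re =
      P.toLinearMap (∑ i, (θ i).re • P.root (B.simple i)) μ := by
    rw [map_sum, LinearMap.sum_apply, Complex.re_sum]
    refine Finset.sum_congr rfl fun i _ => ?_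
    rw [LinearMap.map_smul, LinearMap.smul_apply, L.pair_spec, smul_eq_mul]
    simp [mul_comm]
  have him : (∑ i, (L.pair (B.simple i) μ : ℂ) * θ i).im = 2 * Real.pi *
      P.toLinearMap (∑ i, ((θ i).im / (2 * Real.pi)) • P.root (B.simple i)) μ := by
    rw [map_sum, LinearMap.sum_apply, Complex.im_sum, Finset.mul_sum]
    refine Finset.sum_congr rfl fun i _ => ?_
    rw [LinearMap.map_smul, LinearMap.smul_apply, L.pair_spec, smul_eq_mul]
    have := Real.pi_ne_zero
    simp
    field_simp
  rw [ht, Complex.exp_eq_one_iff, ← hre]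
  generalize P.toLinearMap (∑ i, ((θ i).im / (2 * Real.pi)) • P.root (B.simple i)) μ = X at him ⊢
  have hpi : 2 * Real.pi ≠ 0 := mul_ne_zero two_ne_zero Real.pi_ne_zero
  constructor
  · rintro ⟨m, hm⟩
    refine ⟨⟨m, ?_⟩, ?_⟩
    · rw [hm] at him
      simp at him
      exact mul_left_cancel₀ hpi (by rw [← him, mul_comm])
    · rw [hm]; simp
  · rintro ⟨⟨m, hm⟩, h0⟩
    refine ⟨m, Complex.ext ?_ ?_⟩
    · rw [h0]; simp
    · rw [him, hm]; simp; ring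

variable {B} [Finite ι] [P.IsCrystallographic] {q : ParameterSystem B} {J : Set ι}
  {t : AddChar L.carrier ℂ}

/-- The stabilizer of $t$ may be nontrivial, but its elements that preserve $D(t)$ are not: a
$g$-fixed vector positive on $D(t)$ pushes the logarithm of $t$ off the remaining walls without
leaving its class modulo the root lattice under $g$. -/
theorem eq_of_tw_eq (hL : L.carrier = coweightLattice P)
    {w w' : P.weylGroup} (hw : w ∈ setF q L J t) (hw' : w' ∈ setF q L J t)
    (h : L.tw w t = L.tw w' t) : w = w' := by
  set g := w⁻¹ * w' with hgdef
  have hwg : w' = w * g := by rw [hgdef, mul_inv_cancel_left]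
  have hgt : L.tw g t = t := by
    rw [hgdef, L.tw_mul, ← h, ← L.tw_mul, inv_mul_cancel, L.tw_one]
  have hgt' : L.tw g⁻¹ t = t := by
    conv_lhs => rw [← hgt, ← L.tw_mul, inv_mul_cancel, L.tw_one]
  have hpos : ∀ u ∈ setF q L J t, ∀ k ∈ setD B L t, 0 < B.ht (P.root (u • k)) := by
    intro u hu k hk
    by_contra hneg
    have h1 := B.mem_R0pos.1 hk.1
    have h2 : k ∈ B.inversionSet u⁻¹ ∩ setD B L t :=
      ⟨B.mem_inversionSet.2 ⟨h1.1, h1.2,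
        lt_of_le_of_ne (not_lt.1 hneg) (B.ht_root_ne_zero _)⟩, hk⟩
    rw [hu.2] at h2
    exact h2
  have hmem : ∀ k, k ∈ setD B L t ↔
      (k ∈ R0 P ∧ 0 < B.ht (P.root k)) ∧ t (L.coroot k) = 1 := fun k =>
    and_congr B.mem_R0pos (eval_dElt_eq_zero_iff L t k)
  have hneg : ∀ k ∈ R0 P, t (L.coroot k) = 1 → k ∈ setD B L t ∨ negIdx P k ∈ setD B L t := by
    intro k hk hk1
    rcases lt_or_gt_of_ne (B.ht_root_ne_zero k) with h0 | h0
    · refine Or.inr ((hmem _).2 ⟨⟨negIdx_mem_R0 hk, ?_⟩, ?_⟩)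
      · rw [root_negIdx, map_neg]; exact neg_pos.2 h0
      · rw [L.coroot_negIdx, AddChar.map_neg_eq_inv, hk1, inv_one]
    · exact Or.inl ((hmem _).2 ⟨⟨hk, h0⟩, hk1⟩)
  have hgD : ∀ k ∈ setD B L t, g • k ∈ setD B L t := by
    intro k hk
    have h1 := (hmem k).1 hk
    have h2 : t (L.coroot (g • k)) = 1 := by
      have := L.tw_coroot g⁻¹ t k
      rw [hgt', inv_inv] at this
      rw [← this, h1.2]
    -- If $-g\alpha$ were in $D(t)$, then $w$ would keep it positive and $w'\alpha=wg\alpha$ would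
    -- be negative, although $w'$ keeps $\alpha\in D(t)$ positive.
    rcases hneg _ (smul_mem_R0 g h1.1.1) h2 with h3 | h3
    · exact h3
    · have h4 := hpos w hw _ h3
      have h5 := hpos w' hw' k hk
      rw [smul_negIdx, ← mul_smul, ← hwg, root_negIdx, map_neg] at h4
      linarith
  obtain ⟨v, hgv, hv⟩ := exists_smul_eq_self_and_pos B (fun k hk => ((hmem k).1 hk).1.2) hgD
  obtain ⟨x, y, hxy⟩ := exists_log B hL t
  have hact : ∀ (u : V) (μ : L.carrier),
      P.toLinearMap (g • u - u) μ = P.toLinearMap u (L.act g⁻¹ μ - μ : L.carrier) := by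
    intro u μ
    rw [map_sub, LinearMap.sub_apply, toLinearMap_smul, AddSubgroup.coe_sub, map_sub]
    congr 2
    change _ = op ((g⁻¹⁻¹ : P.weylGroup) : P.Aut) • (μ : V')
    rw [inv_inv]
  have hone : ∀ μ : L.carrier, t (L.act g⁻¹ μ - μ) = 1 := by
    intro μ
    rw [AddChar.map_sub_eq_div, ← L.tw_apply, hgt, div_self (char_ne_zero t μ)]
  have hgy : g • y = y := by
    rw [← sub_eq_zero]
    refine eq_zero_of_forall_lattice B hL fun μ => ?_
    rw [hact]
    exact ((hxy _).1 (hone μ)).2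
  have hgx : g • x - x ∈ rootLattice P := by
    refine mem_rootLattice_of_forall_lattice B hL fun μ => ?_
    rw [hact]
    exact ((hxy _).1 (hone μ)).1
  -- If $\langle x,\alpha^\vee\rangle$ is integral and $\langle y,\alpha^\vee\rangle=0$, then
  -- $t^{\alpha^\vee}=1$, so $\pm\alpha\in D(t)$ and $v$ does not vanish on $\alpha^\vee$. Hence
  -- none of the quadratics in $\varepsilon$ is an integral constant.
  obtain ⟨ε, hε⟩ := exists_forall_quadratic_ne_int (κ := R0 P)
    (a := fun k => P.toLinearMap x (P.coroot k)) (b := fun k => P.toLinearMap y (P.coroot k))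
    (c := fun k => P.toLinearMap v (P.coroot k)) (by
      rintro ⟨k, hk⟩
      by_contra! hc
      obtain ⟨⟨m, hm⟩, h0, h1⟩ := hc
      rcases hneg k hk ((hxy (L.coroot k)).2 ⟨⟨m, hm⟩, h0⟩) with h3 | h3
      · exact (hv k h3).ne' h1
      · have h4 := hv _ h3
        rw [toLinearMap_coroot_negIdx] at h4
        simp only at h1
        linarith)
  have hp : ∀ k ∈ R0 P, ∀ m : ℤ,
      P.toLinearMap (x + ε • y + ε ^ 2 • v) (P.coroot k) ≠ m := by
    intro k hk m
    have := hε ⟨k, hk⟩ m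
    simpa only [map_add, LinearMap.map_smul, LinearMap.add_apply, LinearMap.smul_apply,
      smul_eq_mul] using this
  have hg1 : g = 1 := by
    refine eq_one_of_smul_sub_mem_rootLattice B (p := x + ε • y + ε ^ 2 • v) (fun k m hkm => ?_) ?_
    · by_cases hk : k ∈ R0 P
      · exact hp k hk m hkm
      -- A root outside $R_0$ is twice a root of $R_2$, whose coroot is twice as long, so an
      -- integral value on the former gives an integral value on the latter.
      · have hk2 : ∃ l, P.root k = (2 : ℝ) • P.root l := by
          by_contra! hc
          by_cases h2 : k ∈ R2 P
          · exact hk (Or.inr h2)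
          · refine hk (Or.inl ⟨hc, fun l hl => h2 ⟨l, hl⟩⟩)
        obtain ⟨l, hl⟩ := hk2
        have : IsAddTorsionFree V' := .of_isTorsionFree ℝ V'
        have h1 := P.smul_coroot_eq_of_root_eq_smul l k 2 hl
        refine hp l (Or.inr ⟨k, hl⟩) (2 * m) ?_
        rw [← h1, map_smul, hkm, smul_eq_mul]
        push_cast
        rfl
    · have h1 : g • (x + ε • y + ε ^ 2 • v) - (x + ε • y + ε ^ 2 • v) = g • x - x := by
        rw [smul_add, smul_add, smul_comm g ε, smul_comm g (ε ^ 2), hgy, hgv]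
        abel
      rw [h1]
      exact hgx
  rw [hwg, hg1, mul_one]


end CalibratedHecke

/-! ### The main theorem. -/

open CalibratedHecke in
theorem mainTheorem1 {ι V V' : Type*} [Finite ι] [AddCommGroup V] [Module ℝ V]
    [AddCommGroup V'] [Module ℝ V'] (P : RootPairing ι ℝ V V') [P.IsRootSystem]
    [P.IsCrystallographic] [P.IsIrreducible] {n : ℕ} (B : SimpleSystem P n)
    (q : ParameterSystem B) (L : TranslationLattice P) (t : AddChar L.carrier ℂ) (J : Set ι)
    (hJ : J ⊆ setN B q L t) (hF : (setF q L J t).Nonempty)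
    (hcal : ∀ w ∈ setF q L J t, ∀ i j : Fin n, IsCalibratable q L i j (L.tw w t)) :
    (∀ w ∈ setF q L J t, ∀ i, L.eval (L.tw w t) (dElt L (B.simple i)) ≠ 0) ∧
    ∃ ρ : Hecke q L →ₐ[ℂ] Module.End ℂ (ModuleSpace q L J t),
      (∀ i, ρ (Hecke.T q L i) = opT q L J t i) ∧
      (∀ v, ρ (Hecke.X q L v) = opX q L J t v) ∧
      ((∀ w ∈ setF q L J t, ∀ w' ∈ setF q L J t, w ≠ w' → L.tw w t ≠ L.tw w' t) →
        IsIrreducibleRep ρ) ∧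
      (L.carrier = coweightLattice P → IsIrreducibleRep ρ) := by
  have hd : ∀ w ∈ setF q L J t, ∀ i, L.tw w t (L.coroot (B.simple i)) ≠ 1 :=
    fun w hw i => coroot_ne_one_of_isCalibratable (hcal w hw i i)
  refine ⟨fun w hw i => mt (eval_dElt_eq_zero_iff L _ _).1 (hd w hw i), heckeRep q L J t hcal,
    heckeRep_T hcal, heckeRep_X hcal, fun hdist => ?_, fun hL => ?_⟩
  · exact isIrreducibleRep_of_injective_weights hd hF hdist (heckeRep_T hcal) (heckeRep_X hcal)
  · exact isIrreducibleRep_of_injective_weights hd hF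
      (fun w hw w' hw' hne h => hne (eq_of_tw_eq hL hw hw' h)) (heckeRep_T hcal) (heckeRep_X hcal)
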